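/- Let $\Omega=(a,b)$ be a finite interval, $0<\alpha<1$, $1<p<\infty$, $\alpha p>1$, $0\le\theta\le 1$ and $\lambda\in\{0,1\}$. Definitions. For $\beta>0$ let ${}^-I^{\beta}u(x)=\frac1{\Gamma(\beta)}\int_a^x (x-y)^{\beta-1}u(y)\,dy$ and ${}^+I^{\beta}u(x)=\frac1{\Gamma(\beta)}\int_x^b (y-x)^{\beta-1}u(y)\,dy$, and for $\varphi\in C_0^\infty(\Omega)$ let ${}^-D^{\alpha}\varphi=\frac{d}{dx}{}^-I^{1-\alpha}\varphi$ and ${}^+D^{\alpha}\varphi=-\frac{d}{dx}{}^+I^{1-\alpha}\varphi$. For $u\in L^1(\Omega)$, a function $v\in L^1_{loc}(\Omega)$ is the left (right) weak fractional derivative ${}^{-}\mathcal D^\alpha u$ (${}^{+}\mathcal D^\alpha u$) if $\int_\Omega v\varphi\,dx=\int_\Omega u\,{}^{\pm}D^\alpha\varphi\,dx$ for all $\varphi\in C_0^\infty(\Omega)$, with ${}^+D^\alpha$ for the left and ${}^-D^\alpha$ for the right derivative. Let ${}^{\pm}W^{\alpha,p}=\{u\in L^p(\Omega):{}^{\pm}\mathcal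 D^\alpha u\in L^p(\Omega)\}$, and let ${}^{\pm}\mathring W^{\alpha,p}$ be the subspace on which $c_{\pm}^{1-\alpha}=0$, where $c_-^{1-\alpha}={}^-I^{1-\alpha}u(a)/\Gamma(1-\alpha)$ and $c_+^{1-\alpha}={}^+I^{1-\alpha}u(b)/\Gamma(1-\alpha)$ (values at the end points of the versions continuous up to that end point). Put $$\mathcal W^{\alpha,p}_{\theta,\lambda}=\begin{cases}{}^-\mathring W^{\alpha,p}&\theta=0,\ \lambda=0\\ {}^-W^{\alpha,p}&\theta=0,\ \lambda=1\\ {}^-W^{\alpha,p}\cap{}^+W^{\alpha,p}&0<\theta<1\\ {}^+\mathring W^{\alpha,p}&\theta=1,\ \lambda=0\\ {}^+W^{\alpha,p}&\theta=1,\ \lambda=1\end{cases}$$ and let ${}_0\mathcal W^{\alpha,p}_{\theta,\lambda}$ be the set of $u\in\mathcal W^{\alpha,p}_{\theta,\lambda}$ with $u(b)=0$ if $\theta<1$ and $u(a)=0$ if $\theta>0$, where $u(b)$, $u(a)$ are the values of the versions of $u$ continuous on $(a,b]$, respectively on $[a,b)$. Theorem. Let $L:\mathbb R^3\times\Omega\to\mathbb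 R$, $L=L(a_1,a_2,s,x)$, satisfy: 1. $L(a_1,a_2,s,x)=L_p((1-\theta)a_1,\theta a_2,s,x)$ for some function $L_p$ (that is, $L$ does not depend on $a_2$ if $\theta=0$, nor on $a_1$ if $\theta=1$); 2. $L$ is continuously differentiable on $\mathbb R^3\times\Omega$, bounded from below, and convex in $(a_1,a_2)$ for all fixed $(s,x)$; 3. there are continuous functions $L^1,L^2:\mathbb R^2\times\Omega\to\mathbb R$ with $\frac{\partial L}{\partial a_1}(a_1,a_2,s,x)=L^1(a_1,s,x)$ and $\frac{\partial L}{\partial a_2}(a_1,a_2,s,x)=L^2(a_2,s,x)$; 4. there are $c_0>0$ and $c_1\ge0$ with $L(a_1,a_2,s,x)\ge\frac{c_0}{2}\bigl((1-\theta)|a_1|^p+\theta|a_2|^p+\lambda|s|^p\bigr)-c_1$ for all $(a_1,a_2,s,x)\in\mathbb R^3\times\Omega$. Then the energy $$\mathcal E(v)=\int_\Omega L\bigl({}^-\mathcal D^\alpha v(x),{}^+\mathcal D^\alpha v(x),v(x),x\bigr)\,dx\in(-\infty,+\infty]$$ (in which, if $\theta\in\{0,1\}$, the derivative on which $L$ does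 not depend plays no role) attains its minimum over ${}_0\mathcal W^{\alpha,p}_{\theta,\lambda}$: there is $u\in{}_0\mathcal W^{\alpha,p}_{\theta,\lambda}$ with $\mathcal E(u)\le\mathcal E(v)$ for all $v\in{}_0\mathcal W^{\alpha,p}_{\theta,\lambda}$. -/

import Mathlib

open Set Filter Topology MeasureTheory
open scoped ENNReal ContDiff

noncomputable section

namespace FracVar

/-- Left Riemann-Liouville fractional integral of order `β` on `(a, b)`:
`(1 / Γ(β)) ∫_a^x (x - y)^(β - 1) u(y) dy`. -/
def leftRLIntegral (a β : ℝ) (u : ℝ → ℝ) (x : ℝ) : ℝ :=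
  (1 / Real.Gamma β) * ∫ y in a..x, (x - y) ^ (β - 1) * u y

/-- Right Riemann-Liouville fractional integral of order `β` on `(a, b)`:
`(1 / Γ(β)) ∫_x^b (y - x)^(β - 1) u(y) dy`. -/
def rightRLIntegral (b β : ℝ) (u : ℝ → ℝ) (x : ℝ) : ℝ :=
  (1 / Real.Gamma β) * ∫ y in x..b, (y - x) ^ (β - 1) * u y

/-- Left Riemann-Liouville derivative of order `α ∈ (0, 1)` (used on test functions only). -/
def leftRLDeriv (a α : ℝ) (φ : ℝ → ℝ) (x : ℝ) : ℝ :=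
  deriv (leftRLIntegral a (1 - α) φ) x

/-- Right Riemann-Liouville derivative of order `α ∈ (0, 1)` (used on test functions only). -/
def rightRLDeriv (b α : ℝ) (φ : ℝ → ℝ) (x : ℝ) : ℝ :=
  -deriv (rightRLIntegral b (1 - α) φ) x

/-- `φ ∈ C_0^∞((a, b))`, extended by zero to the real line. -/
def IsTestFunction (a b : ℝ) (φ : ℝ → ℝ) : Prop :=
  ContDiff ℝ ∞ φ ∧ HasCompactSupport φ ∧ tsupport φ ⊆ Ioo a b

/-- `v` is a left weak fractional derivative of order `α ∈ (0, 1)` of `u` on `(a, b)`. -/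
def IsLeftWeakDeriv (a b α : ℝ) (u v : ℝ → ℝ) : Prop :=
  IntegrableOn u (Ioo a b) ∧ LocallyIntegrableOn v (Ioo a b) ∧
    ∀ φ : ℝ → ℝ, IsTestFunction a b φ →
      ∫ x in Ioo a b, v x * φ x = ∫ x in Ioo a b, u x * rightRLDeriv b α φ x

/-- `w` is a right weak fractional derivative of order `α ∈ (0, 1)` of `u` on `(a, b)`. -/
def IsRightWeakDeriv (a b α : ℝ) (u w : ℝ → ℝ) : Prop :=
  IntegrableOn u (Ioo a b) ∧ LocallyIntegrableOn w (Ioo a b) ∧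
    ∀ φ : ℝ → ℝ, IsTestFunction a b φ →
      ∫ x in Ioo a b, w x * φ x = ∫ x in Ioo a b, u x * leftRLDeriv a α φ x

open Classical in
/-- A version of the left weak fractional derivative (unique almost everywhere on `(a, b)`);
the zero function if there is none. -/
def leftWeakDeriv (a b α : ℝ) (u : ℝ → ℝ) : ℝ → ℝ :=
  if h : ∃ v, IsLeftWeakDeriv a b α u v then Classical.choose h else 0

open Classical in
/-- A version of the right weak fractional derivative (unique almost everywhere on `(a, b)`);
the zero function if there is none. -/
def rightWeakDeriv (a b α : ℝ) (u : ℝ → ℝ) : ℝ → ℝ :=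
  if h : ∃ w, IsRightWeakDeriv a b α u w then Classical.choose h else 0

/-- `u ∈ L^p((a, b))`. -/
def MemLpOn (a b p : ℝ) (u : ℝ → ℝ) : Prop :=
  MemLp u (ENNReal.ofReal p) (volume.restrict (Ioo a b))

/-- The left fractional Sobolev space (`0 < α < 1`): functions in `L^p((a, b))` with left weak
fractional derivative in `L^p((a, b))`. Elements are functions; values off a null set of `(a, b)`
play no role. -/
def leftSobolev (a b α p : ℝ) : Set (ℝ → ℝ) :=
  {u | MemLpOn a b p u ∧ ∃ v, IsLeftWeakDeriv a b α u v ∧ MemLpOn a b p v}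

/-- The right fractional Sobolev space (`0 < α < 1`). -/
def rightSobolev (a b α p : ℝ) : Set (ℝ → ℝ) :=
  {u | MemLpOn a b p u ∧ ∃ w, IsRightWeakDeriv a b α u w ∧ MemLpOn a b p w}

/-- `c` is the constant `(I^(1-α) u)(a) / Γ(1-α)` of `u`, for the left fractional integral. The value
at `a` is that of the version of the fractional integral that is continuous up to `a`. -/
def HasLeftConst (a b α : ℝ) (u : ℝ → ℝ) (c : ℝ) : Prop :=
  ∃ g : ℝ → ℝ, ContinuousOn g (Ico a b) ∧
    g =ᵐ[volume.restrict (Ioo a b)] leftRLIntegral a (1 - α) u ∧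
    c = g a / Real.Gamma (1 - α)

/-- `c` is the constant `(I^(1-α) u)(b) / Γ(1-α)` of `u`, for the right fractional integral. -/
def HasRightConst (a b α : ℝ) (u : ℝ → ℝ) (c : ℝ) : Prop :=
  ∃ g : ℝ → ℝ, ContinuousOn g (Ioc a b) ∧
    g =ᵐ[volume.restrict (Ioo a b)] rightRLIntegral b (1 - α) u ∧
    c = g b / Real.Gamma (1 - α)

/-- The subspace of the left fractional Sobolev space where the constant vanishes. -/
def leftRingSobolev (a b α p : ℝ) : Set (ℝ → ℝ) :=
  {u | u ∈ leftSobolev a b α p ∧ HasLeftConst a b α u 0}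

/-- The subspace of the right fractional Sobolev space where the constant vanishes. -/
def rightRingSobolev (a b α p : ℝ) : Set (ℝ → ℝ) :=
  {u | u ∈ rightSobolev a b α p ∧ HasRightConst a b α u 0}

/-- The two-parameter family of spaces, for `θ ∈ [0, 1]` and `lam ∈ {0, 1}`. -/
def fracSpace (a b α p θ lam : ℝ) : Set (ℝ → ℝ) :=
  if θ = 0 then
    if lam = 0 then leftRingSobolev a b α p else leftSobolev a b α p
  else if θ = 1 then
    if lam = 0 then rightRingSobolev a b α p else rightSobolev a b α p
  else leftSobolev a b α p ∩ rightSobolev a b α p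

/-- The trace at `x = b` (the one available in the left space) is `τ`: the value at `b` of the
version of `u` that is continuous on `(a, b]`. -/
def HasLeftTrace (a b : ℝ) (u : ℝ → ℝ) (τ : ℝ) : Prop :=
  ∃ g : ℝ → ℝ, ContinuousOn g (Ioc a b) ∧ g =ᵐ[volume.restrict (Ioo a b)] u ∧ g b = τ

/-- The trace at `x = a` (the one available in the right space) is `τ`: the value at `a` of the
version of `u` that is continuous on `[a, b)`. -/
def HasRightTrace (a b : ℝ) (u : ℝ → ℝ) (τ : ℝ) : Prop :=
  ∃ g : ℝ → ℝ, ContinuousOn g (Ico a b) ∧ g =ᵐ[volume.restrict (Ioo a b)] u ∧ g a = τ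

/-- The zero-trace space: the trace at `b` vanishes if `θ < 1`, the trace at `a` if `θ > 0`. -/
def zeroTraceSpace (a b α p θ lam : ℝ) : Set (ℝ → ℝ) :=
  {u | u ∈ fracSpace a b α p θ lam ∧
    (θ ≠ 1 → HasLeftTrace a b u 0) ∧ (θ ≠ 0 → HasRightTrace a b u 0)}

/-- The integral over `(a, b)` of a function whose negative part has finite integral, as an extended
real number: the integral of the positive part minus that of the negative part. -/
def extIntegral (a b : ℝ) (f : ℝ → ℝ) : EReal :=
  ((∫⁻ x in Ioo a b, ENNReal.ofReal (f x) : ℝ≥0∞) : EReal) -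
    ((∫⁻ x in Ioo a b, ENNReal.ofReal (-f x) : ℝ≥0∞) : EReal)

/-- The energy `∫ L(left derivative of v, right derivative of v, v, x) dx` over `(a, b)`. -/
def energy (a b α : ℝ) (L : ℝ → ℝ → ℝ → ℝ → ℝ) (v : ℝ → ℝ) : EReal :=
  extIntegral a b fun x => L (leftWeakDeriv a b α v x) (rightWeakDeriv a b α v x) (v x) x

end FracVar

end

noncomputable section

namespace FracVar

/-! ### Weak compactness of balls of `L^p` along an ultrafilter -/

section WeakCompactness

variable {X : Type*} [MeasurableSpace X] {μ : Measure X}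

/-! The proof is the direct method of the calculus of variations. A minimizing sequence has bounded
energy, so coercivity bounds in `L^p` each derivative that carries a positive weight, and a weak
limit of the derivatives exists (`exists_weak_limit`). All limits are taken along a nonprincipal
ultrafilter on `ℕ`, so no subsequence is ever extracted.

What links the derivative to the function is a fundamental theorem of calculus
(`IsLeftWeakDeriv.exists_eq_add`): if `v` is the left weak derivative of `u`, then `u = C (x - a)^(α
- 1) + I^α v` almost everywhere. Since `α p > 1`, the kernel `t^(α - 1)` is locally in the dual
space `L^q`. Hence `I^α` maps a ball of `L^p` to an equicontinuous family
(`exists_modulus_leftRLIntegral`) and turns weak convergence into uniform convergence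
(`tendstoUniformlyOn_leftRLIntegral`). The vanishing trace at `b` expresses `C` through `I^α v` at
`b`, so the coefficients converge as well. The functions therefore converge uniformly on compact
subintervals and the limit keeps the constraints (`exists_limit_leftSobolev`).

The energy is lower semicontinuous (`lintegral_le_of_weak_limit`) because convexity puts `L` above
its tangent planes in the derivative variables (`add_mul_sub_add_mul_sub_le`). At the limit, the
tangent plane is linear in the weakly convergent derivatives, and its coefficients depend
continuously on the locally uniformly convergent functions. `exists_isMinOn_of_sequential` combines
compactness and semicontinuity.

Everything about the right derivative comes from the left one by the reflection `x ↦ a + b - x`.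
When both derivatives occur, the two vanishing traces exclude the singular terms at both ends, and
pointwise convergence shows that the two weak limits are derivatives of one function. -/

theorem setLIntegral_le_of_lintegral_rpow_le [IsFiniteMeasure μ] {p q : ℝ}
    (hpq : p.HolderConjugate q) {f g : X → ℝ≥0∞} (hf : AEMeasurable f μ) (hg : AEMeasurable g μ)
    {M : ℝ≥0∞} (hb : ∫⁻ x, f x ^ p ∂μ ≤ M) :
    ∫⁻ x, g x * f x ∂μ ≤ M ^ (1 / p) * (∫⁻ x, g x ^ q ∂μ) ^ (1 / q) := by
  have h := ENNReal.lintegral_mul_le_Lp_mul_Lq μ hpq hf hg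
  simp only [Pi.mul_apply] at h
  simp_rw [mul_comm (g _)]
  refine h.trans ?_
  gcongr
  exact one_div_nonneg.2 hpq.nonneg

/-- Setwise limits of densities bounded in `L^p`, along an ultrafilter, form a measure. -/
theorem exists_measure_tendsto_setLIntegral [IsFiniteMeasure μ] {p q : ℝ}
    (hpq : p.HolderConjugate q) (𝒰 : Ultrafilter ℕ) {f : ℕ → X → ℝ≥0∞}
    (hf : ∀ n, AEMeasurable (f n) μ) {M : ℝ≥0∞} (hM : M ≠ ⊤)
    (hb : ∀ n, ∫⁻ x, f n x ^ p ∂μ ≤ M) :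
    ∃ ν : Measure X, ∀ A, MeasurableSet A →
      Tendsto (fun n => ∫⁻ x in A, f n x ∂μ) 𝒰 (𝓝 (ν A)) := by
  classical
  -- `ℝ≥0∞` is compact, so the image ultrafilter has a limit for every set `A` at once.
  let m : Set X → ℝ≥0∞ := fun A => (𝒰.map fun n => ∫⁻ x in A, f n x ∂μ).lim
  have hm : ∀ A, Tendsto (fun n => ∫⁻ x in A, f n x ∂μ) 𝒰 (𝓝 (m A)) := fun A =>
    (𝒰.map fun n => ∫⁻ x in A, f n x ∂μ).le_nhds_lim
  have hq0 : 0 < 1 / q := one_div_pos.2 hpq.symm.pos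
  -- Hölder against the indicator of `A`. The bound is uniform in `n`, and it is what lifts finite
  -- additivity of the limit to countable additivity.
  have hle : ∀ A, MeasurableSet A → m A ≤ M ^ (1 / p) * μ A ^ (1 / q) := by
    intro A hA
    refine le_of_tendsto' (hm A) fun n => ?_
    have h := setLIntegral_le_of_lintegral_rpow_le hpq (hf n)
      (g := A.indicator 1) ((measurable_const.indicator hA).aemeasurable) (hb n)
    have e1 : ∫⁻ x, A.indicator 1 x * f n x ∂μ = ∫⁻ x in A, f n x ∂μ := by
      rw [← lintegral_indicator hA]
      congr 1 with x
      by_cases hx : x ∈ A <;> simp [hx]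
    have e2 : ∫⁻ x, (A.indicator 1 x : ℝ≥0∞) ^ q ∂μ = μ A := by
      rw [← lintegral_indicator_one hA]
      congr 1 with x
      by_cases hx : x ∈ A <;> simp [hx, hpq.symm.pos]
    rwa [e1, e2] at h
  have hadd : ∀ A B, MeasurableSet B → Disjoint A B → m (A ∪ B) = m A + m B := by
    intro A B hB hAB
    refine tendsto_nhds_unique (hm (A ∪ B)) ?_
    simp_rw [lintegral_union hB hAB]
    exact (hm A).add (hm B)
  have h0 : m ∅ = 0 := by
    have := hle ∅ MeasurableSet.empty
    rwa [measure_empty, ENNReal.zero_rpow_of_pos hq0, mul_zero, nonpos_iff_eq_zero] at this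
  have hU : ∀ ⦃A : ℕ → Set X⦄ (_ : ∀ i, MeasurableSet (A i)),
      Pairwise (Function.onFun Disjoint A) → m (⋃ i, A i) = ∑' i, m (A i) := by
    -- The tails `R N` decrease to the empty set, so `μ (R N)` tends to 0 and, by `hle`, so does `m
    -- (R N)`. Finite additivity then leaves exactly the series.
    intro A hA hd
    let R : ℕ → Set X := fun N => ⋃ i, ⋃ (_ : N ≤ i), A i
    have hR : ∀ N, MeasurableSet (R N) := fun N =>
      MeasurableSet.iUnion fun i => MeasurableSet.iUnion fun _ => hA i
    have hsum : ∀ N, (∑ i ∈ Finset.range N, m (A i)) + m (R N) = m (⋃ i, A i) := by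
      intro N
      induction N with
      | zero => simp [R]
      | succ N ih =>
        rw [← ih, Finset.sum_range_succ, add_assoc, ← hadd _ _ (hR _)]
        · congr 2
          ext x
          simp only [R, mem_union, mem_iUnion, exists_prop]
          constructor
          · rintro (h | ⟨i, hi, h⟩)
            · exact ⟨N, le_rfl, h⟩
            · exact ⟨i, by omega, h⟩
          · rintro ⟨i, hi, h⟩
            rcases hi.eq_or_lt with rfl | hi
            · exact Or.inl h
            · exact Or.inr ⟨i, hi, h⟩
        · simp only [R, disjoint_iUnion_right]
          intro i hi
          exact hd (by omega)
    have hμ : Tendsto (fun N => μ (R N)) atTop (𝓝 0) := by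
      have h := tendsto_measure_iInter_atTop (μ := μ) (s := R)
        (fun i => (hR i).nullMeasurableSet) (fun i j hij => by
          refine iUnion_mono fun k => ?_
          exact iUnion_mono' fun hk => ⟨hij.trans hk, le_rfl⟩) ⟨0, measure_ne_top _ _⟩
      have e : ⋂ n, R n = ∅ := by
        ext x
        simp only [R, mem_iInter, mem_iUnion, exists_prop, mem_empty_iff_false, iff_false,
          not_forall]
        by_contra! hcon
        obtain ⟨i, -, hi⟩ := hcon 0
        obtain ⟨j, hj, hj'⟩ := hcon (i + 1)
        exact (hd (show i ≠ j by omega)).le_bot ⟨hi, hj'⟩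
      rw [e, measure_empty] at h
      exact h
    have hmR : Tendsto (fun N => m (R N)) atTop (𝓝 0) := by
      refine tendsto_of_tendsto_of_tendsto_of_le_of_le tendsto_const_nhds ?_
        (fun N => zero_le) (fun N => hle _ (hR N))
      have h1 : Tendsto (fun N => μ (R N) ^ (1 / q)) atTop (𝓝 0) := by
        have := (ENNReal.continuous_rpow_const (y := 1 / q)).tendsto 0 |>.comp hμ
        rwa [ENNReal.zero_rpow_of_pos hq0] at this
      have := ENNReal.Tendsto.const_mul (a := M ^ (1 / p)) h1
        (Or.inr (ENNReal.rpow_ne_top_of_nonneg (one_div_nonneg.2 hpq.nonneg) hM))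
      simpa using this
    have := (ENNReal.tendsto_nat_tsum fun i => m (A i)).add hmR
    simp_rw [hsum, add_zero] at this
    exact tendsto_nhds_unique tendsto_const_nhds this
  refine ⟨Measure.ofMeasurable (fun A _ => m A) h0 hU, fun A hA => ?_⟩
  rw [Measure.ofMeasurable_apply A hA]
  exact hm A

/-- The limit measure inherits the Hölder estimate, first against simple functions and then against
all measurable ones. This makes it finite and absolutely continuous, so Radon–Nikodym provides the
density; the `L^p` bound of the density follows by duality. -/
theorem exists_setLIntegral_limit [IsFiniteMeasure μ] {p q : ℝ}
    (hpq : p.HolderConjugate q) (𝒰 : Ultrafilter ℕ) {f : ℕ → X → ℝ≥0∞}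
    (hf : ∀ n, AEMeasurable (f n) μ) {M : ℝ≥0∞} (hM : M ≠ ⊤)
    (hb : ∀ n, ∫⁻ x, f n x ^ p ∂μ ≤ M) :
    ∃ v : X → ℝ≥0∞, Measurable v ∧ ∫⁻ x, v x ^ p ∂μ ≤ M ∧ ∀ A, MeasurableSet A →
      Tendsto (fun n => ∫⁻ x in A, f n x ∂μ) 𝒰 (𝓝 (∫⁻ x in A, v x ∂μ)) := by
  obtain ⟨ν, hν⟩ := exists_measure_tendsto_setLIntegral hpq 𝒰 hf hM hb
  have hp0 : 0 < p := hpq.pos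
  have hq0 : 0 < q := hpq.symm.pos
  have hsimple : ∀ φ : SimpleFunc X NNReal, (φ.map ((↑) : NNReal → ℝ≥0∞)).lintegral ν ≤
      M ^ (1 / p) * (∫⁻ x, (φ x : ℝ≥0∞) ^ q ∂μ) ^ (1 / q) := by
    intro φ
    have ht : Tendsto (fun n => ∫⁻ x, (φ x : ℝ≥0∞) * f n x ∂μ) 𝒰
        (𝓝 ((φ.map ((↑) : NNReal → ℝ≥0∞)).lintegral ν)) := by
      have e : ∀ n, ∫⁻ x, (φ x : ℝ≥0∞) * f n x ∂μ =
          (φ.map ((↑) : NNReal → ℝ≥0∞)).lintegral (μ.withDensity (f n)) := by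
        intro n
        rw [← SimpleFunc.lintegral_eq_lintegral,
          lintegral_withDensity_eq_lintegral_mul₀ (hf n) (SimpleFunc.measurable _).aemeasurable]
        simp [mul_comm]
      simp_rw [e, SimpleFunc.map_lintegral]
      refine tendsto_finsetSum _ fun y _ => ENNReal.Tendsto.const_mul ?_
        (Or.inr ENNReal.coe_ne_top)
      simp_rw [withDensity_apply _ (φ.measurableSet_fiber y)]
      exact hν _ (φ.measurableSet_fiber y)
    exact le_of_tendsto' ht fun n => setLIntegral_le_of_lintegral_rpow_le hpq (hf n)
      φ.measurable.coe_nnreal_ennreal.aemeasurable (hb n)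
  have hdual : ∀ g : X → ℝ≥0∞, Measurable g →
      ∫⁻ x, g x ∂ν ≤ M ^ (1 / p) * (∫⁻ x, g x ^ q ∂μ) ^ (1 / q) := by
    intro g hg
    rw [lintegral_eq_nnreal]
    refine iSup₂_le fun φ hφ => (hsimple φ).trans ?_
    gcongr
    exact hφ _
  have hac : ν ≪ μ := by
    refine Measure.AbsolutelyContinuous.mk fun A hA h0 => ?_
    have h := hdual (A.indicator 1) (measurable_const.indicator hA)
    rw [lintegral_indicator_one hA] at h
    have e2 : ∫⁻ x, (A.indicator 1 x : ℝ≥0∞) ^ q ∂μ = μ A := by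
      rw [← lintegral_indicator_one hA]
      congr 1 with x
      by_cases hx : x ∈ A <;> simp [hx, hq0]
    rw [e2, h0, ENNReal.zero_rpow_of_pos (one_div_pos.2 hq0), mul_zero] at h
    exact le_zero_iff.1 h
  have hfin : IsFiniteMeasure ν := by
    refine ⟨?_⟩
    have h := hdual 1 measurable_const
    simp only [Pi.one_apply, lintegral_const, one_mul, ENNReal.one_rpow] at h
    refine h.trans_lt (ENNReal.mul_lt_top ?_ ?_)
    · exact ENNReal.rpow_lt_top_of_nonneg (by positivity) hM
    · exact ENNReal.rpow_lt_top_of_nonneg (by positivity) (measure_ne_top _ _)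
  have hνv : μ.withDensity (ν.rnDeriv μ) = ν := Measure.withDensity_rnDeriv_eq ν μ hac
  set v := ν.rnDeriv μ with hv
  have hvm : Measurable v := Measure.measurable_rnDeriv ν μ
  refine ⟨v, hvm, ?_, fun A hA => ?_⟩
  -- The dual estimate is tested with `min v k ^ (p - 1)`, which gives `I ≤ M^(1/p) * I^(1/q)`.
  -- Truncation at `k` keeps `I` finite, so that `I^(1/q)` can be cancelled; monotone convergence
  -- removes `k` afterwards.
  · have key : ∀ k : ℕ, ∫⁻ x, (min (v x) k) ^ p ∂μ ≤ M := by
      intro k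
      have hmk : Measurable fun x => min (v x) (k : ℝ≥0∞) := hvm.min measurable_const
      set I := ∫⁻ x, (min (v x) k) ^ p ∂μ with hI
      have hItop : I ≠ ⊤ := by
        refine ne_of_lt (lt_of_le_of_lt (lintegral_mono (g := fun _ => (k : ℝ≥0∞) ^ p)
          fun x => ?_) ?_)
        · simp only
          gcongr
          exact min_le_right _ _
        · rw [lintegral_const]
          exact ENNReal.mul_lt_top (ENNReal.rpow_lt_top_of_nonneg hp0.le (ENNReal.natCast_ne_top k))
            (measure_lt_top _ _)
      have h := hdual (fun x => (min (v x) k) ^ (p - 1)) (hmk.pow_const _)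
      have e : ∀ x, ((min (v x) (k : ℝ≥0∞)) ^ (p - 1)) ^ q = (min (v x) k) ^ p := by
        intro x
        rw [← ENNReal.rpow_mul, hpq.sub_one_mul_conj]
      simp_rw [e] at h
      have h2 : I ≤ ∫⁻ x, (min (v x) k) ^ (p - 1) ∂ν := by
        rw [← hνv, lintegral_withDensity_eq_lintegral_mul _ hvm (hmk.pow_const _)]
        refine lintegral_mono fun x => ?_
        have : (min (v x) (k : ℝ≥0∞)) ^ p
            = min (v x) (k : ℝ≥0∞) * (min (v x) (k : ℝ≥0∞)) ^ (p - 1) := by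
          conv_lhs => rw [show p = 1 + (p - 1) by ring]
          rw [ENNReal.rpow_add_of_nonneg _ _ zero_le_one hpq.sub_one_pos.le, ENNReal.rpow_one]
        simp only [this, Pi.mul_apply]
        gcongr
        exact min_le_left _ _
      have h3 : I ≤ M ^ (1 / p) * I ^ (1 / q) := h2.trans h
      by_cases hI0 : I = 0
      · simp [hI0]
      have h4 : I ^ (1 / p) * I ^ (1 / q) = I := by
        rw [← ENNReal.rpow_add _ _ hI0 hItop, one_div, one_div, hpq.inv_add_inv_eq_one,
          ENNReal.rpow_one]
      nth_rewrite 1 [← h4] at h3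
      have h5 : I ^ (1 / p) ≤ M ^ (1 / p) := by
        refine (ENNReal.mul_le_mul_iff_left ?_ ?_).1 h3
        · simp [hI0, hq0.le]
        · exact ENNReal.rpow_ne_top_of_nonneg (by positivity) hItop
      exact (ENNReal.rpow_le_rpow_iff (one_div_pos.2 hp0)).1 h5
    have hmono : ∀ x, v x ^ p = ⨆ k : ℕ, (min (v x) (k : ℝ≥0∞)) ^ p := by
      intro x
      have ht : Tendsto (fun k : ℕ => (min (v x) (k : ℝ≥0∞)) ^ p) atTop (𝓝 (v x ^ p)) := by
        refine ((ENNReal.continuous_rpow_const (y := p)).tendsto _).comp ?_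
        have := (tendsto_const_nhds (x := v x)).min ENNReal.tendsto_nat_nhds_top
        simpa using this
      refine tendsto_nhds_unique ht (tendsto_atTop_iSup fun i j hij => ?_)
      gcongr
    simp_rw [hmono]
    rw [lintegral_iSup]
    · exact iSup_le key
    · exact fun k => (hvm.min measurable_const).pow_const _
    · intro i j hij x
      simp only
      gcongr
  · have := hν A hA
    rwa [← hνv, withDensity_apply _ hA] at this

/-- The nonnegative case is applied to the positive and the negative part, encoded as
`ENNReal.ofReal (s * v n x)` with `s = 1` and `s = -1`. -/
theorem exists_setIntegral_limit [IsFiniteMeasure μ] {p q : ℝ}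
    (hpq : p.HolderConjugate q) (𝒰 : Ultrafilter ℕ) {v : ℕ → X → ℝ}
    (hv : ∀ n, AEStronglyMeasurable (v n) μ) {M : ℝ≥0∞} (hM : M ≠ ⊤)
    (hb : ∀ n, ∫⁻ x, ‖v n x‖ₑ ^ p ∂μ ≤ M) :
    ∃ w : X → ℝ, MemLp w (ENNReal.ofReal p) μ ∧ ∀ A, MeasurableSet A →
      Tendsto (fun n => ∫ x in A, v n x ∂μ) 𝒰 (𝓝 (∫ x in A, w x ∂μ)) := by
  have hp0 : 0 < p := hpq.pos
  have hp1 : (1 : ℝ≥0∞) ≤ ENNReal.ofReal p := by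
    rw [← ENNReal.ofReal_one]; exact ENNReal.ofReal_le_ofReal hpq.lt.le
  have hpz : ENNReal.ofReal p ≠ 0 := by simpa using hp0
  have hbound : ∀ s : ℝ, (∀ t : ℝ, ENNReal.ofReal (s * t) ≤ ‖t‖ₑ) → ∀ n,
      ∫⁻ x, ENNReal.ofReal (s * v n x) ^ p ∂μ ≤ M := fun s hs n => by
    refine le_trans (lintegral_mono fun x => ?_) (hb n)
    simp only
    gcongr
    exact hs _
  have hs1 : ∀ t : ℝ, ENNReal.ofReal (1 * t) ≤ ‖t‖ₑ := fun t => by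
    rw [one_mul, Real.enorm_eq_ofReal_abs]; exact ENNReal.ofReal_le_ofReal (le_abs_self t)
  have hs2 : ∀ t : ℝ, ENNReal.ofReal (-1 * t) ≤ ‖t‖ₑ := fun t => by
    rw [neg_one_mul, Real.enorm_eq_ofReal_abs]; exact ENNReal.ofReal_le_ofReal (neg_le_abs t)
  have hmeas : ∀ s : ℝ, ∀ n, AEMeasurable (fun x => ENNReal.ofReal (s * v n x)) μ := fun s n =>
    ((hv n).aemeasurable.const_mul s).ennreal_ofReal
  have hfinL : ∀ f : X → ℝ≥0∞, AEMeasurable f μ → ∫⁻ x, f x ^ p ∂μ ≤ M → ∫⁻ x, f x ∂μ ≠ ⊤ := by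
    intro f hf hfM
    have h := setLIntegral_le_of_lintegral_rpow_le hpq hf (g := fun _ => 1) aemeasurable_const hfM
    simp only [one_mul, ENNReal.one_rpow, lintegral_const] at h
    refine ne_of_lt (h.trans_lt (ENNReal.mul_lt_top ?_ ?_))
    · exact ENNReal.rpow_lt_top_of_nonneg (one_div_nonneg.2 hp0.le) hM
    · exact ENNReal.rpow_lt_top_of_nonneg (one_div_nonneg.2 hpq.symm.nonneg) (measure_ne_top _ _)
  obtain ⟨w₁, hw₁m, hw₁M, hw₁⟩ :=
    exists_setLIntegral_limit hpq 𝒰 (hmeas 1) hM (hbound 1 hs1)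
  obtain ⟨w₂, hw₂m, hw₂M, hw₂⟩ :=
    exists_setLIntegral_limit hpq 𝒰 (hmeas (-1)) hM (hbound (-1) hs2)
  have hLp : ∀ f : X → ℝ≥0∞, Measurable f → ∫⁻ x, f x ^ p ∂μ ≤ M →
      MemLp (fun x => (f x).toReal) (ENNReal.ofReal p) μ := by
    intro f hf hfM
    refine ⟨hf.ennreal_toReal.aestronglyMeasurable, ?_⟩
    rw [eLpNorm_lt_top_iff_lintegral_rpow_enorm_lt_top hpz ENNReal.ofReal_ne_top,
      ENNReal.toReal_ofReal hp0.le]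
    refine lt_of_le_of_lt (lintegral_mono fun x => ?_) (hfM.trans_lt hM.lt_top)
    simp only
    gcongr
    rw [Real.enorm_eq_ofReal ENNReal.toReal_nonneg]
    exact ENNReal.ofReal_toReal_le
  have hL₁ := hLp w₁ hw₁m hw₁M
  have hL₂ := hLp w₂ hw₂m hw₂M
  have htoReal : ∀ f : X → ℝ≥0∞, Measurable f → ∫⁻ x, f x ^ p ∂μ ≤ M → ∀ A,
      ∫ x in A, (f x).toReal ∂μ = (∫⁻ x in A, f x ∂μ).toReal := by
    intro f hf hfM A
    refine integral_toReal hf.aemeasurable ?_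
    exact ae_restrict_of_ae (ae_lt_top hf (hfinL f hf.aemeasurable hfM))
  have hint : ∀ n, Integrable (v n) μ := fun n => by
    refine ⟨hv n, ?_⟩
    exact (hfinL (fun x => ‖v n x‖ₑ) (hv n).enorm (hb n)).lt_top
  refine ⟨fun x => (w₁ x).toReal - (w₂ x).toReal, hL₁.sub hL₂, fun A hA => ?_⟩
  rw [integral_sub (hL₁.integrable hp1).integrableOn (hL₂.integrable hp1).integrableOn,
    htoReal w₁ hw₁m hw₁M, htoReal w₂ hw₂m hw₂M]
  have e : ∀ n, ∫ x in A, v n x ∂μ = (∫⁻ x in A, ENNReal.ofReal (1 * v n x) ∂μ).toReal -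
      (∫⁻ x in A, ENNReal.ofReal (-1 * v n x) ∂μ).toReal := by
    intro n
    rw [integral_eq_lintegral_pos_part_sub_lintegral_neg_part (hint n).integrableOn]
    simp
  simp_rw [e]
  have hne : ∀ f : X → ℝ≥0∞, Measurable f → ∫⁻ x, f x ^ p ∂μ ≤ M → ∫⁻ x in A, f x ∂μ ≠ ⊤ :=
    fun f hf hfM => ne_top_of_le_ne_top (hfinL f hf.aemeasurable hfM)
      (setLIntegral_le_lintegral _ _)
  exact ((ENNReal.tendsto_toReal (hne w₁ hw₁m hw₁M)).comp (hw₁ A hA)).sub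
    ((ENNReal.tendsto_toReal (hne w₂ hw₂m hw₂M)).comp (hw₂ A hA))

theorem norm_integral_mul_le {p q : ℝ} (hpq : p.HolderConjugate q) {f v : X → ℝ}
    (hf : MemLp f (ENNReal.ofReal q) μ) (hv : MemLp v (ENNReal.ofReal p) μ) {M : ℝ≥0∞}
    (hM : M ≠ ⊤) (hb : ∫⁻ x, ‖v x‖ₑ ^ p ∂μ ≤ M) :
    |∫ x, f x * v x ∂μ| ≤ (M ^ (1 / p)).toReal * (eLpNorm f (ENNReal.ofReal q) μ).toReal := by
  have hq0 := hpq.symm.pos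
  have hp0 := hpq.pos
  have hqz : ENNReal.ofReal q ≠ 0 := by simpa using hq0
  have h1 : ∫⁻ x, ‖f x * v x‖ₑ ∂μ ≤ M ^ (1 / p) * eLpNorm f (ENNReal.ofReal q) μ := by
    simp_rw [enorm_mul]
    refine (ENNReal.lintegral_mul_le_Lp_mul_Lq μ hpq.symm hf.1.enorm hv.1.enorm).trans ?_
    rw [mul_comm, eLpNorm_eq_lintegral_rpow_enorm_toReal hqz ENNReal.ofReal_ne_top,
      ENNReal.toReal_ofReal hq0.le]
    gcongr
  have h2 : M ^ (1 / p) * eLpNorm f (ENNReal.ofReal q) μ ≠ ⊤ :=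
    ENNReal.mul_ne_top (ENNReal.rpow_ne_top_of_nonneg (one_div_nonneg.2 hp0.le) hM) hf.2.ne
  rw [← ENNReal.toReal_mul]
  refine (norm_integral_le_lintegral_norm (μ := μ) fun x => f x * v x).trans ?_
  refine ENNReal.toReal_mono h2 (le_trans (le_of_eq ?_) h1)
  simp_rw [ofReal_norm]

theorem integrable_mul_of_memLp {p q : ℝ} (hpq : p.HolderConjugate q) {f v : X → ℝ}
    (hf : MemLp f (ENNReal.ofReal q) μ) (hv : MemLp v (ENNReal.ofReal p) μ) :
    Integrable (fun x => f x * v x) μ := by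
  have := ENNReal.HolderConjugate.symm (p := ENNReal.ofReal p) (q := ENNReal.ofReal q)
    (hpq := hpq.ennrealOfReal)
  exact hf.integrable_mul hv

/-- Sequential weak compactness of balls of `L^p`, `1 < p < ∞`, along an ultrafilter. -/
theorem exists_weak_limit [IsFiniteMeasure μ] {p q : ℝ}
    (hpq : p.HolderConjugate q) (𝒰 : Ultrafilter ℕ) {v : ℕ → X → ℝ}
    (hv : ∀ n, MemLp (v n) (ENNReal.ofReal p) μ) {M : ℝ≥0∞} (hM : M ≠ ⊤)
    (hb : ∀ n, ∫⁻ x, ‖v n x‖ₑ ^ p ∂μ ≤ M) :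
    ∃ w : X → ℝ, MemLp w (ENNReal.ofReal p) μ ∧ ∀ f : X → ℝ, MemLp f (ENNReal.ofReal q) μ →
      Tendsto (fun n => ∫ x, f x * v n x ∂μ) 𝒰 (𝓝 (∫ x, f x * w x ∂μ)) := by
  obtain ⟨w, hw, hA⟩ := exists_setIntegral_limit hpq 𝒰 (fun n => (hv n).1) hM hb
  refine ⟨w, hw, ?_⟩
  have hq1 : (1 : ℝ≥0∞) ≤ ENNReal.ofReal q := by
    rw [← ENNReal.ofReal_one]; exact ENNReal.ofReal_le_ofReal hpq.symm.lt.le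
  have : Fact ((1 : ℝ≥0∞) ≤ ENNReal.ofReal q) := ⟨hq1⟩
  have hind : ∀ (c : ℝ) (s : Set X), MeasurableSet s → ∀ g : X → ℝ,
      ∫ x, s.indicator (fun _ => c) x * g x ∂μ = c * ∫ x in s, g x ∂μ := by
    intro c s hs g
    rw [← integral_const_mul, ← integral_indicator hs]
    congr 1 with x
    by_cases hx : x ∈ s <;> simp [hx]
  refine MemLp.induction ENNReal.ofReal_ne_top (motive := fun f => Tendsto
    (fun n => ∫ x, f x * v n x ∂μ) 𝒰 (𝓝 (∫ x, f x * w x ∂μ))) ?_ ?_ ?_ ?_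
  · intro c s hs _
    simp_rw [hind c s hs]
    exact (hA s hs).const_mul c
  · intro f g _ hf hg hf' hg'
    have e : ∀ u : X → ℝ, MemLp u (ENNReal.ofReal p) μ → ∫ x, (f + g) x * u x ∂μ =
        ∫ x, f x * u x ∂μ + ∫ x, g x * u x ∂μ := by
      intro u hu
      rw [← integral_add (integrable_mul_of_memLp hpq hf hu) (integrable_mul_of_memLp hpq hg hu)]
      simp [add_mul]
    simp_rw [e w hw, fun n => e _ (hv n)]
    exact hf'.add hg'
  -- The functionals `f ↦ ∫ f * v n` share one Lipschitz constant on `L^q`. For an equicontinuous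
  -- family, the set of points of convergence to a continuous limit is closed.
  · set K := (M ^ (1 / p)).toReal
    have hlip : ∀ u : X → ℝ, MemLp u (ENNReal.ofReal p) μ → ∀ C : ℝ≥0∞, C ≠ ⊤ →
        ∫⁻ x, ‖u x‖ₑ ^ p ∂μ ≤ C → LipschitzWith (C ^ (1 / p)).toNNReal
          (fun f : Lp ℝ (ENNReal.ofReal q) μ => ∫ x, f x * u x ∂μ) := by
      intro u hu C hC huC
      refine LipschitzWith.of_dist_le_mul fun f g => ?_
      rw [Real.dist_eq, ← integral_sub (integrable_mul_of_memLp hpq (Lp.memLp f) hu)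
        (integrable_mul_of_memLp hpq (Lp.memLp g) hu), Lp.dist_def]
      have h := norm_integral_mul_le hpq ((Lp.memLp f).sub (Lp.memLp g)) hu hC huC
      simpa [sub_mul, ENNReal.toReal] using h
    have heq : Equicontinuous fun n => fun f : Lp ℝ (ENNReal.ofReal q) μ =>
        ∫ x, f x * v n x ∂μ := by
      refine UniformEquicontinuous.equicontinuous ?_
      exact LipschitzWith.uniformEquicontinuous _ _ fun n => hlip _ (hv n) M hM (hb n)
    have hwfin : ∫⁻ x, ‖w x‖ₑ ^ p ∂μ ≠ ⊤ := by
      have := (eLpNorm_lt_top_iff_lintegral_rpow_enorm_lt_top (by simpa using hpq.pos)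
        ENNReal.ofReal_ne_top).1 hw.2
      rw [ENNReal.toReal_ofReal hpq.nonneg] at this
      exact this.ne
    exact heq.isClosed_setOfPred_tendsto (hlip w hw _ hwfin le_rfl).continuous
  · intro f g hfg _ hf
    have e : ∀ u : X → ℝ, ∫ x, g x * u x ∂μ = ∫ x, f x * u x ∂μ := fun u =>
      integral_congr_ae (hfg.mono fun x hx => by simp [hx])
    simp_rw [e]
    exact hf

end WeakCompactness

/-! ### Lower semicontinuity of the energy -/

section Semicontinuity

variable {a b : ℝ}

/-- Continuity for `x` in `(a, b)` is enough: the extension of `G` by zero is Borel, and it agrees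
with `G` along the composition almost everywhere. -/
theorem aemeasurable_comp_of_continuousOn {G : ℝ × ℝ × ℝ × ℝ → ℝ}
    (hG : ContinuousOn G (univ ×ˢ univ ×ˢ univ ×ˢ Ioo a b)) {v w u : ℝ → ℝ}
    (hv : AEMeasurable v (volume.restrict (Ioo a b)))
    (hw : AEMeasurable w (volume.restrict (Ioo a b)))
    (hu : AEMeasurable u (volume.restrict (Ioo a b))) :
    AEMeasurable (fun x => G (v x, w x, u x, x)) (volume.restrict (Ioo a b)) := by
  classical
  set S : Set (ℝ × ℝ × ℝ × ℝ) := univ ×ˢ univ ×ˢ univ ×ˢ Ioo a b with hS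
  have hSm : MeasurableSet S :=
    MeasurableSet.univ.prod (MeasurableSet.univ.prod (MeasurableSet.univ.prod measurableSet_Ioo))
  have h1 : Measurable (S.piecewise G 0) :=
    hG.measurable_piecewise continuousOn_const hSm
  have h2 := h1.comp_aemeasurable (hv.prodMk (hw.prodMk (hu.prodMk aemeasurable_id)))
  refine h2.congr ?_
  filter_upwards [ae_restrict_mem measurableSet_Ioo] with x hx
  have : (v x, w x, u x, x) ∈ S := by simpa [hS] using hx
  simp [Function.comp, piecewise_eq_of_mem _ _ _ this]

theorem eventually_abs_sub_lt_of_tendstoUniformlyOn {G : ℝ × ℝ × ℝ × ℝ → ℝ}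
    (hG : ContinuousOn G (univ ×ˢ univ ×ˢ univ ×ˢ Ioo a b)) {l : Filter ℕ}
    {u : ℕ → ℝ → ℝ} {u₀ : ℝ → ℝ} (hu₀ : ContinuousOn u₀ (Ioo a b)) {c d : ℝ} (hc : a < c)
    (hd : d < b) (hu : TendstoUniformlyOn u u₀ l (Icc c d)) (k : ℝ) {ε : ℝ} (hε : 0 < ε) :
    ∀ᶠ n in l, ∀ x ∈ Icc c d, ∀ s t, |s| ≤ k → |t| ≤ k →
      |G (s, t, u n x, x) - G (s, t, u₀ x, x)| < ε := by
  have hsub : Icc c d ⊆ Ioo a b := Icc_subset_Ioo hc hd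
  obtain ⟨R, hR⟩ := isCompact_Icc.exists_bound_of_continuousOn (hu₀.mono hsub)
  -- `R` bounds `u₀` on `[c, d]`; the extra 1 leaves room for `u n`, which will be within `min δ 1`
  -- of `u₀`. On this compact box `G` is uniformly continuous.
  set Q : Set (ℝ × ℝ × ℝ × ℝ) :=
    Icc (-k) k ×ˢ Icc (-k) k ×ˢ Icc (-(R + 1)) (R + 1) ×ˢ Icc c d with hQ
  have hQc : IsCompact Q :=
    isCompact_Icc.prod (isCompact_Icc.prod (isCompact_Icc.prod isCompact_Icc))
  have hGQ : ContinuousOn G Q := hG.mono (by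
    rintro ⟨s, t, r, x⟩ ⟨-, -, -, hx⟩
    exact ⟨trivial, trivial, trivial, hsub hx⟩)
  obtain ⟨δ, hδ, hδ'⟩ := Metric.uniformContinuousOn_iff.1
    (hQc.uniformContinuousOn_of_continuous hGQ) ε hε
  filter_upwards [Metric.tendstoUniformlyOn_iff.1 hu (min δ 1) (lt_min hδ one_pos)] with n hn
  intro x hx s t hs ht
  have h1 := hn x hx
  have h2 := hR x hx
  rw [Real.dist_eq] at h1
  rw [Real.norm_eq_abs] at h2
  have h3 := h1.trans_le (min_le_left _ _)
  have h4 := h1.trans_le (min_le_right _ _)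
  rw [abs_le] at h2
  rw [abs_lt] at h4
  have := hδ' (s, t, u n x, x) ⟨abs_le.1 hs, abs_le.1 ht, ⟨by linarith, by linarith⟩, hx⟩
    (s, t, u₀ x, x) ⟨abs_le.1 hs, abs_le.1 ht, ⟨by linarith, by linarith⟩, hx⟩ (by
      simp only [Prod.dist_eq, dist_self]
      rw [Real.dist_eq, abs_sub_comm]
      simp [h3])
  rwa [Real.dist_eq] at this

/-- Subtracting the lower bound `m` makes the integrand nonnegative, so only a finite constant
separates the energy from a `lintegral`, and no `∞ - ∞` can arise. -/
theorem extIntegral_eq_lintegral_add (hab : a ≤ b) {f : ℝ → ℝ} {m : ℝ}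
    (hf : AEMeasurable f (volume.restrict (Ioo a b))) (hm : ∀ x ∈ Ioo a b, m ≤ f x) :
    extIntegral a b f =
      ((∫⁻ x in Ioo a b, ENNReal.ofReal (f x - m) : ℝ≥0∞) : EReal) + ((m * (b - a) : ℝ) : EReal) := by
  have hvol : (volume (Ioo a b)) = ENNReal.ofReal (b - a) := Real.volume_Ioo
  have hneg : AEMeasurable (fun x => ENNReal.ofReal (-f x)) (volume.restrict (Ioo a b)) :=
    hf.neg.ennreal_ofReal
  -- The pointwise identity is `(f - m) + f⁻ + m⁺ = f⁺ + m⁻`; it is arranged without subtraction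
  -- because subtraction in `ℝ≥0∞` truncates.
  have key : (∫⁻ x in Ioo a b, ENNReal.ofReal (f x - m)) + (∫⁻ x in Ioo a b, ENNReal.ofReal (-f x))
      + ENNReal.ofReal m * ENNReal.ofReal (b - a) =
      (∫⁻ x in Ioo a b, ENNReal.ofReal (f x)) + ENNReal.ofReal (-m) * ENNReal.ofReal (b - a) := by
    rw [← hvol, ← setLIntegral_const, ← setLIntegral_const, ← lintegral_add_right' _ hneg, ← lintegral_add_right _ measurable_const,
      ← lintegral_add_right _ measurable_const]
    refine setLIntegral_congr_fun measurableSet_Ioo fun x hx => ?_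
    have hx' := hm x hx
    rw [← ENNReal.toReal_eq_toReal_iff' (by simp) (by simp), ENNReal.toReal_add (by simp) (by simp),
      ENNReal.toReal_add (by simp) (by simp), ENNReal.toReal_add (by simp) (by simp)]
    simp only [ENNReal.toReal_ofReal']
    rw [max_eq_left (by linarith : (0:ℝ) ≤ f x - m)]
    rcases le_total (f x) 0 with h | h <;> rcases le_total m 0 with h' | h' <;>
      simp [h, h'] <;> ring
  have hN : ∫⁻ x in Ioo a b, ENNReal.ofReal (-f x) ≠ ⊤ := by
    refine ne_top_of_le_ne_top ?_ (setLIntegral_mono' (g := fun _ => ENNReal.ofReal (-m))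
      measurableSet_Ioo fun x hx => ENNReal.ofReal_le_ofReal (neg_le_neg (hm x hx)))
    rw [setLIntegral_const, hvol]
    exact ENNReal.mul_ne_top (by simp) (by simp)
  unfold extIntegral
  generalize (∫⁻ x in Ioo a b, ENNReal.ofReal (-f x)) = N at *
  generalize (∫⁻ x in Ioo a b, ENNReal.ofReal (f x)) = P at *
  generalize (∫⁻ x in Ioo a b, ENNReal.ofReal (f x - m)) = H at *
  lift N to NNReal using hN
  rw [← ENNReal.ofReal_mul' (by linarith), ← ENNReal.ofReal_mul' (by linarith)] at key
  by_cases hP : P = ⊤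
  · have hH : H = ⊤ := by
      by_contra hH
      rw [hP, top_add] at key
      exact (ENNReal.add_ne_top.2 ⟨ENNReal.add_ne_top.2 ⟨hH, by simp⟩, by simp⟩) key
    subst hP hH
    simp only [EReal.coe_ennreal_top, EReal.top_add_coe]
    exact EReal.top_sub_coe N
  · have hH : H ≠ ⊤ := by
      rintro rfl
      rw [top_add, top_add] at key
      exact (ENNReal.add_ne_top.2 ⟨hP, by simp⟩) key.symm
    lift P to NNReal using hP
    lift H to NNReal using hH
    rw [← ENNReal.toReal_eq_toReal_iff' (by simp) (by simp), ENNReal.toReal_add (by simp) (by simp),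
      ENNReal.toReal_add (by simp) (by simp), ENNReal.toReal_add (by simp) (by simp)] at key
    simp only [ENNReal.toReal_ofReal', ENNReal.coe_toReal] at key
    have e : ((P : ℝ) - N) = H + m * (b - a) := by
      rcases le_total (m * (b - a)) 0 with h | h
      · rw [max_eq_right h, max_eq_left (by linarith)] at key; linarith
      · rw [max_eq_left h, max_eq_right (by linarith)] at key; linarith
    simp only [EReal.coe_nnreal_eq_coe_real]
    rw [← EReal.coe_sub, ← EReal.coe_add, e]

theorem extIntegral_congr_ae {f g : ℝ → ℝ} (h : f =ᵐ[volume.restrict (Ioo a b)] g) :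
    extIntegral a b f = extIntegral a b g := by
  unfold extIntegral
  rw [lintegral_congr_ae (h.mono fun x hx => by simp only [hx] :
      (fun x => ENNReal.ofReal (f x)) =ᵐ[volume.restrict (Ioo a b)] fun x => ENNReal.ofReal (g x)),
    lintegral_congr_ae (h.mono fun x hx => by simp only [hx] :
      (fun x => ENNReal.ofReal (-f x)) =ᵐ[volume.restrict (Ioo a b)]
        fun x => ENNReal.ofReal (-g x))]

/-- The tangent plane at `(v₀, w₀)` bounds `L (v n) (w n) (u n)` below by an expression linear in `v
n - v₀` and `w n - w₀`. On sets where `v₀`, `w₀` are bounded and `x` stays away from the ends, `u n`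
may be replaced by `u₀` at a uniformly small cost, after which weak convergence kills the linear
terms. -/
theorem lintegral_le_of_weak_limit {L : ℝ → ℝ → ℝ → ℝ → ℝ} {L₁ L₂ : ℝ → ℝ → ℝ → ℝ} {m : ℝ}
    (hL : ContinuousOn (fun q : ℝ × ℝ × ℝ × ℝ => L q.1 q.2.1 q.2.2.1 q.2.2.2)
      (univ ×ˢ univ ×ˢ univ ×ˢ Ioo a b))
    (hL₁ : ContinuousOn (fun q : ℝ × ℝ × ℝ => L₁ q.1 q.2.1 q.2.2) (univ ×ˢ univ ×ˢ Ioo a b))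
    (hL₂ : ContinuousOn (fun q : ℝ × ℝ × ℝ => L₂ q.1 q.2.1 q.2.2) (univ ×ˢ univ ×ˢ Ioo a b))
    (htan : ∀ a₁ a₂ b₁ b₂ s : ℝ, ∀ x ∈ Ioo a b,
      L a₁ a₂ s x + L₁ a₁ s x * (b₁ - a₁) + L₂ a₂ s x * (b₂ - a₂) ≤ L b₁ b₂ s x)
    (hm : ∀ a₁ a₂ s : ℝ, ∀ x ∈ Ioo a b, m ≤ L a₁ a₂ s x)
    {l : Filter ℕ} [l.NeBot] {v w u : ℕ → ℝ → ℝ} {v₀ w₀ u₀ : ℝ → ℝ}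
    (hv₀ : Measurable v₀) (hw₀ : Measurable w₀) (hu₀ : ContinuousOn u₀ (Ioo a b))
    (hvi₀ : IntegrableOn v₀ (Ioo a b)) (hwi₀ : IntegrableOn w₀ (Ioo a b))
    (hvi : ∀ n, IntegrableOn (v n) (Ioo a b)) (hwi : ∀ n, IntegrableOn (w n) (Ioo a b))
    {K : ℝ} (hvK : ∀ n, ∫ x in Ioo a b, |v n x| ≤ K) (hwK : ∀ n, ∫ x in Ioo a b, |w n x| ≤ K)
    (hv : ∀ f : ℝ → ℝ, AEStronglyMeasurable f (volume.restrict (Ioo a b)) →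
      (∃ C, ∀ x, |f x| ≤ C) →
      Tendsto (fun n => ∫ x in Ioo a b, f x * v n x) l (𝓝 (∫ x in Ioo a b, f x * v₀ x)))
    (hw : ∀ f : ℝ → ℝ, AEStronglyMeasurable f (volume.restrict (Ioo a b)) →
      (∃ C, ∀ x, |f x| ≤ C) →
      Tendsto (fun n => ∫ x in Ioo a b, f x * w n x) l (𝓝 (∫ x in Ioo a b, f x * w₀ x)))
    (hu : ∀ c d, a < c → d < b → TendstoUniformlyOn u u₀ l (Icc c d))
    {r : NNReal} (hr : ∀ᶠ n in l,
      ∫⁻ x in Ioo a b, ENNReal.ofReal (L (v n x) (w n x) (u n x) x - m) ≤ r) :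
    ∫⁻ x in Ioo a b, ENNReal.ofReal (L (v₀ x) (w₀ x) (u₀ x) x - m) ≤ r := by
  -- These sets increase to `(a, b)`, so by monotone convergence the estimate is needed only on each
  -- `A k`, where `L`, `L₁`, `L₂` along the limit are bounded.
  let A : ℕ → Set ℝ := fun k =>
    Icc (a + 1 / ((k : ℝ) + 1)) (b - 1 / ((k : ℝ) + 1)) ∩ {x | |v₀ x| ≤ k} ∩ {x | |w₀ x| ≤ k}
  have hAm : ∀ k, MeasurableSet (A k) := fun k =>
    (measurableSet_Icc.inter (measurableSet_le hv₀.abs measurable_const)).inter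
      (measurableSet_le hw₀.abs measurable_const)
  have hA1 : ∀ k : ℕ, 0 < 1 / ((k : ℝ) + 1) := fun k => by positivity
  have hAsub : ∀ k, A k ⊆ Ioo a b := fun k x hx =>
    Icc_subset_Ioo (by linarith [hA1 k]) (by linarith [hA1 k]) hx.1.1
  have hmono : Monotone A := by
    intro i j hij x hx
    have hij' : (i : ℝ) ≤ j := by exact_mod_cast hij
    have h1 : 1 / ((j : ℝ) + 1) ≤ 1 / ((i : ℝ) + 1) :=
      one_div_le_one_div_of_le (by positivity) (by linarith)
    exact ⟨⟨⟨by linarith [hx.1.1.1], by linarith [hx.1.1.2]⟩, le_trans hx.1.2 hij'⟩,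
      le_trans hx.2 hij'⟩
  have hunion : Ioo a b = ⋃ k, A k := by
    refine Subset.antisymm (fun x hx => ?_) (iUnion_subset hAsub)
    have h0 : Tendsto (fun k : ℕ => 1 / ((k : ℝ) + 1)) atTop (𝓝 0) :=
      tendsto_one_div_add_atTop_nhds_zero_nat
    have h1 := h0.eventually (gt_mem_nhds (show (0 : ℝ) < min (x - a) (b - x) from
      lt_min (by linarith [hx.1]) (by linarith [hx.2])))
    have h2 := tendsto_natCast_atTop_atTop (R := ℝ) |>.eventually_ge_atTop (|v₀ x|)
    have h3 := tendsto_natCast_atTop_atTop (R := ℝ) |>.eventually_ge_atTop (|w₀ x|)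
    obtain ⟨k, hk1, hk2, hk3⟩ := (h1.and (h2.and h3)).exists
    rw [lt_min_iff] at hk1
    exact mem_iUnion.2 ⟨k, ⟨⟨by linarith, by linarith⟩, hk2⟩, hk3⟩
  rw [hunion, setLIntegral_iUnion_of_directed _ hmono.directed_le]
  refine iSup_le fun k => ?_
  set c := a + 1 / ((k : ℝ) + 1) with hc
  set d := b - 1 / ((k : ℝ) + 1) with hd
  have hac : a < c := by linarith [hA1 k]
  have hdb : d < b := by linarith [hA1 k]
  set μ := volume.restrict (Ioo a b) with hμ
  have hAμ : volume.restrict (A k) = μ.restrict (A k) := by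
    rw [hμ, Measure.restrict_restrict (hAm k), inter_eq_self_of_subset_left (hAsub k)]
  have hu₀m : AEMeasurable u₀ μ := hu₀.aemeasurable measurableSet_Ioo
  have hG1 : ContinuousOn (fun q : ℝ × ℝ × ℝ × ℝ => L₁ q.1 q.2.2.1 q.2.2.2)
      (univ ×ˢ univ ×ˢ univ ×ˢ Ioo a b) := by
    refine hL₁.comp (f := fun q : ℝ × ℝ × ℝ × ℝ => (q.1, q.2.2.1, q.2.2.2)) (by fun_prop) ?_
    rintro ⟨s, t, r, x⟩ ⟨-, -, -, hx⟩
    exact ⟨trivial, trivial, hx⟩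
  have hG2 : ContinuousOn (fun q : ℝ × ℝ × ℝ × ℝ => L₂ q.2.1 q.2.2.1 q.2.2.2)
      (univ ×ˢ univ ×ˢ univ ×ˢ Ioo a b) := by
    refine hL₂.comp (f := fun q : ℝ × ℝ × ℝ × ℝ => (q.2.1, q.2.2.1, q.2.2.2)) (by fun_prop) ?_
    rintro ⟨s, t, r, x⟩ ⟨-, -, -, hx⟩
    exact ⟨trivial, trivial, hx⟩
  have hbound : ∀ G : ℝ × ℝ × ℝ × ℝ → ℝ, ContinuousOn G (univ ×ˢ univ ×ˢ univ ×ˢ Ioo a b) →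
      ∃ C, ∀ x ∈ A k, |G (v₀ x, w₀ x, u₀ x, x)| ≤ C := by
    intro G hG
    have hsub : Icc c d ⊆ Ioo a b := Icc_subset_Ioo hac hdb
    obtain ⟨R, hR⟩ := isCompact_Icc.exists_bound_of_continuousOn (hu₀.mono hsub)
    obtain ⟨C, hC⟩ := ((isCompact_Icc (a := -(k : ℝ)) (b := k)).prod
      ((isCompact_Icc (a := -(k : ℝ)) (b := k)).prod ((isCompact_Icc (a := -R) (b := R)).prod
        (isCompact_Icc (a := c) (b := d))))).exists_bound_of_continuousOn (hG.mono (by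
          rintro ⟨s, t, r, x⟩ ⟨-, -, -, hx⟩
          exact ⟨trivial, trivial, trivial, hsub hx⟩))
    exact ⟨C, fun x hx => hC _ ⟨abs_le.1 hx.1.2, abs_le.1 hx.2, abs_le.1 (hR x hx.1.1), hx.1.1⟩⟩
  have hmeasG : ∀ G : ℝ × ℝ × ℝ × ℝ → ℝ, ContinuousOn G (univ ×ˢ univ ×ˢ univ ×ˢ Ioo a b) →
      AEMeasurable (fun x => G (v₀ x, w₀ x, u₀ x, x)) μ := fun G hG =>
    aemeasurable_comp_of_continuousOn hG hv₀.aemeasurable hw₀.aemeasurable hu₀m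
  have hfin : IsFiniteMeasure (volume.restrict (A k)) := by
    rw [hAμ]; infer_instance
  obtain ⟨C₀, hC₀⟩ := hbound _ hL
  obtain ⟨C₁, hC₁⟩ := hbound _ hG1
  obtain ⟨C₂, hC₂⟩ := hbound _ hG2
  set g : ℝ → ℝ := fun x => L (v₀ x) (w₀ x) (u₀ x) x - m with hg
  -- The slopes are frozen at the limit, which makes them fixed bounded test functions for the weak
  -- convergence.
  set f₁ : ℝ → ℝ := (A k).indicator fun x => L₁ (v₀ x) (u₀ x) x with hf₁
  set f₂ : ℝ → ℝ := (A k).indicator fun x => L₂ (w₀ x) (u₀ x) x with hf₂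
  have hgi : IntegrableOn g (A k) := by
    refine Integrable.of_bound (C := C₀ + |m|) ?_ ?_
    · rw [hAμ]
      exact ((hmeasG _ hL).sub_const m).aestronglyMeasurable.restrict
    · filter_upwards [ae_restrict_mem (hAm k)] with x hx
      exact (abs_sub _ _).trans (add_le_add (hC₀ x hx) le_rfl)
  have hf₁m : AEStronglyMeasurable f₁ μ := (hmeasG _ hG1).aestronglyMeasurable.indicator (hAm k)
  have hf₂m : AEStronglyMeasurable f₂ μ := (hmeasG _ hG2).aestronglyMeasurable.indicator (hAm k)
  have hf₁b : ∃ C, ∀ x, |f₁ x| ≤ C := by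
    refine ⟨|C₁|, fun x => ?_⟩
    by_cases hx : x ∈ A k
    · rw [hf₁, indicator_of_mem hx]; exact (hC₁ x hx).trans (le_abs_self _)
    · rw [hf₁, indicator_of_notMem hx]; simp
  have hf₂b : ∃ C, ∀ x, |f₂ x| ≤ C := by
    refine ⟨|C₂|, fun x => ?_⟩
    by_cases hx : x ∈ A k
    · rw [hf₂, indicator_of_mem hx]; exact (hC₂ x hx).trans (le_abs_self _)
    · rw [hf₂, indicator_of_notMem hx]; simp
  set V := ∫ x in Ioo a b, |v₀ x| with hV
  set W := ∫ x in Ioo a b, |w₀ x| with hW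
  have hmulint : ∀ f y : ℝ → ℝ, AEStronglyMeasurable f μ → (∃ C, ∀ x, |f x| ≤ C) →
      IntegrableOn y (Ioo a b) → IntegrableOn (fun x => f x * y x) (Ioo a b) := by
    rintro f y hf ⟨C, hC⟩ hy
    exact hy.bdd_mul hf (Eventually.of_forall hC)
  have hAint : ∀ (F f : ℝ → ℝ), f = (A k).indicator F → ∀ y : ℝ → ℝ,
      ∫ x in A k, f x * y x = ∫ x in Ioo a b, f x * y x := by
    intro F f hf y
    refine setIntegral_eq_of_subset_of_forall_sdiff_eq_zero measurableSet_Ioo (hAsub k) ?_ |>.symm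
    intro x hx
    rw [hf, indicator_of_notMem hx.2, zero_mul]
  -- Replacing `u n` by `u₀` in `L`, `L₁`, `L₂` costs at most `ε * (1 + |v n - v₀| + |w n - w₀|)`
  -- pointwise. The bracket bounds the integral of that factor uniformly in `n`.
  have hstep : ∀ ε > 0, (∫ x in A k, g x) - ε * (volume.real (A k) + (K + V) + (K + W)) ≤ r := by
    intro ε hε
    have hlim : Tendsto (fun n => (∫ x in A k, g x) +
        ((∫ x in Ioo a b, f₁ x * v n x) - ∫ x in Ioo a b, f₁ x * v₀ x) +
        ((∫ x in Ioo a b, f₂ x * w n x) - ∫ x in Ioo a b, f₂ x * w₀ x) -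
        ε * (volume.real (A k) + (K + V) + (K + W))) l
        (𝓝 ((∫ x in A k, g x) - ε * (volume.real (A k) + (K + V) + (K + W)))) := by
      have h := (((hv f₁ hf₁m hf₁b).sub_const (∫ x in Ioo a b, f₁ x * v₀ x)).const_add
        (∫ x in A k, g x)).add ((hw f₂ hf₂m hf₂b).sub_const (∫ x in Ioo a b, f₂ x * w₀ x))
      have h' := h.sub_const (ε * (volume.real (A k) + (K + V) + (K + W)))
      simp only [← hμ, sub_self, add_zero] at h' ⊢
      exact h'
    refine le_of_tendsto hlim ?_
    filter_upwards [hr,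
      eventually_abs_sub_lt_of_tendstoUniformlyOn hL hu₀ hac hdb (hu c d hac hdb) k hε,
      eventually_abs_sub_lt_of_tendstoUniformlyOn hG1 hu₀ hac hdb (hu c d hac hdb) k hε,
      eventually_abs_sub_lt_of_tendstoUniformlyOn hG2 hu₀ hac hdb (hu c d hac hdb) k hε]
      with n hn hn0 hn1 hn2
    have hfv := (hmulint f₁ (v n) hf₁m hf₁b (hvi n)).mono_set (hAsub k)
    have hfv₀ := (hmulint f₁ v₀ hf₁m hf₁b hvi₀).mono_set (hAsub k)
    have hfw := (hmulint f₂ (w n) hf₂m hf₂b (hwi n)).mono_set (hAsub k)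
    have hfw₀ := (hmulint f₂ w₀ hf₂m hf₂b hwi₀).mono_set (hAsub k)
    have hva := IntegrableOn.mono_set (Integrable.abs ((hvi n).sub hvi₀)) (hAsub k)
    have hwa := IntegrableOn.mono_set (Integrable.abs ((hwi n).sub hwi₀)) (hAsub k)
    simp only [Pi.sub_apply] at hva hwa
    have hone : IntegrableOn (fun _ => (1 : ℝ)) (A k) := integrable_const _
    set h : ℝ → ℝ := fun x => g x + (f₁ x * v n x - f₁ x * v₀ x) + (f₂ x * w n x - f₂ x * w₀ x)
      - ε * (1 + |v n x - v₀ x| + |w n x - w₀ x|) with hh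
    have hhi : IntegrableOn h (A k) :=
      ((hgi.add (hfv.sub hfv₀)).add (hfw.sub hfw₀)).sub
        (((hone.add hva).add hwa).const_mul ε)
    have hhle : ∀ x ∈ A k, h x ≤ L (v n x) (w n x) (u n x) x - m := by
      intro x hx
      have h0 := (abs_lt.1 (hn0 x hx.1.1 (v₀ x) (w₀ x) hx.1.2 hx.2)).1
      have h1 := (hn1 x hx.1.1 (v₀ x) (w₀ x) hx.1.2 hx.2).le
      have h2 := (hn2 x hx.1.1 (v₀ x) (w₀ x) hx.1.2 hx.2).le
      have ht := htan (v₀ x) (w₀ x) (v n x) (w n x) (u n x) x (hAsub k hx)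
      have h1' : (L₁ (v₀ x) (u₀ x) x - L₁ (v₀ x) (u n x) x) * (v n x - v₀ x)
          ≤ ε * |v n x - v₀ x| := by
        refine (le_abs_self _).trans ?_
        rw [abs_mul, abs_sub_comm (L₁ _ _ _)]
        exact mul_le_mul_of_nonneg_right h1 (abs_nonneg _)
      have h2' : (L₂ (w₀ x) (u₀ x) x - L₂ (w₀ x) (u n x) x) * (w n x - w₀ x)
          ≤ ε * |w n x - w₀ x| := by
        refine (le_abs_self _).trans ?_
        rw [abs_mul, abs_sub_comm (L₂ _ _ _)]
        exact mul_le_mul_of_nonneg_right h2 (abs_nonneg _)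
      simp only [hh, hg, hf₁, hf₂, indicator_of_mem hx]
      nlinarith [ht, h1', h2', h0]
    have hhint : ∫ x in A k, h x ≤ r := by
      rw [integral_eq_lintegral_pos_part_sub_lintegral_neg_part hhi]
      have h1 : ∫⁻ x in A k, ENNReal.ofReal (h x) ≤ r := by
        refine le_trans ?_ hn
        refine le_trans (setLIntegral_mono' (hAm k) fun x hx =>
          ENNReal.ofReal_le_ofReal (hhle x hx)) ?_
        exact lintegral_mono_set (hAsub k)
      have h2 := ENNReal.toReal_mono ENNReal.coe_ne_top h1
      rw [ENNReal.coe_toReal] at h2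
      linarith [ENNReal.toReal_nonneg (a := ∫⁻ x in A k, ENNReal.ofReal (-h x))]
    have hsplit : ∫ x in A k, h x = (∫ x in A k, g x) +
        ((∫ x in Ioo a b, f₁ x * v n x) - ∫ x in Ioo a b, f₁ x * v₀ x) +
        ((∫ x in Ioo a b, f₂ x * w n x) - ∫ x in Ioo a b, f₂ x * w₀ x) -
        ε * (volume.real (A k) + (∫ x in A k, |v n x - v₀ x|) + ∫ x in A k, |w n x - w₀ x|) := by
      have i₁ : IntegrableOn (fun x => f₁ x * v n x - f₁ x * v₀ x) (A k) := hfv.sub hfv₀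
      have i₂ : IntegrableOn (fun x => f₂ x * w n x - f₂ x * w₀ x) (A k) := hfw.sub hfw₀
      have i₃ : IntegrableOn (fun x => 1 + |v n x - v₀ x|) (A k) := hone.add hva
      have i₄ : IntegrableOn (fun x => ε * (1 + |v n x - v₀ x| + |w n x - w₀ x|)) (A k) :=
        (i₃.add hwa).const_mul ε
      have i₅ : IntegrableOn (fun x => g x + (f₁ x * v n x - f₁ x * v₀ x)) (A k) := hgi.add i₁
      have i₆ : IntegrableOn (fun x => g x + (f₁ x * v n x - f₁ x * v₀ x) +
        (f₂ x * w n x - f₂ x * w₀ x)) (A k) := i₅.add i₂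
      simp only [hh]
      rw [integral_sub i₆ i₄, integral_add i₅ i₂, integral_add hgi i₁, integral_sub hfv hfv₀,
        integral_sub hfw hfw₀, integral_const_mul, integral_add i₃ hwa,
        integral_add hone hva, hAint _ f₁ hf₁, hAint _ f₁ hf₁, hAint _ f₂ hf₂, hAint _ f₂ hf₂]
      simp
    have habs : ∀ y y₀ : ℝ → ℝ, IntegrableOn y (Ioo a b) → IntegrableOn y₀ (Ioo a b) →
        ∫ x in Ioo a b, |y x| ≤ K →
        ∫ x in A k, |y x - y₀ x| ≤ K + ∫ x in Ioo a b, |y₀ x| := by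
      intro y y₀ hy hy₀ hyK
      calc ∫ x in A k, |y x - y₀ x| ≤ ∫ x in Ioo a b, |y x - y₀ x| :=
            setIntegral_mono_set (hy.sub hy₀).abs (Eventually.of_forall fun x => abs_nonneg _)
              (hAsub k).eventuallyLE
        _ ≤ ∫ x in Ioo a b, (|y x| + |y₀ x|) :=
            integral_mono (hy.sub hy₀).abs (hy.abs.add hy₀.abs) fun x => abs_sub _ _
        _ = (∫ x in Ioo a b, |y x|) + ∫ x in Ioo a b, |y₀ x| := integral_add hy.abs hy₀.abs
        _ ≤ _ := by linarith
    have hv' := habs (v n) v₀ (hvi n) hvi₀ (hvK n)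
    have hw' := habs (w n) w₀ (hwi n) hwi₀ (hwK n)
    have := mul_le_mul_of_nonneg_left (add_le_add (add_le_add (le_refl (volume.real (A k))) hv') hw')
      hε.le
    linarith
  have hgoal : ∫ x in A k, g x ≤ r := by
    refine le_of_forall_pos_le_add fun δ hδ => ?_
    set D := volume.real (A k) + (K + V) + (K + W) with hD
    have h1 := hstep (δ / (|D| + 1)) (by positivity)
    have h2 : δ / (|D| + 1) * D ≤ δ := by
      rw [div_mul_eq_mul_div, div_le_iff₀ (by positivity)]
      exact mul_le_mul_of_nonneg_left ((le_abs_self D).trans (by linarith)) hδ.le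
    linarith
  have hg0 : 0 ≤ᵐ[volume.restrict (A k)] g := by
    filter_upwards [ae_restrict_mem (hAm k)] with x hx
    exact sub_nonneg.2 (hm _ _ _ x (hAsub k hx))
  rw [← ofReal_integral_eq_lintegral_ofReal hgi hg0]
  exact ENNReal.ofReal_le_of_le_toReal hgoal

end Semicontinuity

/-! ### Riemann–Liouville integrals: integration by parts and semigroup property -/

section FractionalCalculus

variable {a b α β γ : ℝ} {u ψ : ℝ → ℝ}

/-- The Riemann-Liouville kernel truncated to `(0, T)`, without the normalizing constant. -/
def rlKernel (β T : ℝ) : ℝ → ℝ := (Ioo 0 T).indicator fun t => t ^ (β - 1)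

theorem integrableOn_rpow_sub_one (hβ : 0 < β) (T : ℝ) :
    IntegrableOn (fun t : ℝ => t ^ (β - 1)) (Ioo 0 T) := by
  rcases le_total 0 T with hT | hT
  · exact (intervalIntegrable_iff_integrableOn_Ioo_of_le hT).1
      (intervalIntegral.intervalIntegrable_rpow' (by linarith))
  · simp [Ioo_eq_empty (not_lt.2 hT)]

theorem integrable_rlKernel (hβ : 0 < β) (T : ℝ) : Integrable (rlKernel β T) :=
  (integrable_indicator_iff measurableSet_Ioo).2 (integrableOn_rpow_sub_one hβ T)

/-- This exhibits the fractional integral as a convolution on the whole line. Truncating the kernel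
at `b - a` loses nothing since `x - y < b - a`, and makes it integrable. -/
theorem leftRLIntegral_eq_integral_indicator {x : ℝ} (hx : x ∈ Icc a b) :
    leftRLIntegral a β u x =
      (1 / Real.Gamma β) * ∫ y, (Ioo a b).indicator u y * rlKernel β (b - a) (x - y) := by
  unfold leftRLIntegral
  rw [intervalIntegral.integral_of_le hx.1, integral_Ioc_eq_integral_Ioo,
    ← integral_indicator measurableSet_Ioo]
  congr 2 with y
  by_cases h1 : y ∈ Ioo a x
  · have h2 : y ∈ Ioo a b := ⟨h1.1, h1.2.trans_le hx.2⟩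
    have h3 : x - y ∈ Ioo 0 (b - a) := ⟨by linarith [h1.2], by linarith [h1.1, hx.2]⟩
    simp only [rlKernel, indicator_of_mem h1, indicator_of_mem h2, indicator_of_mem h3]
    ring
  · rw [indicator_of_notMem h1]
    by_cases h2 : y ∈ Ioo a b
    · have h3 : x - y ∉ Ioo 0 (b - a) := fun h => h1 ⟨h2.1, by linarith [h.1]⟩
      rw [rlKernel, indicator_of_notMem h3, mul_zero]
    · rw [indicator_of_notMem h2, zero_mul]

theorem rightRLIntegral_eq_integral_indicator {x : ℝ} (hx : x ∈ Icc a b) :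
    rightRLIntegral b β u x =
      (1 / Real.Gamma β) * ∫ y, (Ioo a b).indicator u y * rlKernel β (b - a) (y - x) := by
  unfold rightRLIntegral
  rw [intervalIntegral.integral_of_le hx.2, integral_Ioc_eq_integral_Ioo,
    ← integral_indicator measurableSet_Ioo]
  congr 2 with y
  by_cases h1 : y ∈ Ioo x b
  · have h2 : y ∈ Ioo a b := ⟨hx.1.trans_lt h1.1, h1.2⟩
    have h3 : y - x ∈ Ioo 0 (b - a) := ⟨by linarith [h1.1], by linarith [h1.2, hx.1]⟩
    simp only [rlKernel, indicator_of_mem h1, indicator_of_mem h2, indicator_of_mem h3]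
    ring
  · rw [indicator_of_notMem h1]
    by_cases h2 : y ∈ Ioo a b
    · have h3 : y - x ∉ Ioo 0 (b - a) := fun h => h1 ⟨by linarith [h.1], h2.2⟩
      rw [rlKernel, indicator_of_notMem h3, mul_zero]
    · rw [indicator_of_notMem h2, zero_mul]

theorem integrable_rlKernel_mul (hβ : 0 < β) (hu : IntegrableOn u (Ioo a b)) :
    Integrable (fun z : ℝ × ℝ => (Ioo a b).indicator u z.2 * rlKernel β (b - a) (z.1 - z.2))
      (volume.prod volume) :=
  Integrable.convolution_integrand (ContinuousLinearMap.mul ℝ ℝ)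
    ((integrable_indicator_iff measurableSet_Ioo).2 hu) (integrable_rlKernel hβ (b - a))

theorem integrableOn_leftRLIntegral (hβ : 0 < β) (hu : IntegrableOn u (Ioo a b)) :
    IntegrableOn (leftRLIntegral a β u) (Ioo a b) := by
  have h := (((integrable_rlKernel_mul hβ hu).integral_prod_left).const_mul
    (1 / Real.Gamma β)).integrableOn (s := Ioo a b)
  refine h.congr ?_
  filter_upwards [ae_restrict_mem measurableSet_Ioo] with x hx
  exact (leftRLIntegral_eq_integral_indicator (Ioo_subset_Icc_self hx)).symm

/-- Fractional integration by parts. -/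
theorem integral_leftRLIntegral_mul (hβ : 0 < β) (hu : IntegrableOn u (Ioo a b))
    (hψ : AEStronglyMeasurable ψ (volume.restrict (Ioo a b))) {C : ℝ}
    (hC : ∀ x ∈ Ioo a b, |ψ x| ≤ C) :
    ∫ x in Ioo a b, leftRLIntegral a β u x * ψ x =
      ∫ x in Ioo a b, u x * rightRLIntegral b β ψ x := by
  set Ψ := (Ioo a b).indicator ψ with hΨ
  set U := (Ioo a b).indicator u with hU
  have hΨm : AEStronglyMeasurable Ψ volume :=
    (aestronglyMeasurable_indicator_iff measurableSet_Ioo).2 hψ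
  have hΨb : ∀ x, ‖Ψ x‖ ≤ |C| := by
    intro x
    by_cases hx : x ∈ Ioo a b
    · rw [hΨ, indicator_of_mem hx]; exact (hC x hx).trans (le_abs_self C)
    · rw [hΨ, indicator_of_notMem hx]; simp
  -- An integrable convolution integrand times a bounded function, so Fubini applies.
  have hint : Integrable (Function.uncurry fun x y =>
      Ψ x * (U y * rlKernel β (b - a) (x - y))) (volume.prod volume) :=
    (integrable_rlKernel_mul hβ hu).bdd_mul
      (hΨm.comp_fst) (Eventually.of_forall fun z => hΨb z.1)
  have hswap := integral_integral_swap hint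
  have e1 : ∫ x in Ioo a b, leftRLIntegral a β u x * ψ x =
      (1 / Real.Gamma β) * ∫ x, ∫ y, Ψ x * (U y * rlKernel β (b - a) (x - y)) := by
    rw [← integral_const_mul, ← integral_indicator measurableSet_Ioo]
    congr 1 with x
    rw [integral_const_mul]
    by_cases hx : x ∈ Ioo a b
    · rw [indicator_of_mem hx, leftRLIntegral_eq_integral_indicator (Ioo_subset_Icc_self hx), hΨ,
        indicator_of_mem hx]
      ring
    · rw [indicator_of_notMem hx, hΨ, indicator_of_notMem hx]
      ring
  have e2 : ∫ x in Ioo a b, u x * rightRLIntegral b β ψ x =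
      (1 / Real.Gamma β) * ∫ y, ∫ x, Ψ x * (U y * rlKernel β (b - a) (x - y)) := by
    rw [← integral_const_mul, ← integral_indicator measurableSet_Ioo]
    congr 1 with y
    have : ∫ x, Ψ x * (U y * rlKernel β (b - a) (x - y)) =
        U y * ∫ x, Ψ x * rlKernel β (b - a) (x - y) := by
      rw [← integral_const_mul]
      congr 1 with x
      ring
    rw [this]
    by_cases hy : y ∈ Ioo a b
    · rw [indicator_of_mem hy, rightRLIntegral_eq_integral_indicator (Ioo_subset_Icc_self hy), hU,
        indicator_of_mem hy]
      ring
    · rw [indicator_of_notMem hy, hU, indicator_of_notMem hy]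
      ring
  rw [e1, e2, hswap]

theorem rightRLIntegral_eq_leftRLIntegral_reflect (a b β : ℝ) (u : ℝ → ℝ) (x : ℝ) :
    rightRLIntegral b β u x = leftRLIntegral a β (fun y => u (a + b - y)) (a + b - x) := by
  unfold rightRLIntegral leftRLIntegral
  have h := intervalIntegral.integral_comp_sub_left (a := a) (b := a + b - x)
    (fun z => (z - x) ^ (β - 1) * u z) (a + b)
  rw [show a + b - (a + b - x) = x by ring, show a + b - a = b by ring] at h
  rw [← h]
  congr 2 with y
  congr 2
  ring

theorem integral_sub_rpow {x y : ℝ} (hβ : 0 < β) :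
    ∫ t in y..x, (x - t) ^ (β - 1) = (x - y) ^ β / β := by
  rw [intervalIntegral.integral_comp_sub_left (fun t => t ^ (β - 1)) x, sub_self,
    integral_rpow (Or.inl (by linarith))]
  simp [Real.zero_rpow hβ.ne']

theorem abs_leftRLIntegral_le (hβ : 0 < β) {C : ℝ} (hC : ∀ x ∈ Ioo a b, |u x| ≤ C) {x : ℝ}
    (hx : x ∈ Icc a b) :
    |leftRLIntegral a β u x| ≤ 1 / Real.Gamma β * (|C| * ((x - a) ^ β / β)) := by
  have hG := Real.Gamma_pos_of_pos hβ
  unfold leftRLIntegral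
  rw [abs_mul, abs_of_pos (one_div_pos.2 hG)]
  gcongr
  rw [← integral_sub_rpow hβ, ← intervalIntegral.integral_const_mul]
  have hi : IntervalIntegrable (fun t => |C| * (x - t) ^ (β - 1)) volume a x := by
    refine IntervalIntegrable.const_mul ?_ _
    have := (intervalIntegral.intervalIntegrable_rpow' (a := 0) (b := x - a) (r := β - 1)
      (by linarith)).comp_sub_left x
    simpa using this.symm
  rw [← Real.norm_eq_abs]
  refine intervalIntegral.norm_integral_le_of_norm_le hx.1 ?_ hi
  have hne : ∀ᵐ t : ℝ, t ≠ x := by simp [ae_iff]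
  filter_upwards [hne] with t ht htm
  have ht' : t ∈ Ioo a b := ⟨htm.1, (lt_of_le_of_ne htm.2 ht).trans_le hx.2⟩
  rw [norm_mul, mul_comm, Real.norm_of_nonneg (Real.rpow_nonneg (by linarith [htm.2]) _)]
  gcongr
  · exact Real.rpow_nonneg (by linarith [htm.2]) _
  · exact (hC t ht').trans (le_abs_self C)

theorem exists_abs_leftRLIntegral_le (hβ : 0 < β) {C : ℝ} (hC : ∀ x ∈ Ioo a b, |u x| ≤ C) :
    ∃ C', ∀ x ∈ Icc a b, |leftRLIntegral a β u x| ≤ C' := by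
  have hG := Real.Gamma_pos_of_pos hβ
  refine ⟨1 / Real.Gamma β * (|C| * ((b - a) ^ β / β)), fun x hx => ?_⟩
  refine (abs_leftRLIntegral_le hβ hC hx).trans ?_
  have : (x - a) ^ β ≤ (b - a) ^ β :=
    Real.rpow_le_rpow (by linarith [hx.1]) (by linarith [hx.2]) hβ.le
  gcongr

theorem measurePreserving_reflect (a b : ℝ) :
    MeasurePreserving (fun x : ℝ => a + b - x) (volume.restrict (Ioo a b))
      (volume.restrict (Ioo a b)) := by
  have h := (Measure.measurePreserving_sub_left volume (a + b)).restrict_preimage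
    (measurableSet_Ioo (a := a) (b := b))
  have e : (fun x : ℝ => a + b - x) ⁻¹' Ioo a b = Ioo a b := by
    ext x
    simp only [mem_preimage, mem_Ioo]
    constructor <;> rintro ⟨h1, h2⟩ <;> constructor <;> linarith
  rwa [e] at h

theorem reflect_mem_Ioo {x : ℝ} (hx : x ∈ Ioo a b) : a + b - x ∈ Ioo a b :=
  ⟨by linarith [hx.2], by linarith [hx.1]⟩

theorem reflect_mem_Icc {x : ℝ} (hx : x ∈ Icc a b) : a + b - x ∈ Icc a b :=
  ⟨by linarith [hx.2], by linarith [hx.1]⟩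

theorem exists_abs_rightRLIntegral_le (hβ : 0 < β) {C : ℝ} (hC : ∀ x ∈ Ioo a b, |u x| ≤ C) :
    ∃ C', ∀ x ∈ Icc a b, |rightRLIntegral b β u x| ≤ C' := by
  obtain ⟨C', hC'⟩ := exists_abs_leftRLIntegral_le (a := a) (b := b) hβ
    (u := fun y => u (a + b - y)) (fun x hx => hC _ (reflect_mem_Ioo hx))
  refine ⟨C', fun x hx => ?_⟩
  rw [rightRLIntegral_eq_leftRLIntegral_reflect a b]
  exact hC' _ (reflect_mem_Icc hx)

theorem integrableOn_rightRLIntegral (hβ : 0 < β) (hu : IntegrableOn u (Ioo a b)) :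
    IntegrableOn (rightRLIntegral b β u) (Ioo a b) := by
  have hr := measurePreserving_reflect a b
  have h1 : IntegrableOn (fun y => u (a + b - y)) (Ioo a b) := hr.integrable_comp_of_integrable hu
  have h2 := hr.integrable_comp_of_integrable (integrableOn_leftRLIntegral hβ h1)
  refine h2.congr (Eventually.of_forall fun x => ?_)
  exact (rightRLIntegral_eq_leftRLIntegral_reflect a b β u x).symm

/-- This is the Beta integral `B(β, γ) = Γ(β) Γ(γ) / Γ(β + γ)`, rescaled to `(y, x)`. As `β + γ =
1`, both the scaling factor and the denominator equal 1. -/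
theorem integral_rpow_mul_rpow {x y : ℝ} (hβ : 0 < β) (hγ : 0 < γ) (h1 : β + γ = 1) (hxy : y < x) :
    ∫ t in y..x, (x - t) ^ (γ - 1) * (t - y) ^ (β - 1) = Real.Gamma β * Real.Gamma γ := by
  have h := intervalIntegral.integral_comp_add_left (a := 0) (b := x - y)
    (fun t => (x - t) ^ (γ - 1) * (t - y) ^ (β - 1)) y
  rw [add_zero, add_sub_cancel] at h
  rw [← h]
  have hb := Complex.betaIntegral_scaled (β : ℂ) (γ : ℂ) (a := x - y) (by linarith)
  have hg := Complex.Gamma_mul_Gamma_eq_betaIntegral (s := (β : ℂ)) (t := (γ : ℂ))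
    (by simpa using hβ) (by simpa using hγ)
  have h1' : (β : ℂ) + (γ : ℂ) = 1 := by exact_mod_cast congrArg ((↑) : ℝ → ℂ) h1
  rw [h1', sub_self, Complex.cpow_zero, one_mul] at hb
  rw [h1', Complex.Gamma_one, one_mul] at hg
  rw [← hg, Complex.Gamma_ofReal, Complex.Gamma_ofReal] at hb
  have key : ((∫ t in (0 : ℝ)..(x - y), (x - (y + t)) ^ (γ - 1) * (y + t - y) ^ (β - 1) : ℝ) : ℂ) =
      ((Real.Gamma β * Real.Gamma γ : ℝ) : ℂ) := by
    rw [Complex.ofReal_mul, ← hb, ← intervalIntegral.integral_ofReal]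
    refine intervalIntegral.integral_congr fun t ht => ?_
    rw [uIcc_of_le (by linarith)] at ht
    rw [Complex.ofReal_mul, Complex.ofReal_cpow (by linarith [ht.2]),
      Complex.ofReal_cpow (by linarith [ht.1])]
    push_cast
    rw [mul_comm]
    congr 2 <;> ring
  exact_mod_cast key

/-- The complementary fractional integral of `(t - a)^(β - 1)` is constant. With `β = α` this is why
`(x - a)^(α - 1)` has left derivative zero. -/
theorem leftRLIntegral_rpow {x : ℝ} (hβ : 0 < β) (hγ : 0 < γ) (h1 : β + γ = 1) (hx : a < x) :
    leftRLIntegral a γ (fun t => (t - a) ^ (β - 1)) x = Real.Gamma β := by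
  unfold leftRLIntegral
  rw [integral_rpow_mul_rpow hβ hγ h1 hx]
  field_simp [(Real.Gamma_pos_of_pos hγ).ne']

theorem integrableOn_sub_rpow (hβ : 0 < β) (a b : ℝ) :
    IntegrableOn (fun t => (t - a) ^ (β - 1)) (Ioo a b) := by
  rcases le_total a b with hab | hab
  · refine (intervalIntegrable_iff_integrableOn_Ioo_of_le hab).1 ?_
    have := (intervalIntegral.intervalIntegrable_rpow' (a := 0) (b := b - a) (r := β - 1)
      (by linarith)).comp_sub_right a
    simpa using this
  · simp [Ioo_eq_empty (not_lt.2 hab)]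

theorem rightRLIntegral_one (b : ℝ) (ψ : ℝ → ℝ) (x : ℝ) :
    rightRLIntegral b 1 ψ x = ∫ y in x..b, ψ y := by
  simp [rightRLIntegral]

theorem leftRLIntegral_one (a : ℝ) (ψ : ℝ → ℝ) (x : ℝ) :
    leftRLIntegral a 1 ψ x = ∫ y in a..x, ψ y := by
  simp [leftRLIntegral]

/-- Semigroup property of the right fractional integrals, for complementary orders. -/
theorem rightRLIntegral_rightRLIntegral (hβ : 0 < β) (hγ : 0 < γ) (h1 : β + γ = 1)
    (hψ : AEStronglyMeasurable ψ (volume.restrict (Ioo a b))) {C : ℝ}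
    (hC : ∀ x ∈ Ioo a b, |ψ x| ≤ C) {y : ℝ} (hy : y ∈ Icc a b) :
    rightRLIntegral b β (rightRLIntegral b γ ψ) y = ∫ x in y..b, ψ x := by
  have hsub : Ioo y b ⊆ Ioo a b := Ioo_subset_Ioo_left hy.1
  -- The outer integral at `y` pairs `rightRLIntegral b γ ψ` with `(t - y)^(β - 1)` on `(y, b)`.
  -- Integration by parts moves the order `γ` onto that power, which becomes the constant `Γ(β)`.
  have h := integral_leftRLIntegral_mul (a := y) (b := b) (ψ := ψ) hγ (integrableOn_sub_rpow hβ y b)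
    (hψ.mono_measure (Measure.restrict_mono hsub le_rfl)) (fun x hx => hC x (hsub hx))
  have e : ∫ x in Ioo y b, leftRLIntegral y γ (fun t => (t - y) ^ (β - 1)) x * ψ x =
      Real.Gamma β * ∫ x in Ioo y b, ψ x := by
    rw [← integral_const_mul]
    refine setIntegral_congr_fun measurableSet_Ioo fun x hx => ?_
    simp only [leftRLIntegral_rpow hβ hγ h1 hx.1]
  rw [e] at h
  rw [rightRLIntegral, intervalIntegral.integral_of_le hy.2, integral_Ioc_eq_integral_Ioo, ← h,
    intervalIntegral.integral_of_le hy.2, integral_Ioc_eq_integral_Ioo]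
  field_simp [(Real.Gamma_pos_of_pos hβ).ne']

end FractionalCalculus

/-! ### Fractional integrals of test functions and the lemma of du Bois-Reymond -/

section WeakDerivative

variable {a b α β : ℝ} {u v φ : ℝ → ℝ}

theorem IsTestFunction.eq_zero_of_notMem (hφ : IsTestFunction a b φ) {x : ℝ} (hx : x ∉ Ioo a b) :
    φ x = 0 :=
  image_eq_zero_of_notMem_tsupport fun h => hx (hφ.2.2 h)

theorem IsTestFunction.deriv (hφ : IsTestFunction a b φ) : IsTestFunction a b (deriv φ) :=
  ⟨(contDiff_infty_iff_deriv.1 hφ.1).2, hφ.2.1.deriv,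
    tsupport_deriv_subset.trans hφ.2.2⟩

theorem IsTestFunction.exists_abs_le (hφ : IsTestFunction a b φ) : ∃ C, ∀ x, |φ x| ≤ C :=
  hφ.1.continuous.bounded_above_of_compact_support hφ.2.1

theorem IsTestFunction.differentiable (hφ : IsTestFunction a b φ) : Differentiable ℝ φ :=
  (contDiff_infty_iff_deriv.1 hφ.1).1

theorem IsTestFunction.integrable (hφ : IsTestFunction a b φ) : Integrable φ :=
  hφ.1.continuous.integrable_of_hasCompactSupport hφ.2.1

theorem IsTestFunction.intervalIntegral_deriv (hφ : IsTestFunction a b φ) (x : ℝ) :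
    ∫ y in x..b, _root_.deriv φ y = -φ x := by
  rw [intervalIntegral.integral_deriv_eq_sub (fun y _ => hφ.differentiable y)
    (hφ.deriv.1.continuous.intervalIntegrable _ _),
    hφ.eq_zero_of_notMem (x := b) (by simp), zero_sub]

theorem IsTestFunction.integral_deriv (hφ : IsTestFunction a b φ) (hab : a ≤ b) :
    ∫ y in Ioo a b, _root_.deriv φ y = 0 := by
  rw [← integral_Ioc_eq_integral_Ioo, ← intervalIntegral.integral_of_le hab,
    hφ.intervalIntegral_deriv, hφ.eq_zero_of_notMem (by simp), neg_zero]

/-- The substitution moves the dependence on `x` from the singular kernel to `φ`. As `φ` vanishes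
beyond `b`, the range of integration can be fixed too, so one may differentiate under the integral
sign. -/
theorem rightRLIntegral_eq_setIntegral (hφ : ∀ x, b ≤ x → φ x = 0) {x : ℝ} (hx : x ∈ Icc a b) :
    rightRLIntegral b β φ x =
      1 / Real.Gamma β * ∫ t in Ioo 0 (b - a), t ^ (β - 1) * φ (x + t) := by
  unfold rightRLIntegral
  congr 1
  have h := intervalIntegral.integral_comp_add_left (a := 0) (b := b - x)
    (fun y => (y - x) ^ (β - 1) * φ y) x
  rw [add_zero, add_sub_cancel] at h
  rw [← h, intervalIntegral.integral_of_le (by linarith [hx.2]), integral_Ioc_eq_integral_Ioo]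
  simp only [add_sub_cancel_left]
  refine (setIntegral_eq_of_subset_of_forall_sdiff_eq_zero measurableSet_Ioo
    (Ioo_subset_Ioo_right (by linarith [hx.1])) fun t ht => ?_).symm
  have : b - x ≤ t := by
    by_contra hlt
    exact ht.2 ⟨ht.1.1, not_le.1 hlt⟩
  rw [hφ _ (by linarith), mul_zero]

theorem hasDerivAt_setIntegral_rpow_mul (hβ : 0 < β) (hφ : IsTestFunction a b φ) (x : ℝ) :
    HasDerivAt (fun x => ∫ t in Ioo 0 (b - a), t ^ (β - 1) * φ (x + t))
      (∫ t in Ioo 0 (b - a), t ^ (β - 1) * deriv φ (x + t)) x := by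
  obtain ⟨C, hC⟩ := hφ.exists_abs_le
  obtain ⟨C', hC'⟩ := hφ.deriv.exists_abs_le
  have hk := integrableOn_rpow_sub_one hβ (b - a)
  have hm : ∀ g : ℝ → ℝ, Continuous g → ∀ x, AEStronglyMeasurable
      (fun t => t ^ (β - 1) * g (x + t)) (volume.restrict (Ioo 0 (b - a))) := fun g hg x =>
    hk.aestronglyMeasurable.mul (hg.comp (continuous_const.add continuous_id)).aestronglyMeasurable
  refine (hasDerivAt_integral_of_dominated_loc_of_deriv_le (s := univ)
    (bound := fun t => C' * t ^ (β - 1))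
    (F' := fun x t => t ^ (β - 1) * deriv φ (x + t)) univ_mem
    (Eventually.of_forall fun x => hm φ hφ.1.continuous x) ?_
    (hm _ hφ.deriv.1.continuous x) ?_ (hk.const_mul C') ?_).2
  · refine Integrable.mono' (hk.const_mul C) (hm φ hφ.1.continuous x) ?_
    filter_upwards [ae_restrict_mem measurableSet_Ioo] with t ht
    rw [norm_mul, Real.norm_of_nonneg (Real.rpow_nonneg ht.1.le _), mul_comm]
    exact mul_le_mul_of_nonneg_right (hC _) (Real.rpow_nonneg ht.1.le _)
  · filter_upwards [ae_restrict_mem measurableSet_Ioo] with t ht y _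
    rw [norm_mul, Real.norm_of_nonneg (Real.rpow_nonneg ht.1.le _), mul_comm]
    exact mul_le_mul_of_nonneg_right (hC' _) (Real.rpow_nonneg ht.1.le _)
  · refine Eventually.of_forall fun t y _ => ?_
    have h := (hφ.differentiable (y + t)).hasDerivAt.comp_add_const y t
    exact h.const_mul _

theorem hasDerivAt_rightRLIntegral (hβ : 0 < β) (hφ : IsTestFunction a b φ) {x : ℝ}
    (hx : x ∈ Ioo a b) :
    HasDerivAt (rightRLIntegral b β φ) (rightRLIntegral b β (deriv φ) x) x := by
  have hz : ∀ y, b ≤ y → φ y = 0 := fun y hy => hφ.eq_zero_of_notMem fun h => hy.not_gt h.2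
  have hz' : ∀ y, b ≤ y → deriv φ y = 0 := fun y hy =>
    hφ.deriv.eq_zero_of_notMem fun h => hy.not_gt h.2
  rw [rightRLIntegral_eq_setIntegral hz' (Ioo_subset_Icc_self hx)]
  refine ((hasDerivAt_setIntegral_rpow_mul hβ hφ x).const_mul _).congr_of_eventuallyEq ?_
  filter_upwards [isOpen_Ioo.mem_nhds hx] with y hy
  exact rightRLIntegral_eq_setIntegral hz (Ioo_subset_Icc_self hy)

theorem continuousOn_rightRLIntegral (hβ : 0 < β) (hφ : IsTestFunction a b φ) :
    ContinuousOn (rightRLIntegral b β φ) (Icc a b) := by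
  have hz : ∀ y, b ≤ y → φ y = 0 := fun y hy => hφ.eq_zero_of_notMem fun h => hy.not_gt h.2
  have h : Continuous fun x => 1 / Real.Gamma β * ∫ t in Ioo 0 (b - a), t ^ (β - 1) * φ (x + t) :=
    continuous_const.mul (continuous_iff_continuousAt.2 fun x =>
      (hasDerivAt_setIntegral_rpow_mul hβ hφ x).continuousAt)
  exact h.continuousOn.congr fun x hx => rightRLIntegral_eq_setIntegral hz hx

theorem intervalIntegral_rightRLIntegral_deriv (hβ : 0 < β) (hφ : IsTestFunction a b φ) {x : ℝ}
    (hx : x ∈ Icc a b) :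
    ∫ y in x..b, rightRLIntegral b β (deriv φ) y = -rightRLIntegral b β φ x := by
  have hsub : Icc x b ⊆ Icc a b := Icc_subset_Icc_left hx.1
  rw [intervalIntegral.integral_eq_sub_of_hasDerivAt_of_le hx.2
    ((continuousOn_rightRLIntegral hβ hφ).mono hsub)
    (fun y hy => hasDerivAt_rightRLIntegral hβ hφ ⟨hx.1.trans_lt hy.1, hy.2⟩)]
  · simp [rightRLIntegral]
  · refine ContinuousOn.intervalIntegrable_of_Icc hx.2 ?_
    exact (continuousOn_rightRLIntegral hβ hφ.deriv).mono hsub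

theorem rightRLDeriv_eq (hα : α < 1) (hφ : IsTestFunction a b φ) {x : ℝ} (hx : x ∈ Ioo a b) :
    rightRLDeriv b α φ x = -rightRLIntegral b (1 - α) (deriv φ) x := by
  rw [rightRLDeriv, (hasDerivAt_rightRLIntegral (by linarith) hφ hx).deriv]

theorem setIntegral_mul_rightRLDeriv (hα : α < 1) (hφ : IsTestFunction a b φ) (u : ℝ → ℝ) :
    ∫ x in Ioo a b, u x * rightRLDeriv b α φ x =
      -∫ x in Ioo a b, u x * rightRLIntegral b (1 - α) (deriv φ) x := by
  rw [← integral_neg]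
  refine setIntegral_congr_fun measurableSet_Ioo fun x hx => ?_
  simp only [rightRLDeriv_eq hα hφ hx]
  ring

theorem IsTestFunction.aestronglyMeasurable (hφ : IsTestFunction a b φ) :
    AEStronglyMeasurable φ (volume.restrict (Ioo a b)) :=
  hφ.1.continuous.aestronglyMeasurable

theorem ae_eq_of_forall_integral_test_eq {f g : ℝ → ℝ} (hf : LocallyIntegrableOn f (Ioo a b))
    (hg : LocallyIntegrableOn g (Ioo a b))
    (h : ∀ φ, IsTestFunction a b φ → ∫ x in Ioo a b, f x * φ x = ∫ x in Ioo a b, g x * φ x) :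
    f =ᵐ[volume.restrict (Ioo a b)] g := by
  have hint : ∀ k : ℝ → ℝ, LocallyIntegrableOn k (Ioo a b) → ∀ φ, IsTestFunction a b φ →
      Integrable (fun x => φ x * k x) := by
    intro k hk φ hφ
    have h1 := (hk.integrableOn_compact_subset hφ.2.2 hφ.2.1)
    have h2 := (integrable_indicator_iff (isClosed_tsupport φ).measurableSet).2 h1
    obtain ⟨C, hC⟩ := hφ.exists_abs_le
    refine (h2.bdd_mul hφ.1.continuous.aestronglyMeasurable (Eventually.of_forall hC)).congr
      (Eventually.of_forall fun x => ?_)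
    by_cases hx : x ∈ tsupport φ
    · simp [hx]
    · simp [hx, image_eq_zero_of_notMem_tsupport hx]
  have hset : ∀ k : ℝ → ℝ, ∀ φ, IsTestFunction a b φ →
      ∫ x, φ x * k x = ∫ x in Ioo a b, k x * φ x := by
    intro k φ hφ
    rw [← setIntegral_eq_integral_of_forall_compl_eq_zero (s := Ioo a b) fun x hx => by
      rw [hφ.eq_zero_of_notMem hx, zero_mul]]
    simp_rw [mul_comm]
  have key := isOpen_Ioo.ae_eq_zero_of_integral_contDiff_smul_eq_zero (μ := volume)
    (f := fun x => f x - g x) (hf.sub hg) (fun φ h1 h2 h3 => by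
      have hφ : IsTestFunction a b φ := ⟨h1, h2, h3⟩
      simp only [smul_eq_mul, mul_sub]
      rw [integral_sub (hint f hf φ hφ) (hint g hg φ hφ), hset f φ hφ, hset g φ hφ, h φ hφ, sub_self])
  rw [EventuallyEq, ae_restrict_iff' measurableSet_Ioo]
  filter_upwards [key] with x hx hxm
  exact sub_eq_zero.1 (hx hxm)

theorem exists_subset_Icc_of_isCompact_subset_Ioo {K : Set ℝ} (hab : a < b) (hK : IsCompact K)
    (h : K ⊆ Ioo a b) : ∃ c d, a < c ∧ d < b ∧ K ⊆ Icc c d := by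
  rcases K.eq_empty_or_nonempty with rfl | hne
  · exact ⟨b, a, hab, hab, empty_subset _⟩
  · obtain ⟨c, hc, hc'⟩ := hK.exists_isLeast hne
    obtain ⟨d, hd, hd'⟩ := hK.exists_isGreatest hne
    exact ⟨c, d, (h hc).1, (h hd).2, fun x hx => ⟨hc' hx, hd' hx⟩⟩

/-- The primitive starting at `a` vanishes to the left of the support of `η`, and to the right of it
because the total integral is zero. -/
theorem IsTestFunction.exists_deriv_eq (hab : a < b) {η : ℝ → ℝ} (hη : IsTestFunction a b η)
    (h0 : ∫ x, η x = 0) : ∃ φ, IsTestFunction a b φ ∧ _root_.deriv φ = η := by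
  obtain ⟨c, d, hc, hd, hcd⟩ := exists_subset_Icc_of_isCompact_subset_Ioo hab hη.2.1 hη.2.2
  have hz : ∀ x, x ∉ Icc c d → η x = 0 := fun x hx =>
    image_eq_zero_of_notMem_tsupport fun h => hx (hcd h)
  set φ : ℝ → ℝ := fun x => ∫ y in a..x, η y with hφ
  have hder : ∀ x, HasDerivAt φ (η x) x := fun x =>
    hη.1.continuous.integral_hasStrictDerivAt a x |>.hasDerivAt
  have hderiv : _root_.deriv φ = η := funext fun x => (hder x).deriv
  have hsupp : tsupport φ ⊆ Icc c d := by
    refine closure_minimal (fun x hx => ?_) isClosed_Icc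
    by_contra hxn
    refine hx ?_
    rcases lt_or_ge x c with hxc | hxc
    · have : ∀ y ∈ uIcc a x, η y = 0 := fun y hy => hz y fun hy' => by
        have := hy.2
        rcases le_max_iff.1 this with h | h <;> linarith [hy'.1]
      exact (intervalIntegral.integral_congr (g := fun _ => 0) this).trans (by simp)
    · have hxd : d < x := by
        by_contra hle
        exact hxn ⟨hxc, not_lt.1 hle⟩
      rcases le_or_gt a x with hax | hax
      · simp only [hφ]
        rw [intervalIntegral.integral_of_le hax, setIntegral_eq_integral_of_forall_compl_eq_zero, h0]
        intro y hy
        refine hz y fun hy' => hy ⟨by linarith [hy'.1], by linarith [hy'.2]⟩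
      · have : ∀ y ∈ uIcc a x, η y = 0 := fun y hy => hz y fun hy' => by
          have := hy.1
          rcases min_le_iff.1 this with h | h <;> linarith [hy'.1, hy'.2]
        exact (intervalIntegral.integral_congr (g := fun _ => 0) this).trans (by simp)
  refine ⟨φ, ⟨?_, ?_, hsupp.trans (Icc_subset_Ioo hc hd)⟩, hderiv⟩
  · rw [contDiff_infty_iff_deriv, hderiv]
    exact ⟨fun x => (hder x).differentiableAt, hη.1⟩
  · exact isCompact_Icc.of_isClosed_subset (isClosed_tsupport φ) hsupp

theorem exists_isTestFunction_integral_eq_one (hab : a < b) :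
    ∃ ρ, IsTestFunction a b ρ ∧ ∫ x, ρ x = 1 := by
  let f : ContDiffBump ((a + b) / 2) :=
    ⟨(b - a) / 8, (b - a) / 4, by linarith, by linarith⟩
  refine ⟨f.normed volume, ⟨f.contDiff_normed, f.hasCompactSupport_normed, ?_⟩,
    f.integral_normed⟩
  rw [f.tsupport_normed_eq, Real.closedBall_eq_Icc]
  exact Icc_subset_Ioo (by simp only [f]; linarith) (by simp only [f]; linarith)

theorem IsTestFunction.sub_const_mul {ψ ρ : ℝ → ℝ} (hψ : IsTestFunction a b ψ)
    (hρ : IsTestFunction a b ρ) (c : ℝ) : IsTestFunction a b fun x => ψ x - c * ρ x := by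
  have hsub : tsupport (fun x => ψ x - c * ρ x) ⊆ tsupport ψ ∪ tsupport ρ := by
    refine closure_minimal (fun x hx => ?_)
      ((isClosed_tsupport ψ).union (isClosed_tsupport ρ))
    by_contra hn
    rw [mem_union, not_or] at hn
    exact hx (by
      simp [image_eq_zero_of_notMem_tsupport hn.1, image_eq_zero_of_notMem_tsupport hn.2])
  exact ⟨hψ.1.sub (contDiff_const.mul hρ.1),
    (hψ.2.1.union hρ.2.1).of_isClosed_subset (isClosed_tsupport _) hsub,
    hsub.trans (union_subset hψ.2.2 hρ.2.2)⟩

theorem IsTestFunction.setIntegral_eq (hφ : IsTestFunction a b φ) :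
    ∫ x in Ioo a b, φ x = ∫ x, φ x :=
  setIntegral_eq_integral_of_forall_compl_eq_zero fun _ hx => hφ.eq_zero_of_notMem hx

theorem integrableOn_mul_test {W : ℝ → ℝ} (hW : IntegrableOn W (Ioo a b))
    (hφ : IsTestFunction a b φ) : IntegrableOn (fun x => W x * φ x) (Ioo a b) := by
  obtain ⟨C, hC⟩ := hφ.exists_abs_le
  exact hW.mul_bdd hφ.aestronglyMeasurable (Eventually.of_forall hC)

/-- The lemma of du Bois-Reymond. -/
theorem ae_eq_const_of_forall_integral_deriv_eq_zero (hab : a < b) {W : ℝ → ℝ}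
    (hW : IntegrableOn W (Ioo a b))
    (h : ∀ φ, IsTestFunction a b φ → ∫ x in Ioo a b, W x * deriv φ x = 0) :
    ∃ C, W =ᵐ[volume.restrict (Ioo a b)] fun _ => C := by
  obtain ⟨ρ, hρ, hρ1⟩ := exists_isTestFunction_integral_eq_one hab
  refine ⟨∫ x in Ioo a b, W x * ρ x, ?_⟩
  have hc : IntegrableOn (fun _ : ℝ => ∫ x in Ioo a b, W x * ρ x) (Ioo a b) :=
    integrableOn_const (by simp)
  refine ae_eq_of_forall_integral_test_eq hW.locallyIntegrableOn hc.locallyIntegrableOn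
    fun ψ hψ => ?_
  -- Subtracting the multiple of `ρ` with the same total mass leaves mean zero, hence a derivative
  -- of a test function, against which `W` integrates to zero.
  have hη := hψ.sub_const_mul hρ (∫ x, ψ x)
  obtain ⟨φ, hφ, hφη⟩ := hη.exists_deriv_eq hab (by
    rw [integral_sub hψ.integrable (hρ.integrable.const_mul _), integral_const_mul, hρ1]
    ring)
  have h0 := h φ hφ
  simp only [hφη, mul_sub] at h0
  have e : ∀ x, W x * ((∫ x, ψ x) * ρ x) = (∫ x, ψ x) * (W x * ρ x) := fun x => by ring
  simp_rw [e] at h0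
  rw [integral_sub (integrableOn_mul_test hW hψ) ((integrableOn_mul_test hW hρ).const_mul _),
    integral_const_mul] at h0
  rw [integral_const_mul, hψ.setIntegral_eq]
  linarith

end WeakDerivative

/-! ### Functions with a weak derivative as fractional integrals -/

section Representation

variable {a b α : ℝ} {u v φ : ℝ → ℝ}

theorem aestronglyMeasurable_rightRLIntegral {β : ℝ} (hβ : 0 < β) (hφ : IsTestFunction a b φ) :
    AEStronglyMeasurable (rightRLIntegral b β φ) (volume.restrict (Ioo a b)) :=
  ((continuousOn_rightRLIntegral hβ hφ).mono Ioo_subset_Icc_self).aestronglyMeasurable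
    measurableSet_Ioo

theorem setIntegral_mul_intervalIntegral_deriv (hφ : IsTestFunction a b φ) (v : ℝ → ℝ) :
    ∫ x in Ioo a b, v x * ∫ y in x..b, deriv φ y = -∫ x in Ioo a b, v x * φ x := by
  simp_rw [hφ.intervalIntegral_deriv, mul_neg]
  exact integral_neg _

/-- Both terms are paired with `I^(1-α) φ'`. Integration by parts turns the singular one into a
multiple of `∫ φ' = 0`; for the other, the semigroup property gives `∫ v * ∫_x^b φ' = -∫ v * φ`. -/
theorem isLeftWeakDeriv_of_eq_add (hab : a ≤ b) (hα0 : 0 < α) (hα1 : α < 1)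
    (hv : IntegrableOn v (Ioo a b)) {C : ℝ}
    (hu : u =ᵐ[volume.restrict (Ioo a b)]
      fun x => C * (x - a) ^ (α - 1) + leftRLIntegral a α v x) :
    IsLeftWeakDeriv a b α u v := by
  have hκ := (integrableOn_sub_rpow hα0 a b).const_mul C
  have hI := integrableOn_leftRLIntegral hα0 hv
  refine ⟨(hκ.add hI).congr hu.symm, hv.locallyIntegrableOn, fun φ hφ => ?_⟩
  rw [setIntegral_mul_rightRLDeriv hα1 hφ]
  have hβ : 0 < 1 - α := by linarith
  obtain ⟨c, hc⟩ := hφ.deriv.exists_abs_le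
  obtain ⟨c', hc'⟩ := exists_abs_rightRLIntegral_le (a := a) (b := b) hβ fun x _ => hc x
  have hm := aestronglyMeasurable_rightRLIntegral hβ hφ.deriv
  have hbd : ∀ x ∈ Ioo a b, |rightRLIntegral b (1 - α) (deriv φ) x| ≤ c' := fun x hx =>
    hc' x (Ioo_subset_Icc_self hx)
  have hbd' : ∀ᵐ x ∂volume.restrict (Ioo a b), ‖rightRLIntegral b (1 - α) (deriv φ) x‖ ≤ c' :=
    (ae_restrict_mem measurableSet_Ioo).mono hbd
  have e0 : ∫ x in Ioo a b, u x * rightRLIntegral b (1 - α) (deriv φ) x =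
      (∫ x in Ioo a b, C * (x - a) ^ (α - 1) * rightRLIntegral b (1 - α) (deriv φ) x) +
      ∫ x in Ioo a b, leftRLIntegral a α v x * rightRLIntegral b (1 - α) (deriv φ) x := by
    rw [← integral_add (hκ.mul_bdd hm hbd') (hI.mul_bdd hm hbd')]
    refine integral_congr_ae (hu.mono fun x hx => ?_)
    simp only [hx]
    ring
  have e1 : ∫ x in Ioo a b, C * (x - a) ^ (α - 1) * rightRLIntegral b (1 - α) (deriv φ) x = 0 := by
    simp_rw [mul_assoc]
    rw [integral_const_mul, ← integral_leftRLIntegral_mul hβ (integrableOn_sub_rpow hα0 a b)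
      hφ.deriv.aestronglyMeasurable fun x _ => hc x]
    have : ∫ x in Ioo a b, leftRLIntegral a (1 - α) (fun t => (t - a) ^ (α - 1)) x * deriv φ x =
        Real.Gamma α * ∫ x in Ioo a b, deriv φ x := by
      rw [← integral_const_mul]
      refine setIntegral_congr_fun measurableSet_Ioo fun x hx => ?_
      simp only [leftRLIntegral_rpow hα0 hβ (by ring) hx.1]
    rw [this, hφ.integral_deriv hab, mul_zero, mul_zero]
  have e2 : ∫ x in Ioo a b, leftRLIntegral a α v x * rightRLIntegral b (1 - α) (deriv φ) x =
      -∫ x in Ioo a b, v x * φ x := by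
    rw [integral_leftRLIntegral_mul hα0 hv hm hbd, ← setIntegral_mul_intervalIntegral_deriv hφ]
    refine setIntegral_congr_fun measurableSet_Ioo fun x hx => ?_
    rw [rightRLIntegral_rightRLIntegral (a := a) hα0 hβ (by ring) hφ.deriv.aestronglyMeasurable
      (fun x _ => hc x) (Ioo_subset_Icc_self hx)]
  rw [e0, e1, e2]
  ring

/-- A function with an integrable left weak fractional derivative `v` is the fractional integral
of `v`, up to a multiple of `(x - a) ^ (α - 1)`. -/
theorem IsLeftWeakDeriv.exists_eq_add (hab : a < b) (hα0 : 0 < α) (hα1 : α < 1)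
    (h : IsLeftWeakDeriv a b α u v) (hv : IntegrableOn v (Ioo a b)) :
    ∃ C, (leftRLIntegral a (1 - α) u =ᵐ[volume.restrict (Ioo a b)]
        fun x => C * Real.Gamma α + ∫ y in a..x, v y) ∧
      u =ᵐ[volume.restrict (Ioo a b)] fun x => C * (x - a) ^ (α - 1) + leftRLIntegral a α v x := by
  obtain ⟨hu, -, hw⟩ := h
  have hβ : 0 < 1 - α := by linarith
  have hG := Real.Gamma_pos_of_pos hα0
  have hJ := integrableOn_leftRLIntegral hβ hu
  have hV := integrableOn_leftRLIntegral one_pos hv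
  -- Against `φ'`, both `I^(1-α) u` and the primitive of `v` integrate to `-∫ v * φ`, so their
  -- difference is a constant `D`.
  have hJV : ∀ φ, IsTestFunction a b φ →
      ∫ x in Ioo a b, (leftRLIntegral a (1 - α) u x - leftRLIntegral a 1 v x) * deriv φ x = 0 := by
    intro φ hφ
    obtain ⟨c, hc⟩ := hφ.deriv.exists_abs_le
    simp_rw [sub_mul]
    rw [integral_sub (integrableOn_mul_test hJ hφ.deriv) (integrableOn_mul_test hV hφ.deriv),
      integral_leftRLIntegral_mul hβ hu hφ.deriv.aestronglyMeasurable fun x _ => hc x,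
      integral_leftRLIntegral_mul one_pos hv hφ.deriv.aestronglyMeasurable fun x _ => hc x]
    simp_rw [rightRLIntegral_one]
    rw [setIntegral_mul_intervalIntegral_deriv hφ, hw φ hφ, setIntegral_mul_rightRLDeriv hα1 hφ]
    ring
  obtain ⟨D, hD⟩ := ae_eq_const_of_forall_integral_deriv_eq_zero hab (hJ.sub hV) hJV
  have hD' : leftRLIntegral a (1 - α) u =ᵐ[volume.restrict (Ioo a b)]
      fun x => D + leftRLIntegral a 1 v x := hD.mono fun x hx => by
    simp only [Pi.sub_apply] at hx
    linarith
  refine ⟨D / Real.Gamma α, ?_, ?_⟩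
  · refine hD'.mono fun x hx => ?_
    simp only [hx, div_mul_cancel₀ _ hG.ne', leftRLIntegral_one]
  have hκ := (integrableOn_sub_rpow hα0 a b).const_mul (D / Real.Gamma α)
  have hI := integrableOn_leftRLIntegral hα0 hv
  refine ae_eq_of_forall_integral_test_eq hu.locallyIntegrableOn
    (IntegrableOn.locallyIntegrableOn (hκ.add hI)) fun φ hφ => ?_
  obtain ⟨c, hc⟩ := hφ.exists_abs_le
  obtain ⟨c₁, hc₁⟩ := hφ.deriv.exists_abs_le
  obtain ⟨c', hc'⟩ := exists_abs_rightRLIntegral_le (a := a) (b := b) hα0 fun x _ => hc₁ x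
  have hm := aestronglyMeasurable_rightRLIntegral hα0 hφ.deriv
  have hbd : ∀ x ∈ Ioo a b, |rightRLIntegral b α (deriv φ) x| ≤ c' := fun x hx =>
    hc' x (Ioo_subset_Icc_self hx)
  have hbd' : ∀ᵐ x ∂volume.restrict (Ioo a b), ‖rightRLIntegral b α (deriv φ) x‖ ≤ c' :=
    (ae_restrict_mem measurableSet_Ioo).mono hbd
  -- To undo `I^(1-α)`, write `φ = -I^(1-α) I^α φ'` with right integrals and move the outer one onto
  -- `u`. Then `I^(1-α) u` can be replaced by `D` plus the primitive of `v`.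
  have e1 : ∫ x in Ioo a b, u x * φ x =
      -∫ x in Ioo a b, leftRLIntegral a (1 - α) u x * rightRLIntegral b α (deriv φ) x := by
    rw [integral_leftRLIntegral_mul hβ hu hm hbd, ← integral_neg]
    refine setIntegral_congr_fun measurableSet_Ioo fun x hx => ?_
    rw [rightRLIntegral_rightRLIntegral (a := a) hβ hα0 (by ring) hφ.deriv.aestronglyMeasurable
      (fun x _ => hc₁ x) (Ioo_subset_Icc_self hx), hφ.intervalIntegral_deriv]
    ring
  have e2 : ∫ x in Ioo a b, leftRLIntegral a (1 - α) u x * rightRLIntegral b α (deriv φ) x =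
      D * (∫ x in Ioo a b, rightRLIntegral b α (deriv φ) x) +
      ∫ x in Ioo a b, leftRLIntegral a 1 v x * rightRLIntegral b α (deriv φ) x := by
    have hint : IntegrableOn (rightRLIntegral b α (deriv φ)) (Ioo a b) :=
      integrableOn_rightRLIntegral hα0 hφ.deriv.integrable.integrableOn
    rw [← integral_const_mul, ← integral_add (hint.const_mul D) (hV.mul_bdd hm hbd')]
    refine integral_congr_ae (hD'.mono fun x hx => ?_)
    simp only [hx]
    ring
  have e3 : ∫ x in Ioo a b, rightRLIntegral b α (deriv φ) x =
      -(1 / Real.Gamma α * ∫ x in Ioo a b, (x - a) ^ (α - 1) * φ x) := by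
    rw [← integral_Ioc_eq_integral_Ioo, ← intervalIntegral.integral_of_le hab.le,
      intervalIntegral_rightRLIntegral_deriv hα0 hφ (left_mem_Icc.2 hab.le), rightRLIntegral,
      intervalIntegral.integral_of_le hab.le, integral_Ioc_eq_integral_Ioo]
  have e4 : ∫ x in Ioo a b, leftRLIntegral a 1 v x * rightRLIntegral b α (deriv φ) x =
      -∫ x in Ioo a b, leftRLIntegral a α v x * φ x := by
    rw [integral_leftRLIntegral_mul one_pos hv hm hbd,
      integral_leftRLIntegral_mul hα0 hv hφ.aestronglyMeasurable fun x _ => hc x, ← integral_neg]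
    refine setIntegral_congr_fun measurableSet_Ioo fun x hx => ?_
    rw [rightRLIntegral_one, intervalIntegral_rightRLIntegral_deriv hα0 hφ
      (Ioo_subset_Icc_self hx)]
    ring
  have e5 : ∫ x in Ioo a b, (D / Real.Gamma α * (x - a) ^ (α - 1) + leftRLIntegral a α v x) * φ x =
      D / Real.Gamma α * (∫ x in Ioo a b, (x - a) ^ (α - 1) * φ x) +
      ∫ x in Ioo a b, leftRLIntegral a α v x * φ x := by
    rw [← integral_const_mul]
    simp_rw [add_mul, mul_assoc]
    have hκφ := integrableOn_mul_test hκ hφ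
    simp only [mul_assoc] at hκφ
    exact integral_add hκφ (integrableOn_mul_test hI hφ)
  rw [e5, e1, e2, e3, e4]
  ring

theorem IsLeftWeakDeriv.ae_eq {w : ℝ → ℝ} (h : IsLeftWeakDeriv a b α u v)
    (h' : IsLeftWeakDeriv a b α u w) : v =ᵐ[volume.restrict (Ioo a b)] w :=
  ae_eq_of_forall_integral_test_eq h.2.1 h'.2.1 fun φ hφ => by rw [h.2.2 φ hφ, h'.2.2 φ hφ]

theorem IsLeftWeakDeriv.leftWeakDeriv_ae_eq (h : IsLeftWeakDeriv a b α u v) :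
    leftWeakDeriv a b α u =ᵐ[volume.restrict (Ioo a b)] v := by
  have hex : ∃ v, IsLeftWeakDeriv a b α u v := ⟨v, h⟩
  rw [leftWeakDeriv, dif_pos hex]
  exact (Classical.choose_spec hex).ae_eq h

end Representation

/-! ### Compactness of the fractional integral when `α p > 1` -/

section Continuity

variable {a b α p q : ℝ} {v : ℝ → ℝ}

/-- As `1/p = 1 - 1/q`, the condition `α > 1/p` reads `α - 1 > -1/q`. This is exactly what puts
`t^(α - 1)` in `L^q` near 0. -/
theorem neg_one_lt_sub_one_mul (hpq : p.HolderConjugate q) (hαp : 1 < α * p) :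
    -1 < (α - 1) * q := by
  have h := hpq.mul_eq_add
  have hp := hpq.pos
  have hq := hpq.symm.pos
  have h1 : q * (α * p - 1) > 0 := mul_pos hq (by linarith)
  have h2 : p * ((α - 1) * q + 1) > 0 := by nlinarith
  have := (mul_pos_iff_of_pos_left hp).1 h2
  linarith

theorem memLp_rlKernel (hpq : p.HolderConjugate q) (hαp : 1 < α * p) (T : ℝ) :
    MemLp (rlKernel α T) (ENNReal.ofReal q) := by
  have hq := hpq.symm.pos
  have h0 : ENNReal.ofReal q ≠ 0 := by simpa using hq
  have hα : 0 < α := by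
    by_contra h
    nlinarith [mul_nonneg (neg_nonneg.2 (not_lt.1 h)) hpq.nonneg]
  have hs := neg_one_lt_sub_one_mul hpq hαp
  unfold rlKernel
  rw [memLp_indicator_iff_restrict measurableSet_Ioo]
  refine (integrable_norm_rpow_iff (integrableOn_rpow_sub_one hα T).aestronglyMeasurable h0
    ENNReal.ofReal_ne_top).1 ?_
  have h := integrableOn_rpow_sub_one (β := (α - 1) * q + 1) (by linarith) T
  refine h.congr ?_
  filter_upwards [ae_restrict_mem measurableSet_Ioo] with t ht
  rw [ENNReal.toReal_ofReal hq.le, Real.norm_of_nonneg (Real.rpow_nonneg ht.1.le _),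
    ← Real.rpow_mul ht.1.le]
  congr 1
  ring

/-- Translation is continuous in `L^q` because `q < ∞`. As a curve in `Lp`, the translated kernel
provides the modulus of continuity of all fractional integrals through Hölder. -/
theorem exists_continuous_rlKernel_translate (hpq : p.HolderConjugate q) (hαp : 1 < α * p)
    (T : ℝ) [Fact ((1 : ℝ≥0∞) ≤ ENNReal.ofReal q)] : ∃ G : ℝ → Lp ℝ (ENNReal.ofReal q) (volume : Measure ℝ), Continuous G ∧
      ∀ x, G x =ᵐ[volume] fun y => rlKernel α T (x - y) := by
  have hk := memLp_rlKernel hpq hαp T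
  let g : ℝ → C(ℝ, ℝ) := fun x => ⟨fun y => x - y, by fun_prop⟩
  have hg : Continuous g := by
    refine ContinuousMap.continuous_of_continuous_uncurry _ ?_
    exact continuous_fst.sub continuous_snd
  have hgm : ∀ x, MeasurePreserving (g x) volume volume := fun x =>
    Measure.measurePreserving_sub_left volume x
  refine ⟨fun x => Lp.compMeasurePreserving (g x) (hgm x) (hk.toLp _),
    continuous_const.compMeasurePreservingLp hg hgm ENNReal.ofReal_ne_top, fun x => ?_⟩
  refine (Lp.coeFn_compMeasurePreserving _ (hgm x)).trans ?_
  exact (hgm x).quasiMeasurePreserving.ae_eq_comp hk.coeFn_toLp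

theorem leftRLIntegral_eq_setIntegral {u : ℝ → ℝ} {β x : ℝ} (hx : x ∈ Icc a b) :
    leftRLIntegral a β u x =
      1 / Real.Gamma β * ∫ y in Ioo a b, rlKernel β (b - a) (x - y) * u y := by
  rw [leftRLIntegral_eq_integral_indicator hx, ← integral_indicator measurableSet_Ioo]
  congr 2 with y
  by_cases hy : y ∈ Ioo a b
  · simp only [indicator_of_mem hy, mul_comm]
  · simp only [indicator_of_notMem hy, zero_mul]

theorem memLp_rlKernel_translate (hpq : p.HolderConjugate q) (hαp : 1 < α * p) (T x : ℝ)
    (s : Set ℝ) :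
    MemLp (fun y => rlKernel α T (x - y)) (ENNReal.ofReal q) (volume.restrict s) :=
  ((memLp_rlKernel hpq hαp T).comp_measurePreserving
    (Measure.measurePreserving_sub_left volume x)).restrict s

/-- A common modulus of continuity of the fractional integrals of a ball of `L^p`. -/
theorem exists_modulus_leftRLIntegral (hpq : p.HolderConjugate q) (hαp : 1 < α * p) (hα : 0 < α)
    (a b : ℝ) {M : ℝ≥0∞} (hM : M ≠ ⊤) : ∃ m : ℝ → ℝ → ℝ,
      (∀ x, Tendsto (m x) (𝓝 x) (𝓝 0)) ∧
      ∀ v : ℝ → ℝ, MemLpOn a b p v → ∫⁻ x in Ioo a b, ‖v x‖ₑ ^ p ≤ M →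
        ∀ x ∈ Icc a b, ∀ y ∈ Icc a b,
          |leftRLIntegral a α v x - leftRLIntegral a α v y| ≤ m x y := by
  have hq1 : Fact ((1 : ℝ≥0∞) ≤ ENNReal.ofReal q) := ⟨by
    rw [← ENNReal.ofReal_one]; exact ENNReal.ofReal_le_ofReal hpq.symm.lt.le⟩
  obtain ⟨G, hG, hGk⟩ := exists_continuous_rlKernel_translate hpq hαp (b - a)
  have hΓ := Real.Gamma_pos_of_pos hα
  refine ⟨fun x y => 1 / Real.Gamma α * ((M ^ (1 / p)).toReal * dist (G x) (G y)), fun x => ?_, ?_⟩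
  · have h : Tendsto (fun y => dist (G x) (G y)) (𝓝 x) (𝓝 0) := by
      have := (tendsto_const_nhds (x := G x)).dist (hG.tendsto x)
      rwa [dist_self] at this
    have := (h.const_mul (M ^ (1 / p)).toReal).const_mul (1 / Real.Gamma α)
    simpa using this
  · intro v hv hvM x hx y hy
    have hkx := memLp_rlKernel_translate hpq hαp (b - a) x (Ioo a b)
    have hky := memLp_rlKernel_translate hpq hαp (b - a) y (Ioo a b)
    rw [leftRLIntegral_eq_setIntegral hx, leftRLIntegral_eq_setIntegral hy, ← mul_sub,
      ← integral_sub (integrable_mul_of_memLp hpq hkx hv) (integrable_mul_of_memLp hpq hky hv),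
      abs_mul, abs_of_pos (one_div_pos.2 hΓ)]
    refine mul_le_mul_of_nonneg_left ?_ (one_div_nonneg.2 hΓ.le)
    have h := norm_integral_mul_le hpq (hkx.sub hky) hv hM hvM
    simp only [Pi.sub_apply, sub_mul] at h
    refine h.trans ?_
    gcongr
    rw [Lp.dist_def]
    refine ENNReal.toReal_mono ((Lp.memLp (G x)).sub (Lp.memLp (G y))).2.ne ?_
    refine (eLpNorm_mono_measure _ Measure.restrict_le_self).trans (le_of_eq ?_)
    exact eLpNorm_congr_ae (((hGk x).sub (hGk y)).symm)

theorem lintegral_enorm_rpow_ne_top (hp : 0 < p) (hv : MemLpOn a b p v) :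
    ∫⁻ x in Ioo a b, ‖v x‖ₑ ^ p ≠ ⊤ := by
  have := (eLpNorm_lt_top_iff_lintegral_rpow_enorm_lt_top (by simpa using hp)
    ENNReal.ofReal_ne_top).1 hv.2
  rw [ENNReal.toReal_ofReal hp.le] at this
  exact this.ne

theorem continuousOn_leftRLIntegral (hp : 1 < p) (hαp : 1 < α * p) (hα : 0 < α)
    (hv : MemLpOn a b p v) : ContinuousOn (leftRLIntegral a α v) (Icc a b) := by
  obtain ⟨m, hm₀, hmv⟩ := exists_modulus_leftRLIntegral (Real.HolderConjugate.conjExponent hp) hαp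
    hα a b (lintegral_enorm_rpow_ne_top (by linarith) hv)
  intro x hx
  rw [ContinuousWithinAt, tendsto_iff_dist_tendsto_zero]
  refine squeeze_zero' (Eventually.of_forall fun y => dist_nonneg) ?_
    ((hm₀ x).mono_left nhdsWithin_le_nhds)
  filter_upwards [self_mem_nhdsWithin] with y hy
  rw [dist_comm]
  exact hmv v hv le_rfl x hx y hy

/-- Evaluating the fractional integral at `x` means testing with a translated kernel in `L^q`, so
weak convergence gives pointwise convergence. The common modulus and compactness of `[a, b]` make it
uniform. -/
theorem tendstoUniformlyOn_leftRLIntegral (hpq : p.HolderConjugate q) (hαp : 1 < α * p)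
    (hα : 0 < α) {l : Filter ℕ} {v : ℕ → ℝ → ℝ} {v₀ : ℝ → ℝ} (hv : ∀ n, MemLpOn a b p (v n))
    (hv₀ : MemLpOn a b p v₀) {M : ℝ≥0∞} (hM : M ≠ ⊤)
    (hb : ∀ n, ∫⁻ x in Ioo a b, ‖v n x‖ₑ ^ p ≤ M)
    (hw : ∀ f : ℝ → ℝ, MemLp f (ENNReal.ofReal q) (volume.restrict (Ioo a b)) →
      Tendsto (fun n => ∫ x in Ioo a b, f x * v n x) l (𝓝 (∫ x in Ioo a b, f x * v₀ x))) :
    TendstoUniformlyOn (fun n => leftRLIntegral a α (v n)) (leftRLIntegral a α v₀) l (Icc a b) := by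
  -- The maximum is taken so that one modulus also serves `v₀`, which is not assumed to obey the
  -- bound `M`.
  obtain ⟨m, hm₀, hmv⟩ := exists_modulus_leftRLIntegral hpq hαp hα a b
    (max_ne_top hM (lintegral_enorm_rpow_ne_top hpq.pos hv₀))
  rw [← tendstoLocallyUniformlyOn_iff_tendstoUniformlyOn_of_compact isCompact_Icc,
    Metric.tendstoLocallyUniformlyOn_iff]
  intro ε hε x hx
  have hpt : Tendsto (fun n => leftRLIntegral a α (v n) x) l (𝓝 (leftRLIntegral a α v₀ x)) := by
    simp_rw [leftRLIntegral_eq_setIntegral hx]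
    exact (hw _ (memLp_rlKernel_translate hpq hαp (b - a) x (Ioo a b))).const_mul _
  have hnear : ∀ᶠ y in 𝓝[Icc a b] x, y ∈ Icc a b ∧ m x y < ε / 3 :=
    eventually_mem_nhdsWithin.and (nhdsWithin_le_nhds ((hm₀ x).eventually
      (gt_mem_nhds (by positivity))))
  refine ⟨_, hnear, ?_⟩
  filter_upwards [Metric.tendsto_nhds.1 hpt (ε / 3) (by positivity)] with n hn y hy
  have h1 := hmv (v n) (hv n) ((hb n).trans (le_max_left _ _)) x hx y hy.1
  have h2 := hmv v₀ hv₀ (le_max_right _ _) x hx y hy.1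
  have h3 := hy.2
  rw [Real.dist_eq] at hn ⊢
  rw [abs_lt] at hn
  rw [abs_le] at h1 h2
  rw [abs_lt]
  constructor <;> linarith [hn.1, hn.2, h1.1, h1.2, h2.1, h2.2]

end Continuity

/-! ### Traces and the singular coefficient in the left space -/

section LeftSpace

variable {a b α p C : ℝ} {u v g : ℝ → ℝ}

/-- The function with left fractional derivative `v` and singular coefficient `C` at `a`. -/
def leftRepr (a α C : ℝ) (v : ℝ → ℝ) (x : ℝ) : ℝ :=
  C * (x - a) ^ (α - 1) + leftRLIntegral a α v x

theorem MemLpOn.integrableOn (hp : 1 < p) (hv : MemLpOn a b p v) : IntegrableOn v (Ioo a b) :=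
  MemLp.integrable (by rw [← ENNReal.ofReal_one]; exact ENNReal.ofReal_le_ofReal hp.le) hv

theorem MemLpOn.congr (hv : MemLpOn a b p v) (h : v =ᵐ[volume.restrict (Ioo a b)] g) :
    MemLpOn a b p g :=
  (memLp_congr_ae h).1 hv

theorem continuousOn_sub_rpow (a r : ℝ) : ContinuousOn (fun x => (x - a) ^ r) (Ioi a) :=
  (continuousOn_id.sub continuousOn_const).rpow_const fun _ hx =>
    Or.inl (sub_pos.2 (mem_Ioi.1 hx)).ne'

theorem continuousOn_leftRepr (hp : 1 < p) (hαp : 1 < α * p) (hα : 0 < α)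
    (hv : MemLpOn a b p v) (C : ℝ) : ContinuousOn (leftRepr a α C v) (Ioc a b) :=
  (continuousOn_const.mul ((continuousOn_sub_rpow a (α - 1)).mono fun _ hx => hx.1)).add
    ((continuousOn_leftRLIntegral hp hαp hα hv).mono Ioc_subset_Icc_self)

/-- The representation of functions in the left fractional Sobolev space. -/
theorem exists_ae_eq_leftRepr (hab : a < b) (hα0 : 0 < α) (hα1 : α < 1) (hp : 1 < p)
    (hu : u ∈ leftSobolev a b α p) :
    IsLeftWeakDeriv a b α u (leftWeakDeriv a b α u) ∧ MemLpOn a b p (leftWeakDeriv a b α u) ∧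
      ∃ C, u =ᵐ[volume.restrict (Ioo a b)] leftRepr a α C (leftWeakDeriv a b α u) ∧
        leftRLIntegral a (1 - α) u =ᵐ[volume.restrict (Ioo a b)]
          fun x => C * Real.Gamma α + ∫ y in a..x, leftWeakDeriv a b α u y := by
  obtain ⟨-, v, hv, hvp⟩ := hu
  have hD : IsLeftWeakDeriv a b α u (leftWeakDeriv a b α u) := by
    rw [leftWeakDeriv, dif_pos ⟨v, hv⟩]
    exact Classical.choose_spec (⟨v, hv⟩ : ∃ v, IsLeftWeakDeriv a b α u v)
  have hDp := hvp.congr hv.leftWeakDeriv_ae_eq.symm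
  obtain ⟨C, hC1, hC2⟩ := hD.exists_eq_add hab hα0 hα1 (hDp.integrableOn hp)
  exact ⟨hD, hDp, C, hC2, hC1⟩

theorem continuousOn_const_add_primitive (hab : a < b) (hv : IntegrableOn v (Ioo a b)) (c : ℝ) :
    ContinuousOn (fun x => c + ∫ y in a..x, v y) (Ico a b) := by
  have h := intervalIntegral.continuousOn_primitive_interval' (b₁ := a) (b₂ := b) (a := a)
    ((intervalIntegrable_iff_integrableOn_Ioo_of_le hab.le).2 hv) left_mem_uIcc
  rw [uIcc_of_le hab.le] at h
  exact continuousOn_const.add (h.mono Ico_subset_Icc_self)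

theorem restrict_Ioo_eq_Ico : volume.restrict (Ioo a b) = volume.restrict (Ico a b) :=
  Measure.restrict_congr_set Ioo_ae_eq_Ico

theorem restrict_Ioo_eq_Ioc : volume.restrict (Ioo a b) = volume.restrict (Ioc a b) :=
  Measure.restrict_congr_set Ioo_ae_eq_Ioc

/-- Versions continuous on `[a, b)` are unique, so the one of `I^(1-α) u` takes the value `C * Γ(α)`
at `a`. -/
theorem HasLeftConst.eq_zero (hab : a < b) (hα0 : 0 < α) (hα1 : α < 1)
    (hv : IntegrableOn v (Ioo a b)) (h : HasLeftConst a b α u 0)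
    (hJ : leftRLIntegral a (1 - α) u =ᵐ[volume.restrict (Ioo a b)]
      fun x => C * Real.Gamma α + ∫ y in a..x, v y) : C = 0 := by
  obtain ⟨g, hg, hgJ, h0⟩ := h
  have h1 := hgJ.trans hJ
  rw [restrict_Ioo_eq_Ico] at h1
  have h2 := Measure.eqOn_Ico_of_ae_eq _ h1 hg (continuousOn_const_add_primitive hab hv _)
    (left_mem_Ico.2 hab)
  have hG := Real.Gamma_pos_of_pos hα0
  have hG' := Real.Gamma_pos_of_pos (show 0 < 1 - α by linarith)
  have h3 : g a = 0 := by
    rw [eq_comm, div_eq_zero_iff] at h0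
    exact h0.resolve_right hG'.ne'
  rw [h3] at h2
  simp only [intervalIntegral.integral_same, add_zero] at h2
  exact (mul_eq_zero.1 h2.symm).resolve_right hG.ne'

theorem HasLeftTrace.leftRepr_eq (hab : a < b) (hp : 1 < p) (hαp : 1 < α * p) (hα : 0 < α)
    (hv : MemLpOn a b p v) {τ : ℝ} (h : HasLeftTrace a b u τ)
    (hu : u =ᵐ[volume.restrict (Ioo a b)] leftRepr a α C v) : leftRepr a α C v b = τ := by
  obtain ⟨g, hg, hgu, rfl⟩ := h
  have h1 := hgu.trans hu
  rw [restrict_Ioo_eq_Ioc] at h1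
  exact (Measure.eqOn_Ioc_of_ae_eq _ h1 hg (continuousOn_leftRepr hp hαp hα hv C)
    (right_mem_Ioc.2 hab)).symm

theorem eqOn_Ioo_of_ae_eq_restrict {f : ℝ → ℝ} (h : f =ᵐ[volume.restrict (Ioo a b)] g)
    (hf : ContinuousOn f (Ioo a b)) (hg : ContinuousOn g (Ioo a b)) : EqOn f g (Ioo a b) :=
  Measure.eqOn_Ioo_of_ae_eq _ h hf hg

/-- If `C ≠ 0`, then `(x - a)^(α - 1) = C⁻¹ (u - I^α v)` would have a finite limit at `a`, although
it blows up there. -/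
theorem HasRightTrace.eq_zero (hab : a < b) (hp : 1 < p) (hαp : 1 < α * p) (hα0 : 0 < α)
    (hα1 : α < 1) (hv : MemLpOn a b p v) {τ : ℝ} (h : HasRightTrace a b u τ)
    (hu : u =ᵐ[volume.restrict (Ioo a b)] leftRepr a α C v) : C = 0 := by
  obtain ⟨g, hg, hgu, rfl⟩ := h
  have heq := eqOn_Ioo_of_ae_eq_restrict (hgu.trans hu) (hg.mono Ioo_subset_Ico_self)
    ((continuousOn_leftRepr hp hαp hα0 hv C).mono Ioo_subset_Ioc_self)
  by_contra hC
  have hle : 𝓝[>] a ≤ 𝓝[Ico a b] a := by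
    rw [← nhdsWithin_Ioo_eq_nhdsGT hab]
    exact nhdsWithin_mono _ Ioo_subset_Ico_self
  have hI := (((continuousOn_leftRLIntegral hp hαp hα0 hv).mono Ico_subset_Icc_self) a
    (left_mem_Ico.2 hab)).tendsto.mono_left hle
  have hg' := (hg a (left_mem_Ico.2 hab)).tendsto.mono_left hle
  have hlim := (hg'.sub hI).const_mul C⁻¹
  have htop : Tendsto (fun x : ℝ => (x - a) ^ (α - 1)) (𝓝[>] a) atTop := by
    refine (tendsto_rpow_neg_nhdsGT_zero (by linarith : α - 1 < 0)).comp ?_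
    refine tendsto_nhdsWithin_iff.2 ⟨?_, eventually_mem_nhdsWithin.mono fun x hx =>
      mem_Ioi.2 (sub_pos.2 (mem_Ioi.1 hx))⟩
    have : Tendsto (fun x : ℝ => x - a) (𝓝 a) (𝓝 (a - a)) :=
      tendsto_id.sub_const a
    rw [sub_self] at this
    exact this.mono_left nhdsWithin_le_nhds
  refine not_tendsto_nhds_of_tendsto_atTop (htop.congr' ?_) _ hlim
  rw [← nhdsWithin_Ioo_eq_nhdsGT hab]
  filter_upwards [self_mem_nhdsWithin] with x hx
  rw [heq hx, leftRepr]
  field_simp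
  ring

theorem memLpOn_leftRLIntegral (hp : 1 < p) (hαp : 1 < α * p) (hα : 0 < α)
    (hv : MemLpOn a b p v) : MemLpOn a b p (leftRLIntegral a α v) := by
  have hc := continuousOn_leftRLIntegral hp hαp hα hv
  obtain ⟨K, hK⟩ := isCompact_Icc.exists_bound_of_continuousOn hc
  refine MemLp.of_bound ((hc.mono Ioo_subset_Icc_self).aestronglyMeasurable measurableSet_Ioo) K ?_
  filter_upwards [ae_restrict_mem measurableSet_Ioo] with x hx
  exact hK x (Ioo_subset_Icc_self hx)

/-- The power need not lie in `L^p` for every admissible `α` and `p`. A single `u` in `L^p` with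
nonzero coefficient shows that it does, which avoids a case distinction on the exponents. -/
theorem memLpOn_sub_rpow_of_ne_zero (hp : 1 < p) (hαp : 1 < α * p) (hα : 0 < α)
    (hv : MemLpOn a b p v) (hup : MemLpOn a b p u)
    (hu : u =ᵐ[volume.restrict (Ioo a b)] leftRepr a α C v) (hC : C ≠ 0) :
    MemLpOn a b p fun x => (x - a) ^ (α - 1) := by
  refine MemLpOn.congr ((MemLp.sub hup (memLpOn_leftRLIntegral hp hαp hα hv)).const_mul C⁻¹)
    (hu.mono fun x hx => ?_)
  simp only [Pi.sub_apply, hx, leftRepr]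
  field_simp
  ring

theorem memLpOn_leftRepr (hp : 1 < p) (hαp : 1 < α * p) (hα : 0 < α) (hv : MemLpOn a b p v)
    (hC : C = 0 ∨ MemLpOn a b p fun x => (x - a) ^ (α - 1)) : MemLpOn a b p (leftRepr a α C v) := by
  have h : MemLpOn a b p fun x => C * (x - a) ^ (α - 1) := by
    rcases hC with rfl | hC
    · simp only [zero_mul]
      exact MemLp.zero'
    · exact hC.const_mul C
  exact h.add (memLpOn_leftRLIntegral hp hαp hα hv)

theorem isLeftWeakDeriv_leftRepr (hab : a < b) (hα0 : 0 < α) (hα1 : α < 1) (hp : 1 < p)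
    (hv : MemLpOn a b p v) (hu : u =ᵐ[volume.restrict (Ioo a b)] leftRepr a α C v) :
    IsLeftWeakDeriv a b α u v :=
  isLeftWeakDeriv_of_eq_add hab.le hα0 hα1 (hv.integrableOn hp) hu

theorem mem_leftSobolev_of_ae_eq_leftRepr (hab : a < b) (hα0 : 0 < α) (hα1 : α < 1) (hp : 1 < p)
    (hαp : 1 < α * p) (hv : MemLpOn a b p v)
    (hC : C = 0 ∨ MemLpOn a b p fun x => (x - a) ^ (α - 1))
    (hu : u =ᵐ[volume.restrict (Ioo a b)] leftRepr a α C v) : u ∈ leftSobolev a b α p :=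
  ⟨(memLpOn_leftRepr hp hαp hα0 hv hC).congr hu.symm, v,
    isLeftWeakDeriv_leftRepr hab hα0 hα1 hp hv hu, hv⟩

theorem hasLeftTrace_of_ae_eq_leftRepr (hp : 1 < p) (hαp : 1 < α * p) (hα : 0 < α)
    (hv : MemLpOn a b p v) (hu : u =ᵐ[volume.restrict (Ioo a b)] leftRepr a α C v) :
    HasLeftTrace a b u (leftRepr a α C v b) :=
  ⟨_, continuousOn_leftRepr hp hαp hα hv C, hu.symm, rfl⟩

/-- The representation theorem yields some coefficient `C`, shared by `I^(1-α) u` and `u`. Comparing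
the two representations of `u` at a single point gives `C = 0`. -/
theorem hasLeftConst_zero_of_ae_eq_leftRepr (hab : a < b) (hα0 : 0 < α) (hα1 : α < 1) (hp : 1 < p)
    (hv : MemLpOn a b p v) (hu : u =ᵐ[volume.restrict (Ioo a b)] leftRepr a α 0 v) :
    HasLeftConst a b α u 0 := by
  have hvi := hv.integrableOn hp
  obtain ⟨C, hJ, hC⟩ := (isLeftWeakDeriv_leftRepr hab hα0 hα1 hp hv hu).exists_eq_add hab hα0 hα1
    hvi
  have hne : (ae (volume.restrict (Ioo a b))).NeBot := by
    rw [ae_neBot]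
    intro h
    have := Measure.restrict_eq_zero.1 h
    rw [Real.volume_Ioo, ENNReal.ofReal_eq_zero] at this
    linarith
  obtain ⟨x, hx1, hx2, hx⟩ := (hu.and (hC.and (ae_restrict_mem measurableSet_Ioo))).exists
  have hpos : 0 < (x - a) ^ (α - 1) := Real.rpow_pos_of_pos (sub_pos.2 hx.1) _
  have hC0 : C = 0 := by
    rw [hx1, leftRepr] at hx2
    have : C * (x - a) ^ (α - 1) = 0 := by linarith
    exact (mul_eq_zero.1 this).resolve_right hpos.ne'
  refine ⟨_, continuousOn_const_add_primitive hab hvi (C * Real.Gamma α), hJ.symm, ?_⟩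
  simp [hC0]

end LeftSpace

/-! ### Reflection at the midpoint exchanges left and right -/

section Reflection

variable {a b α p : ℝ} {u v w : ℝ → ℝ}

/-- Reflection of a function at the midpoint of `(a, b)`. -/
def reflect (a b : ℝ) (u : ℝ → ℝ) (x : ℝ) : ℝ := u (a + b - x)

@[simp] theorem reflect_reflect (a b : ℝ) (u : ℝ → ℝ) : reflect a b (reflect a b u) = u := by
  ext x
  simp [reflect]

theorem ae_eq_reflect (h : u =ᵐ[volume.restrict (Ioo a b)] v) :
    reflect a b u =ᵐ[volume.restrict (Ioo a b)] reflect a b v :=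
  (measurePreserving_reflect a b).quasiMeasurePreserving.ae_eq_comp h

theorem MemLpOn.reflect (h : MemLpOn a b p u) : MemLpOn a b p (reflect a b u) :=
  MemLp.comp_measurePreserving h (measurePreserving_reflect a b)

theorem measurableEmbedding_const_sub (c : ℝ) : MeasurableEmbedding fun x : ℝ => c - x :=
  (MeasurableEquiv.subLeft c).measurableEmbedding

theorem setIntegral_reflect (f : ℝ → ℝ) :
    ∫ x in Ioo a b, reflect a b f x = ∫ x in Ioo a b, f x :=
  (measurePreserving_reflect a b).integral_comp (measurableEmbedding_const_sub _) f

theorem IsTestFunction.reflect {φ : ℝ → ℝ} (h : IsTestFunction a b φ) :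
    IsTestFunction a b (reflect a b φ) := by
  have hsub : tsupport (FracVar.reflect a b φ) ⊆ (fun x => a + b - x) ⁻¹' tsupport φ := by
    refine closure_minimal (fun x hx => subset_tsupport φ hx) ?_
    exact (isClosed_tsupport φ).preimage (by fun_prop)
  refine ⟨h.1.comp (contDiff_const.sub contDiff_id), ?_, fun x hx => ?_⟩
  · exact h.2.1.comp_homeomorph (Homeomorph.subLeft (a + b))
  · simpa using reflect_mem_Ioo (h.2.2 (hsub hx))

/-- The sign produced by differentiating `a + b - x` is the one built into the right derivative. -/
theorem leftRLDeriv_reflect (a b α : ℝ) (φ : ℝ → ℝ) :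
    leftRLDeriv a α (reflect a b φ) = reflect a b (rightRLDeriv b α φ) := by
  ext x
  have : leftRLIntegral a (1 - α) (reflect a b φ) =
      fun x => rightRLIntegral b (1 - α) φ (a + b - x) := by
    ext y
    rw [rightRLIntegral_eq_leftRLIntegral_reflect a b, sub_sub_cancel]
    rfl
  rw [leftRLDeriv, this, deriv_comp_const_sub]
  rfl

theorem integrableOn_reflect (h : IntegrableOn u (Ioo a b)) :
    IntegrableOn (reflect a b u) (Ioo a b) :=
  (measurePreserving_reflect a b).integrable_comp_of_integrable h

theorem locallyIntegrableOn_reflect (h : LocallyIntegrableOn u (Ioo a b)) :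
    LocallyIntegrableOn (reflect a b u) (Ioo a b) := by
  rw [locallyIntegrableOn_iff isOpen_Ioo.isLocallyClosed] at h ⊢
  intro k hk hkc
  have hk' : (fun x => a + b - x) '' k ⊆ Ioo a b := by
    rintro _ ⟨x, hx, rfl⟩
    exact reflect_mem_Ioo (hk hx)
  have h1 := h _ hk' (hkc.image (by fun_prop))
  have h2 := ((Measure.measurePreserving_sub_left volume (a + b)).restrict_image_emb
    (measurableEmbedding_const_sub (a + b)) k).integrable_comp_of_integrable h1
  exact h2

theorem isRightWeakDeriv_reflect (h : IsLeftWeakDeriv a b α u v) :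
    IsRightWeakDeriv a b α (reflect a b u) (reflect a b v) := by
  refine ⟨integrableOn_reflect h.1, locallyIntegrableOn_reflect h.2.1, fun φ hφ => ?_⟩
  have h1 := h.2.2 _ hφ.reflect
  rw [← setIntegral_reflect, ← setIntegral_reflect (fun x => u x * _)] at h1
  have h2 := leftRLDeriv_reflect a b α (reflect a b φ)
  rw [reflect_reflect] at h2
  rw [h2]
  convert h1 using 3 with x
  · simp [reflect]
  · rfl

theorem isLeftWeakDeriv_reflect (h : IsRightWeakDeriv a b α u v) :
    IsLeftWeakDeriv a b α (reflect a b u) (reflect a b v) := by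
  refine ⟨integrableOn_reflect h.1, locallyIntegrableOn_reflect h.2.1, fun φ hφ => ?_⟩
  have h1 := h.2.2 _ hφ.reflect
  rw [← setIntegral_reflect, ← setIntegral_reflect (fun x => u x * _), leftRLDeriv_reflect] at h1
  convert h1 using 3 with x
  · simp [reflect]
  · simp [reflect]

theorem reflect_mem_leftSobolev_iff :
    reflect a b u ∈ leftSobolev a b α p ↔ u ∈ rightSobolev a b α p := by
  constructor
  · rintro ⟨h1, v, h2, h3⟩
    have h1' := h1.reflect
    have h2' := isRightWeakDeriv_reflect h2
    rw [reflect_reflect] at h1' h2'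
    exact ⟨h1', _, h2', h3.reflect⟩
  · rintro ⟨h1, v, h2, h3⟩
    exact ⟨h1.reflect, _, isLeftWeakDeriv_reflect h2, h3.reflect⟩

theorem rightWeakDeriv_ae_eq (h : IsRightWeakDeriv a b α u w) :
    rightWeakDeriv a b α u =ᵐ[volume.restrict (Ioo a b)] w := by
  have hex : ∃ w, IsRightWeakDeriv a b α u w := ⟨w, h⟩
  rw [rightWeakDeriv, dif_pos hex]
  have := (isLeftWeakDeriv_reflect (Classical.choose_spec hex)).ae_eq (isLeftWeakDeriv_reflect h)
  simpa using ae_eq_reflect this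

theorem rightWeakDeriv_ae_eq_reflect (h : u ∈ rightSobolev a b α p) :
    rightWeakDeriv a b α u =ᵐ[volume.restrict (Ioo a b)]
      reflect a b (leftWeakDeriv a b α (reflect a b u)) := by
  obtain ⟨-, w, hw, -⟩ := h
  refine (rightWeakDeriv_ae_eq hw).trans ?_
  have := ae_eq_reflect (isLeftWeakDeriv_reflect hw).leftWeakDeriv_ae_eq
  simpa using this.symm

theorem continuousOn_reflect {s t : Set ℝ} {g : ℝ → ℝ} (hg : ContinuousOn g s)
    (h : ∀ x ∈ t, a + b - x ∈ s) : ContinuousOn (reflect a b g) t :=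
  hg.comp (by fun_prop) h

theorem HasRightTrace.reflect {τ : ℝ} (h : HasRightTrace a b u τ) :
    HasLeftTrace a b (reflect a b u) τ := by
  obtain ⟨g, hg, hgu, h0⟩ := h
  exact ⟨FracVar.reflect a b g, continuousOn_reflect hg fun x hx =>
    ⟨by linarith [hx.2], by linarith [hx.1]⟩, ae_eq_reflect hgu, by simpa [FracVar.reflect] using h0⟩

theorem HasLeftTrace.reflect {τ : ℝ} (h : HasLeftTrace a b u τ) :
    HasRightTrace a b (reflect a b u) τ := by
  obtain ⟨g, hg, hgu, h0⟩ := h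
  exact ⟨FracVar.reflect a b g, continuousOn_reflect hg fun x hx =>
    ⟨by linarith [hx.2], by linarith [hx.1]⟩, ae_eq_reflect hgu, by simpa [FracVar.reflect] using h0⟩

theorem leftRLIntegral_reflect (a b β : ℝ) (u : ℝ → ℝ) :
    leftRLIntegral a β (reflect a b u) = reflect a b (rightRLIntegral b β u) := by
  ext x
  simp only [reflect]
  rw [rightRLIntegral_eq_leftRLIntegral_reflect a b, sub_sub_cancel]
  rfl

theorem hasLeftConst_reflect_iff {c : ℝ} :
    HasLeftConst a b α (reflect a b u) c ↔ HasRightConst a b α u c := by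
  constructor
  · rintro ⟨g, hg, hgu, h0⟩
    refine ⟨reflect a b g, continuousOn_reflect hg fun x hx =>
      ⟨by linarith [hx.2], by linarith [hx.1]⟩, ?_, by simpa [reflect] using h0⟩
    have := ae_eq_reflect hgu
    rwa [leftRLIntegral_reflect, reflect_reflect] at this
  · rintro ⟨g, hg, hgu, h0⟩
    refine ⟨reflect a b g, continuousOn_reflect hg fun x hx =>
      ⟨by linarith [hx.2], by linarith [hx.1]⟩, ?_, by simpa [reflect] using h0⟩
    rw [leftRLIntegral_reflect]
    exact ae_eq_reflect hgu

end Reflection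

/-! ### The direct method and compactness of minimizing sequences -/

section DirectMethod

variable {a b α p : ℝ}

/-- `H` bundles compactness and lower semicontinuity: a sequence of bounded energy has a limit in
`Z` that obeys every upper bound holding eventually along `l`. Applied to a minimizing sequence with
all bounds `s > I`, this gives `E u₀ ≤ I`. If the infimum is `⊤`, every point is a minimizer. -/
theorem exists_isMinOn_of_sequential {Y : Type*} {Z : Set Y} (hZ : Z.Nonempty) (E : Y → EReal)
    {l : Filter ℕ} (hl : l ≤ atTop)
    (H : ∀ u : ℕ → Y, (∀ n, u n ∈ Z) → (∃ t : ℝ, ∀ n, E (u n) ≤ t) →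
      ∃ u₀ ∈ Z, ∀ s, (∀ᶠ n in l, E (u n) ≤ s) → E u₀ ≤ s) :
    ∃ u ∈ Z, ∀ v ∈ Z, E u ≤ E v := by
  set I := sInf (E '' Z) with hI
  by_cases hItop : I = ⊤
  · obtain ⟨u, hu⟩ := hZ
    refine ⟨u, hu, fun v hv => ?_⟩
    have : E v = ⊤ := sInf_eq_top.1 hItop _ (mem_image_of_mem E hv)
    rw [this]
    exact le_top
  · obtain ⟨t, ht, -⟩ := EReal.lt_iff_exists_real_btwn.1 (lt_top_iff_ne_top.2 hItop)
    obtain ⟨e, -, he, heZ⟩ := exists_seq_tendsto_sInf (hZ.image E) (OrderBot.bddBelow _)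
    choose u huZ hue using heZ
    obtain ⟨N, hN⟩ := eventually_atTop.1 (he.eventually (gt_mem_nhds ht))
    -- The shift by `N` makes the energy bound hold for every index, as `H` demands.
    obtain ⟨u₀, hu₀, hlsc⟩ := H (fun n => u (n + N)) (fun n => huZ _)
      ⟨t, fun n => by rw [hue]; exact (hN _ (by omega)).le⟩
    refine ⟨u₀, hu₀, fun v hv => le_trans (le_of_forall_gt_imp_ge_of_dense fun s hs => ?_)
      (sInf_le (mem_image_of_mem E hv))⟩
    refine hlsc s (hl ?_)
    obtain ⟨N', hN'⟩ := eventually_atTop.1 (he.eventually (gt_mem_nhds hs))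
    refine mem_of_superset (mem_atTop N') fun n hn => ?_
    simp only [mem_ofPred_eq, hue]
    exact (hN' _ (le_trans hn (by omega))).le

theorem le_ofReal_of_coe_add_coe_le {H : ℝ≥0∞} {c t : ℝ} (h : (H : EReal) + (c : EReal) ≤ (t : EReal)) :
    0 ≤ t - c ∧ H ≤ ENNReal.ofReal (t - c) := by
  have hH : H ≠ ⊤ := by
    rintro rfl
    rw [EReal.coe_ennreal_top, EReal.top_add_coe, top_le_iff] at h
    exact EReal.coe_ne_top t h
  lift H to NNReal using hH
  rw [EReal.coe_nnreal_eq_coe_real, ← EReal.coe_add, EReal.coe_le_coe_iff] at h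
  have h1 : (H : ℝ) ≤ t - c := by linarith
  have h0 : 0 ≤ t - c := H.2.trans h1
  exact ⟨h0, ENNReal.le_ofReal_iff_toReal_le (by simp) h0 |>.2 (by simpa using h1)⟩

theorem coe_add_coe_le_of_eventually {l : Filter ℕ} [l.NeBot] {Hn : ℕ → ℝ≥0∞} {H : ℝ≥0∞}
    {c : ℝ} (h : ∀ r : NNReal, (∀ᶠ n in l, Hn n ≤ r) → H ≤ r) {s : EReal}
    (hs : ∀ᶠ n in l, (Hn n : EReal) + (c : EReal) ≤ s) : (H : EReal) + (c : EReal) ≤ s := by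
  induction s with
  | top => exact le_top
  | bot =>
    obtain ⟨n, hn⟩ := hs.exists
    exfalso
    rw [le_bot_iff] at hn
    have : (c : EReal) ≤ (Hn n : EReal) + c := by
      conv_lhs => rw [← zero_add (c : EReal)]
      gcongr
      exact EReal.coe_ennreal_nonneg _
    rw [hn, le_bot_iff] at this
    exact EReal.coe_ne_bot c this
  | coe t =>
    obtain ⟨n, hn⟩ := hs.exists
    have h0 := (le_ofReal_of_coe_add_coe_le hn).1
    have h1 : H ≤ ((t - c).toNNReal : NNReal) :=
      h _ (hs.mono fun n hn => (le_ofReal_of_coe_add_coe_le hn).2)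
    have h2 : (H : EReal) ≤ ((t - c : ℝ) : EReal) := by
      refine (EReal.coe_ennreal_le_coe_ennreal_iff.2 h1).trans (le_of_eq ?_)
      rw [EReal.coe_nnreal_eq_coe_real, Real.coe_toNNReal _ h0]
    calc (H : EReal) + c ≤ ((t - c : ℝ) : EReal) + c := by gcongr
      _ = t := by rw [← EReal.coe_add, sub_add_cancel]

theorem exists_lintegral_rpow_le_of_extIntegral_le (hab : a ≤ b) (hp : 0 < p) {k c₁ t : ℝ}
    (hk : 0 < k) : ∃ M : ℝ≥0∞, M ≠ ⊤ ∧ ∀ f g : ℝ → ℝ,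
      AEMeasurable f (volume.restrict (Ioo a b)) → (∀ x ∈ Ioo a b, k * |g x| ^ p - c₁ ≤ f x) →
      extIntegral a b f ≤ t → ∫⁻ x in Ioo a b, ‖g x‖ₑ ^ p ≤ M := by
  -- Integrating `k * |g|^p ≤ f + c₁` gives the bound `(t + c₁ (b - a)) / k`, which does not depend
  -- on `f` or `g`.
  refine ⟨ENNReal.ofReal (t - -c₁ * (b - a)) / ENNReal.ofReal k,
    ENNReal.div_ne_top ENNReal.ofReal_ne_top (by simpa using hk), fun f g hf hfg hft => ?_⟩
  have hk0 : ENNReal.ofReal k ≠ 0 := by simpa using hk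
  rw [extIntegral_eq_lintegral_add hab hf (m := -c₁) fun x hx => by
    have : 0 ≤ k * |g x| ^ p := mul_nonneg hk.le (Real.rpow_nonneg (abs_nonneg _) _)
    linarith [hfg x hx]] at hft
  have h1 := (le_ofReal_of_coe_add_coe_le hft).2
  rw [ENNReal.le_div_iff_mul_le (Or.inl hk0) (Or.inl ENNReal.ofReal_ne_top), mul_comm,
    ← lintegral_const_mul' _ _ ENNReal.ofReal_ne_top]
  refine (setLIntegral_mono' measurableSet_Ioo fun x hx => ?_).trans h1
  rw [Real.enorm_eq_ofReal_abs, ENNReal.ofReal_rpow_of_nonneg (abs_nonneg _) hp.le,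
    ← ENNReal.ofReal_mul hk.le]
  exact ENNReal.ofReal_le_ofReal (by linarith [hfg x hx])

theorem exists_integral_abs_le [IsFiniteMeasure (volume.restrict (Ioo a b))] (hp : 1 < p)
    {M : ℝ≥0∞} (hM : M ≠ ⊤) : ∃ K : ℝ, ∀ v : ℝ → ℝ, MemLpOn a b p v →
      ∫⁻ x in Ioo a b, ‖v x‖ₑ ^ p ≤ M → ∫ x in Ioo a b, |v x| ≤ K := by
  have hpq := Real.HolderConjugate.conjExponent hp
  refine ⟨(M ^ (1 / p)).toReal * (eLpNorm (fun _ => (1 : ℝ)) (ENNReal.ofReal p.conjExponent)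
    (volume.restrict (Ioo a b))).toReal, fun v hv hvM => ?_⟩
  have h := norm_integral_mul_le (μ := volume.restrict (Ioo a b)) hpq (memLp_const (1 : ℝ))
    (MemLp.norm hv) hM (by simpa using hvM)
  simp only [one_mul] at h
  exact (le_abs_self _).trans h

/-- Compactness of bounded sequences with vanishing trace in the left fractional Sobolev space. -/
theorem exists_limit_leftSobolev (hab : a < b) (hα0 : 0 < α) (hα1 : α < 1) (hp : 1 < p)
    (hαp : 1 < α * p) (𝒰 : Ultrafilter ℕ) {u : ℕ → ℝ → ℝ} (hu : ∀ n, u n ∈ leftSobolev a b α p)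
    (htr : ∀ n, HasLeftTrace a b (u n) 0) {M : ℝ≥0∞} (hM : M ≠ ⊤)
    (hb : ∀ n, ∫⁻ x in Ioo a b, ‖leftWeakDeriv a b α (u n) x‖ₑ ^ p ≤ M) :
    ∃ (v₀ : ℝ → ℝ) (C : ℕ → ℝ) (C₀ : ℝ), Measurable v₀ ∧ MemLpOn a b p v₀ ∧
      (∀ f : ℝ → ℝ, AEStronglyMeasurable f (volume.restrict (Ioo a b)) → (∃ K, ∀ x, |f x| ≤ K) →
        Tendsto (fun n => ∫ x in Ioo a b, f x * leftWeakDeriv a b α (u n) x) 𝒰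
          (𝓝 (∫ x in Ioo a b, f x * v₀ x))) ∧
      (∀ n, u n =ᵐ[volume.restrict (Ioo a b)] leftRepr a α (C n) (leftWeakDeriv a b α (u n))) ∧
      (∀ n, MemLpOn a b p (leftWeakDeriv a b α (u n))) ∧
      (∀ c d, a < c → d < b → TendstoUniformlyOn
        (fun n => leftRepr a α (C n) (leftWeakDeriv a b α (u n))) (leftRepr a α C₀ v₀) 𝒰
        (Icc c d)) ∧
      leftRepr a α C₀ v₀ b = 0 ∧
      (C₀ = 0 ∨ MemLpOn a b p fun x => (x - a) ^ (α - 1)) ∧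
      ((∀ n, HasLeftConst a b α (u n) 0) → C₀ = 0) ∧
      ((∀ n, HasRightTrace a b (u n) 0) → C₀ = 0) := by
  have hpq := Real.HolderConjugate.conjExponent hp
  choose hD hDp C hC hCJ using fun n => exists_ae_eq_leftRepr hab hα0 hα1 hp (hu n)
  obtain ⟨v₁, hv₁, hw₁⟩ := exists_weak_limit hpq 𝒰 hDp hM hb
  -- A genuinely measurable version is chosen since the truncation sets in the semicontinuity
  -- argument are defined by pointwise values.
  set v₀ := hv₁.1.mk v₁ with hv₀
  have hae : v₁ =ᵐ[volume.restrict (Ioo a b)] v₀ := hv₁.1.ae_eq_mk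
  have hv₀p : MemLpOn a b p v₀ := MemLpOn.congr hv₁ hae
  have hw : ∀ f : ℝ → ℝ, MemLp f (ENNReal.ofReal p.conjExponent) (volume.restrict (Ioo a b)) →
      Tendsto (fun n => ∫ x in Ioo a b, f x * leftWeakDeriv a b α (u n) x) 𝒰
        (𝓝 (∫ x in Ioo a b, f x * v₀ x)) := by
    intro f hf
    have := hw₁ f hf
    rwa [integral_congr_ae (hae.mono fun x hx => by simp only [hx] :
      (fun x => f x * v₁ x) =ᵐ[volume.restrict (Ioo a b)] fun x => f x * v₀ x)] at this
  have hunif := tendstoUniformlyOn_leftRLIntegral hpq hαp hα0 hDp hv₀p hM hb hw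
  have hba : 0 < (b - a) ^ (α - 1) := Real.rpow_pos_of_pos (by linarith) _
  have htr' : ∀ n, leftRepr a α (C n) (leftWeakDeriv a b α (u n)) b = 0 := fun n =>
    (htr n).leftRepr_eq hab hp hαp hα0 (hDp n) (hC n)
  -- The vanishing trace at `b` determines the coefficient from the derivative. A bound on the
  -- derivatives alone thus controls the functions, and `C n` converges.
  have hCn : ∀ n, C n = -leftRLIntegral a α (leftWeakDeriv a b α (u n)) b / (b - a) ^ (α - 1) := by
    intro n
    have := htr' n
    rw [leftRepr] at this
    rw [eq_div_iff hba.ne']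
    linarith
  set C₀ := -leftRLIntegral a α v₀ b / (b - a) ^ (α - 1) with hC₀
  have hClim : Tendsto C 𝒰 (𝓝 C₀) := by
    rw [funext hCn]
    exact ((hunif.tendsto_at (right_mem_Icc.2 hab.le)).neg).div_const _
  have hzero : (∀ n, C n = 0) → C₀ = 0 := fun h => by
    refine tendsto_nhds_unique hClim ?_
    rw [funext h]
    exact tendsto_const_nhds
  refine ⟨v₀, C, C₀, hv₁.1.stronglyMeasurable_mk.measurable, hv₀p, ?_, hC, hDp, ?_, ?_, ?_, ?_, ?_⟩
  · rintro f hf ⟨K, hK⟩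
    exact hw f (MemLp.of_bound hf K (Eventually.of_forall hK))
  · intro c d hc hd
    have hcont : ContinuousOn (fun x => (x - a) ^ (α - 1)) (Icc c d) :=
      (continuousOn_sub_rpow a (α - 1)).mono fun x hx => hc.trans_le hx.1
    obtain ⟨K, hK⟩ := isCompact_Icc.exists_bound_of_continuousOn hcont
    have h1 : TendstoUniformlyOn (fun n x => C n * (x - a) ^ (α - 1))
        (fun x => C₀ * (x - a) ^ (α - 1)) 𝒰 (Icc c d) := by
      rw [Metric.tendstoUniformlyOn_iff]
      intro ε hε
      filter_upwards [Metric.tendsto_nhds.1 hClim (ε / (|K| + 1)) (by positivity)] with n hn x hx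
      rw [Real.dist_eq, ← sub_mul, abs_mul]
      rw [dist_comm, Real.dist_eq, lt_div_iff₀ (by positivity)] at hn
      refine lt_of_le_of_lt (mul_le_mul_of_nonneg_left ((hK x hx).trans ?_) (abs_nonneg _)) hn
      linarith [le_abs_self K]
    exact h1.add (hunif.mono fun x hx => ⟨hc.le.trans hx.1, hx.2.trans hd.le⟩)
  · rw [leftRepr, hC₀, div_mul_cancel₀ _ hba.ne']
    ring
  -- Either all coefficients vanish, and so does their limit, or one nonzero coefficient shows that
  -- the power belongs to `L^p`.
  · by_cases h : ∀ n, C n = 0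
    · exact Or.inl (hzero h)
    · push Not at h
      obtain ⟨n, hn⟩ := h
      exact Or.inr (memLpOn_sub_rpow_of_ne_zero hp hαp hα0 (hDp n) (hu n).1 (hC n) hn)
  · exact fun h => hzero fun n => (h n).eq_zero hab hα0 hα1 ((hDp n).integrableOn hp) (hCJ n)
  · exact fun h => hzero fun n => (h n).eq_zero hab hp hαp hα0 hα1 (hDp n) (hC n)

end DirectMethod

/-! ### Existence of minimizers with one or with both derivatives -/

section Existence

variable {a b α p : ℝ}

theorem convexOn_add_mul_sub_le {f : ℝ → ℝ} (hf : ConvexOn ℝ univ f) {f' x : ℝ}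
    (h : HasDerivAt f f' x) (y : ℝ) : f x + f' * (y - x) ≤ f y := by
  rcases lt_trichotomy x y with hxy | rfl | hxy
  · have := hf.le_slope_of_hasDerivAt (mem_univ x) (mem_univ y) hxy h
    rw [slope_def_field, le_div_iff₀ (by linarith)] at this
    linarith
  · simp
  · have := hf.slope_le_of_hasDerivAt (mem_univ y) (mem_univ x) hxy h
    rw [slope_def_field, div_le_iff₀ (by linarith)] at this
    linarith

/-- Two tangent lines in one variable are chained, from `(s, t)` to `(s, t')` and on to `(s', t')`.
The second has slope `g₁ s` because the partial derivative does not depend on the other variable. -/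
theorem add_mul_sub_add_mul_sub_le {f : ℝ → ℝ → ℝ}
    (hf : ConvexOn ℝ univ fun q : ℝ × ℝ => f q.1 q.2) {g₁ g₂ : ℝ → ℝ}
    (h₁ : ∀ s t, HasDerivAt (fun r => f r t) (g₁ s) s)
    (h₂ : ∀ s t, HasDerivAt (fun r => f s r) (g₂ t) t) (s t s' t' : ℝ) :
    f s t + g₁ s * (s' - s) + g₂ t * (t' - t) ≤ f s' t' := by
  have hc₁ : ConvexOn ℝ univ fun r => f r t' := by
    refine ⟨convex_univ, fun x _ y _ c d hc hd hcd => ?_⟩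
    have := hf.2 (mem_univ (x, t')) (mem_univ (y, t')) hc hd hcd
    simpa [← add_mul, hcd] using this
  have hc₂ : ConvexOn ℝ univ fun r => f s r := by
    refine ⟨convex_univ, fun x _ y _ c d hc hd hcd => ?_⟩
    have := hf.2 (mem_univ (s, x)) (mem_univ (s, y)) hc hd hcd
    simpa [← add_mul, hcd] using this
  have e₁ := convexOn_add_mul_sub_le hc₁ (h₁ s t') s'
  have e₂ := convexOn_add_mul_sub_le hc₂ (h₂ s t) t'
  linarith

theorem extIntegral_reflect (f : ℝ → ℝ) : extIntegral a b (reflect a b f) = extIntegral a b f := by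
  have h : ∀ g : ℝ → ℝ≥0∞, ∫⁻ x in Ioo a b, g (a + b - x) = ∫⁻ x in Ioo a b, g x :=
    (measurePreserving_reflect a b).lintegral_comp_emb (measurableEmbedding_const_sub _)
  unfold extIntegral reflect
  rw [h fun x => ENNReal.ofReal (f x), h fun x => ENNReal.ofReal (-f x)]

theorem extIntegral_le_of_weak_limit (hab : a ≤ b) {L : ℝ → ℝ → ℝ → ℝ → ℝ} {L₁ L₂ : ℝ → ℝ → ℝ → ℝ}
    {m : ℝ} (hL : ContinuousOn (fun q : ℝ × ℝ × ℝ × ℝ => L q.1 q.2.1 q.2.2.1 q.2.2.2)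
      (univ ×ˢ univ ×ˢ univ ×ˢ Ioo a b))
    (hL₁ : ContinuousOn (fun q : ℝ × ℝ × ℝ => L₁ q.1 q.2.1 q.2.2) (univ ×ˢ univ ×ˢ Ioo a b))
    (hL₂ : ContinuousOn (fun q : ℝ × ℝ × ℝ => L₂ q.1 q.2.1 q.2.2) (univ ×ˢ univ ×ˢ Ioo a b))
    (htan : ∀ a₁ a₂ b₁ b₂ s : ℝ, ∀ x ∈ Ioo a b,
      L a₁ a₂ s x + L₁ a₁ s x * (b₁ - a₁) + L₂ a₂ s x * (b₂ - a₂) ≤ L b₁ b₂ s x)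
    (hm : ∀ a₁ a₂ s : ℝ, ∀ x ∈ Ioo a b, m ≤ L a₁ a₂ s x)
    {l : Filter ℕ} [l.NeBot] {v w u : ℕ → ℝ → ℝ} {v₀ w₀ u₀ : ℝ → ℝ}
    (hv₀ : Measurable v₀) (hw₀ : Measurable w₀) (hu₀ : ContinuousOn u₀ (Ioo a b))
    (hun : ∀ n, ContinuousOn (u n) (Ioo a b))
    (hvi₀ : IntegrableOn v₀ (Ioo a b)) (hwi₀ : IntegrableOn w₀ (Ioo a b))
    (hvi : ∀ n, IntegrableOn (v n) (Ioo a b)) (hwi : ∀ n, IntegrableOn (w n) (Ioo a b))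
    {K : ℝ} (hvK : ∀ n, ∫ x in Ioo a b, |v n x| ≤ K) (hwK : ∀ n, ∫ x in Ioo a b, |w n x| ≤ K)
    (hv : ∀ f : ℝ → ℝ, AEStronglyMeasurable f (volume.restrict (Ioo a b)) →
      (∃ C, ∀ x, |f x| ≤ C) →
      Tendsto (fun n => ∫ x in Ioo a b, f x * v n x) l (𝓝 (∫ x in Ioo a b, f x * v₀ x)))
    (hw : ∀ f : ℝ → ℝ, AEStronglyMeasurable f (volume.restrict (Ioo a b)) →
      (∃ C, ∀ x, |f x| ≤ C) →
      Tendsto (fun n => ∫ x in Ioo a b, f x * w n x) l (𝓝 (∫ x in Ioo a b, f x * w₀ x)))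
    (hu : ∀ c d, a < c → d < b → TendstoUniformlyOn u u₀ l (Icc c d)) {s : EReal}
    (hs : ∀ᶠ n in l, extIntegral a b (fun x => L (v n x) (w n x) (u n x) x) ≤ s) :
    extIntegral a b (fun x => L (v₀ x) (w₀ x) (u₀ x) x) ≤ s := by
  have hmeas : ∀ v w u : ℝ → ℝ, AEMeasurable v (volume.restrict (Ioo a b)) →
      AEMeasurable w (volume.restrict (Ioo a b)) → ContinuousOn u (Ioo a b) →
      AEMeasurable (fun x => L (v x) (w x) (u x) x) (volume.restrict (Ioo a b)) :=
    fun v w u hv hw hu =>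
      aemeasurable_comp_of_continuousOn hL hv hw (hu.aemeasurable measurableSet_Ioo)
  rw [extIntegral_eq_lintegral_add hab (hmeas _ _ _ hv₀.aemeasurable hw₀.aemeasurable hu₀)
    fun x hx => hm _ _ _ x hx]
  have hs' : ∀ᶠ n in l, ((∫⁻ x in Ioo a b,
      ENNReal.ofReal (L (v n x) (w n x) (u n x) x - m) : ℝ≥0∞) : EReal) +
      ((m * (b - a) : ℝ) : EReal) ≤ s := by
    filter_upwards [hs] with n hn
    rwa [extIntegral_eq_lintegral_add hab (hmeas _ _ _ (hvi n).aestronglyMeasurable.aemeasurable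
      (hwi n).aestronglyMeasurable.aemeasurable (hun n)) fun x hx => hm _ _ _ x hx] at hn
  exact coe_add_coe_le_of_eventually (fun r hr => lintegral_le_of_weak_limit hL hL₁ hL₂ htan hm
    hv₀ hw₀ hu₀ hvi₀ hwi₀ hvi hwi hvK hwK hv hw hu hr) hs'

/-- Existence of a minimizer for energies that involve the left derivative only. -/
theorem exists_minimizer_left (hab : a < b) (hα0 : 0 < α) (hα1 : α < 1) (hp : 1 < p)
    (hαp : 1 < α * p) (lam : ℝ) {F F₁ : ℝ → ℝ → ℝ → ℝ}
    (hF : ContinuousOn (fun q : ℝ × ℝ × ℝ => F q.1 q.2.1 q.2.2) (univ ×ˢ univ ×ˢ Ioo a b))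
    (hF₁ : ContinuousOn (fun q : ℝ × ℝ × ℝ => F₁ q.1 q.2.1 q.2.2) (univ ×ˢ univ ×ˢ Ioo a b))
    (htan : ∀ r r' s : ℝ, ∀ x ∈ Ioo a b, F r s x + F₁ r s x * (r' - r) ≤ F r' s x)
    {k c₁ : ℝ} (hk : 0 < k) (hcoer : ∀ r s : ℝ, ∀ x ∈ Ioo a b, k * |r| ^ p - c₁ ≤ F r s x) :
    ∃ u ∈ {u | u ∈ (if lam = 0 then leftRingSobolev a b α p else leftSobolev a b α p) ∧
        HasLeftTrace a b u 0},
      ∀ v ∈ {u | u ∈ (if lam = 0 then leftRingSobolev a b α p else leftSobolev a b α p) ∧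
        HasLeftTrace a b u 0},
        extIntegral a b (fun x => F (leftWeakDeriv a b α u x) (u x) x) ≤
          extIntegral a b (fun x => F (leftWeakDeriv a b α v x) (v x) x) := by
  have hG : ∀ F : ℝ → ℝ → ℝ → ℝ,
      ContinuousOn (fun q : ℝ × ℝ × ℝ => F q.1 q.2.1 q.2.2) (univ ×ˢ univ ×ˢ Ioo a b) →
      ContinuousOn (fun q : ℝ × ℝ × ℝ × ℝ => F q.1 q.2.2.1 q.2.2.2)
        (univ ×ˢ univ ×ˢ univ ×ˢ Ioo a b) := by
    intro F hF
    refine hF.comp (f := fun q : ℝ × ℝ × ℝ × ℝ => (q.1, q.2.2.1, q.2.2.2)) (by fun_prop) ?_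
    rintro ⟨s, t, r, x⟩ ⟨-, -, -, hx⟩
    exact ⟨trivial, trivial, hx⟩
  have hsub : ∀ u, u ∈ (if lam = 0 then leftRingSobolev a b α p else leftSobolev a b α p) →
      u ∈ leftSobolev a b α p := by
    intro u hu
    split_ifs at hu with h
    · exact hu.1
    · exact hu
  have hmem : ∀ (C : ℝ) (v : ℝ → ℝ), MemLpOn a b p v → leftRepr a α C v b = 0 →
      (C = 0 ∨ MemLpOn a b p fun x => (x - a) ^ (α - 1)) → (lam = 0 → C = 0) →
      leftRepr a α C v ∈ {u | u ∈ (if lam = 0 then leftRingSobolev a b α p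
        else leftSobolev a b α p) ∧ HasLeftTrace a b u 0} := by
    intro C v hv hb hC hlam
    have h1 := mem_leftSobolev_of_ae_eq_leftRepr hab hα0 hα1 hp hαp hv hC (ae_eq_refl _)
    refine ⟨?_, ?_⟩
    · split_ifs with h
      · refine ⟨h1, ?_⟩
        obtain rfl := hlam h
        exact hasLeftConst_zero_of_ae_eq_leftRepr hab hα0 hα1 hp hv (ae_eq_refl _)
      · exact h1
    · have := hasLeftTrace_of_ae_eq_leftRepr hp hαp hα0 hv (ae_eq_refl (leftRepr a α C v))
      rwa [hb] at this
  -- The zero function shows that the class is nonempty.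
  refine exists_isMinOn_of_sequential ⟨leftRepr a α 0 0, hmem 0 0 MemLp.zero ?_ (Or.inl rfl)
    fun _ => rfl⟩ (fun u => extIntegral a b fun x => F (leftWeakDeriv a b α u x) (u x) x)
    (l := hyperfilter ℕ) Nat.hyperfilter_le_atTop fun u hu hbd => ?_
  · simp [leftRepr, leftRLIntegral]
  obtain ⟨t, ht⟩ := hbd
  have hrep := fun n => exists_ae_eq_leftRepr hab hα0 hα1 hp (hsub _ (hu n).1)
  obtain ⟨M, hM, hMb⟩ := exists_lintegral_rpow_le_of_extIntegral_le (p := p) (c₁ := c₁) (t := t)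
    hab.le (by linarith) hk
  have hb : ∀ n, ∫⁻ x in Ioo a b, ‖leftWeakDeriv a b α (u n) x‖ₑ ^ p ≤ M := fun n =>
    hMb _ _ (aemeasurable_comp_of_continuousOn (hG F hF) (hrep n).2.1.1.aemeasurable
      (w := fun _ => 0) aemeasurable_const (hrep n).1.1.aestronglyMeasurable.aemeasurable)
      (fun x hx => hcoer _ _ x hx) (ht n)
  obtain ⟨v₀, C, C₀, hv₀m, hv₀, hweak, hC, hvp, hunif, hb₀, hC₀, hring, -⟩ :=
    exists_limit_leftSobolev hab hα0 hα1 hp hαp (hyperfilter ℕ) (fun n => hsub _ (hu n).1)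
      (fun n => (hu n).2) hM hb
  have hmem₀ := hmem C₀ v₀ hv₀ hb₀ hC₀ fun h => hring fun n => by
    have := (hu n).1
    rw [if_pos h] at this
    exact this.2
  refine ⟨_, hmem₀, fun s hs => ?_⟩
  have hD := (isLeftWeakDeriv_leftRepr hab hα0 hα1 hp hv₀
    (ae_eq_refl (leftRepr a α C₀ v₀))).leftWeakDeriv_ae_eq
  obtain ⟨K, hK⟩ := exists_integral_abs_le (a := a) (b := b) hp hM
  have e₀ : extIntegral a b (fun x => F (leftWeakDeriv a b α (leftRepr a α C₀ v₀) x)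
      (leftRepr a α C₀ v₀ x) x) = extIntegral a b (fun x => F (v₀ x) (leftRepr a α C₀ v₀ x) x) :=
    extIntegral_congr_ae (hD.mono fun x hx => by simp only [hx])
  rw [e₀]
  have hcont : ∀ C v, MemLpOn a b p v → ContinuousOn (leftRepr a α C v) (Ioo a b) :=
    fun C v hv => (continuousOn_leftRepr hp hαp hα0 hv C).mono Ioo_subset_Ioc_self
  -- The semicontinuity result for two derivatives is used with the second one identically zero. The
  -- functions enter through their continuous versions `leftRepr`.
  refine extIntegral_le_of_weak_limit (L := fun r _ s x => F r s x) (L₁ := F₁)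
    (L₂ := fun _ _ _ => 0) (m := -c₁) hab.le (hG F hF) hF₁ continuousOn_const ?_ ?_ hv₀m
    (measurable_const (a := (0 : ℝ)))
    (hcont C₀ v₀ hv₀) (fun n => hcont (C n) _ (hvp n)) (hv₀.integrableOn hp)
    (integrable_const (0 : ℝ)) (fun n => (hvp n).integrableOn hp) (w := fun _ _ => 0)
    (fun n => integrable_const (0 : ℝ)) (K := max K 0)
    (fun n => (hK _ (hvp n) (hb n)).trans (le_max_left _ _)) (fun n => by simp) hweak
    (fun f _ _ => by simp) hunif ?_
  · intro r _ r' _ s x hx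
    simpa using htan r r' s x hx
  · intro r _ s x hx
    refine le_trans ?_ (hcoer r s x hx)
    have : 0 ≤ k * |r| ^ p := mul_nonneg hk.le (Real.rpow_nonneg (abs_nonneg _) _)
    linarith
  · filter_upwards [hs] with n hn
    refine le_trans (le_of_eq (extIntegral_congr_ae ((hC n).mono fun x hx => ?_))) hn
    simp only [← hx]

/-- Existence of a minimizer for energies that involve both derivatives. -/
theorem exists_minimizer_both (hab : a < b) (hα0 : 0 < α) (hα1 : α < 1) (hp : 1 < p)
    (hαp : 1 < α * p) {L : ℝ → ℝ → ℝ → ℝ → ℝ} {L₁ L₂ : ℝ → ℝ → ℝ → ℝ}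
    (hL : ContinuousOn (fun q : ℝ × ℝ × ℝ × ℝ => L q.1 q.2.1 q.2.2.1 q.2.2.2)
      (univ ×ˢ univ ×ˢ univ ×ˢ Ioo a b))
    (hL₁ : ContinuousOn (fun q : ℝ × ℝ × ℝ => L₁ q.1 q.2.1 q.2.2) (univ ×ˢ univ ×ˢ Ioo a b))
    (hL₂ : ContinuousOn (fun q : ℝ × ℝ × ℝ => L₂ q.1 q.2.1 q.2.2) (univ ×ˢ univ ×ˢ Ioo a b))
    (htan : ∀ a₁ a₂ b₁ b₂ s : ℝ, ∀ x ∈ Ioo a b,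
      L a₁ a₂ s x + L₁ a₁ s x * (b₁ - a₁) + L₂ a₂ s x * (b₂ - a₂) ≤ L b₁ b₂ s x)
    {k c₁ : ℝ} (hk : 0 < k)
    (hcoer₁ : ∀ a₁ a₂ s : ℝ, ∀ x ∈ Ioo a b, k * |a₁| ^ p - c₁ ≤ L a₁ a₂ s x)
    (hcoer₂ : ∀ a₁ a₂ s : ℝ, ∀ x ∈ Ioo a b, k * |a₂| ^ p - c₁ ≤ L a₁ a₂ s x) :
    ∃ u ∈ {u | u ∈ leftSobolev a b α p ∩ rightSobolev a b α p ∧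
        HasLeftTrace a b u 0 ∧ HasRightTrace a b u 0},
      ∀ v ∈ {u | u ∈ leftSobolev a b α p ∩ rightSobolev a b α p ∧
        HasLeftTrace a b u 0 ∧ HasRightTrace a b u 0},
        energy a b α L u ≤ energy a b α L v := by
  have hmem : ∀ v w : ℝ → ℝ, MemLpOn a b p v → MemLpOn a b p w → leftRepr a α 0 v b = 0 →
      leftRepr a α 0 w b = 0 →
      reflect a b (leftRepr a α 0 v) =ᵐ[volume.restrict (Ioo a b)] leftRepr a α 0 w →
      leftRepr a α 0 v ∈ {u | u ∈ leftSobolev a b α p ∩ rightSobolev a b α p ∧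
        HasLeftTrace a b u 0 ∧ HasRightTrace a b u 0} := by
    intro v w hv hw hvb hwb hvw
    have h1 := mem_leftSobolev_of_ae_eq_leftRepr hab hα0 hα1 hp hαp hv (Or.inl rfl)
      (ae_eq_refl (leftRepr a α 0 v))
    have h2 := mem_leftSobolev_of_ae_eq_leftRepr hab hα0 hα1 hp hαp hw (Or.inl rfl) hvw
    have h3 := hasLeftTrace_of_ae_eq_leftRepr hp hαp hα0 hv (ae_eq_refl (leftRepr a α 0 v))
    have h4 := (hasLeftTrace_of_ae_eq_leftRepr hp hαp hα0 hw hvw).reflect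
    rw [hvb] at h3
    rw [hwb, reflect_reflect] at h4
    exact ⟨⟨h1, reflect_mem_leftSobolev_iff.1 h2⟩, h3, h4⟩
  have hzero : leftRepr a α 0 0 = 0 := by
    ext x
    simp [leftRepr, leftRLIntegral]
  refine exists_isMinOn_of_sequential ⟨leftRepr a α 0 0, hmem 0 0 MemLp.zero MemLp.zero
    (by simp [hzero]) (by simp [hzero]) ?_⟩ (energy a b α L)
    (l := hyperfilter ℕ) Nat.hyperfilter_le_atTop fun u hu hbd => ?_
  · rw [hzero]
    exact ae_eq_refl _
  obtain ⟨t, ht⟩ := hbd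
  have hul : ∀ n, u n ∈ leftSobolev a b α p := fun n => (hu n).1.1
  have hur : ∀ n, reflect a b (u n) ∈ leftSobolev a b α p := fun n =>
    reflect_mem_leftSobolev_iff.2 (hu n).1.2
  have hrep := fun n => exists_ae_eq_leftRepr hab hα0 hα1 hp (hul n)
  have hrep' := fun n => exists_ae_eq_leftRepr hab hα0 hα1 hp (hur n)
  have hwae := fun n => rightWeakDeriv_ae_eq_reflect (hu n).1.2
  have hwp : ∀ n, MemLpOn a b p (rightWeakDeriv a b α (u n)) := fun n =>
    (hrep' n).2.1.reflect.congr (hwae n).symm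
  obtain ⟨M, hM, hMb⟩ := exists_lintegral_rpow_le_of_extIntegral_le (p := p) (c₁ := c₁) (t := t)
    hab.le (by linarith) hk
  have hmeas := fun n => aemeasurable_comp_of_continuousOn hL (hrep n).2.1.1.aemeasurable
    (hwp n).1.aemeasurable (hrep n).1.1.aestronglyMeasurable.aemeasurable
  have hb : ∀ n, ∫⁻ x in Ioo a b, ‖leftWeakDeriv a b α (u n) x‖ₑ ^ p ≤ M := fun n =>
    hMb _ _ (hmeas n) (fun x hx => hcoer₁ _ _ _ x hx) (ht n)
  have hb' : ∀ n, ∫⁻ x in Ioo a b, ‖rightWeakDeriv a b α (u n) x‖ₑ ^ p ≤ M := fun n =>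
    hMb _ _ (hmeas n) (fun x hx => hcoer₂ _ _ _ x hx) (ht n)
  have hbr : ∀ n, ∫⁻ x in Ioo a b, ‖leftWeakDeriv a b α (reflect a b (u n)) x‖ₑ ^ p ≤ M := by
    intro n
    refine le_trans (le_of_eq ?_) (hb' n)
    rw [← (measurePreserving_reflect a b).lintegral_comp_emb (measurableEmbedding_const_sub _)]
    exact lintegral_congr_ae ((hwae n).mono fun x hx => by simp only [hx, reflect])
  obtain ⟨v₀, C, C₀, hv₀m, hv₀, hweak, hC, hvp, hunif, hbv, -, -, hC₀⟩ :=
    exists_limit_leftSobolev hab hα0 hα1 hp hαp (hyperfilter ℕ) hul (fun n => (hu n).2.1) hM hb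
  obtain ⟨w₀, C', C₀', hw₀m, hw₀, hweak', hC', hvp', hunif', hbw, -, -, hC₀'⟩ :=
    exists_limit_leftSobolev hab hα0 hα1 hp hαp (hyperfilter ℕ) hur
      (fun n => (hu n).2.2.reflect) hM hbr
  -- The trace at `a` excludes the singular term of `u n` at `a`; after reflection, the trace at `b`
  -- does the same for the right representation.
  obtain rfl := hC₀ fun n => (hu n).2.2
  obtain rfl := hC₀' fun n => (hu n).2.1.reflect
  have hcont : ∀ C v, MemLpOn a b p v → ContinuousOn (leftRepr a α C v) (Ioo a b) :=
    fun C v hv => (continuousOn_leftRepr hp hαp hα0 hv C).mono Ioo_subset_Ioc_self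
  -- The left and the reflected right representations are continuous versions of the same functions,
  -- so their pointwise limits agree. Hence `v₀` and the reflection of `w₀` are derivatives of one
  -- limit function.
  have heq : EqOn (reflect a b (leftRepr a α 0 v₀)) (leftRepr a α 0 w₀) (Ioo a b) := by
    intro x hx
    have hx' := reflect_mem_Ioo hx
    have l1 := (hunif _ _ hx'.1 hx'.2).tendsto_at (left_mem_Icc.2 le_rfl)
    have l2 := (hunif' _ _ hx.1 hx.2).tendsto_at (left_mem_Icc.2 le_rfl)
    refine tendsto_nhds_unique l1 (l2.congr fun n => ?_)
    have h1 : reflect a b (leftRepr a α (C n) (leftWeakDeriv a b α (u n)))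
        =ᵐ[volume.restrict (Ioo a b)]
        leftRepr a α (C' n) (leftWeakDeriv a b α (reflect a b (u n))) :=
      (ae_eq_reflect (hC n)).symm.trans (hC' n)
    exact (eqOn_Ioo_of_ae_eq_restrict h1 (continuousOn_reflect (hcont _ _ (hvp n))
      fun y hy => reflect_mem_Ioo hy) (hcont _ _ (hvp' n)) hx).symm
  have hae : reflect a b (leftRepr a α 0 v₀) =ᵐ[volume.restrict (Ioo a b)] leftRepr a α 0 w₀ :=
    (ae_restrict_mem measurableSet_Ioo).mono heq
  have hmem₀ := hmem v₀ w₀ hv₀ hw₀ hbv hbw hae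
  refine ⟨_, hmem₀, fun s hs => ?_⟩
  have hD := (isLeftWeakDeriv_leftRepr hab hα0 hα1 hp hv₀
    (ae_eq_refl (leftRepr a α 0 v₀))).leftWeakDeriv_ae_eq
  have hD' : rightWeakDeriv a b α (leftRepr a α 0 v₀) =ᵐ[volume.restrict (Ioo a b)]
      reflect a b w₀ :=
    (rightWeakDeriv_ae_eq_reflect hmem₀.1.2).trans (ae_eq_reflect
      (isLeftWeakDeriv_leftRepr hab hα0 hα1 hp hw₀ hae).leftWeakDeriv_ae_eq)
  obtain ⟨K, hK⟩ := exists_integral_abs_le (a := a) (b := b) hp hM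
  have e₀ : energy a b α L (leftRepr a α 0 v₀) =
      extIntegral a b (fun x => L (v₀ x) (reflect a b w₀ x) (leftRepr a α 0 v₀ x) x) :=
    extIntegral_congr_ae ((hD.and hD').mono fun x hx => by simp only [hx.1, hx.2])
  rw [e₀]
  have hw₀rm : Measurable (reflect a b w₀) := hw₀m.comp (measurable_const.sub measurable_id)
  have hw₀r : MemLpOn a b p (reflect a b w₀) := hw₀.reflect
  refine extIntegral_le_of_weak_limit (m := -c₁) hab.le hL hL₁ hL₂ htan
    ?_ hv₀m hw₀rm
    (hcont 0 v₀ hv₀) (fun n => hcont (C n) _ (hvp n)) (hv₀.integrableOn hp)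
    (hw₀r.integrableOn hp) (fun n => (hvp n).integrableOn hp)
    (fun n => (hwp n).integrableOn hp)
    (fun n => hK _ (hvp n) (hb n)) (fun n => hK _ (hwp n) (hb' n)) hweak ?_ hunif ?_
  · intro a₁ a₂ s x hx
    refine le_trans ?_ (hcoer₁ a₁ a₂ s x hx)
    have : 0 ≤ k * |a₁| ^ p := mul_nonneg hk.le (Real.rpow_nonneg (abs_nonneg _) _)
    linarith
  -- Weak convergence of the right derivatives is that of the left derivatives of the reflected
  -- functions, tested with the reflected `f`.
  · rintro f hf ⟨K', hK'⟩
    have h1 := hweak' (reflect a b f)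
      (hf.comp_measurePreserving (measurePreserving_reflect a b)) ⟨K', fun x => hK' _⟩
    have e1 : ∫ x in Ioo a b, f x * reflect a b w₀ x = ∫ x in Ioo a b, reflect a b f x * w₀ x := by
      rw [← setIntegral_reflect]
      simp [reflect]
    have e2 : ∀ n, ∫ x in Ioo a b, f x * rightWeakDeriv a b α (u n) x =
        ∫ x in Ioo a b, reflect a b f x * leftWeakDeriv a b α (reflect a b (u n)) x := by
      intro n
      rw [← setIntegral_reflect (fun x => reflect a b f x * _)]
      refine integral_congr_ae ((hwae n).mono fun x hx => ?_)
      simp only [hx, reflect, sub_sub_cancel]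
    rw [e1]
    simp_rw [e2]
    exact h1
  · filter_upwards [hs] with n hn
    refine le_trans (le_of_eq (extIntegral_congr_ae ((hC n).mono fun x hx => ?_))) hn
    simp only [← hx]

end Existence

end FracVar

end

/-! ### Assembly: `θ = 0`, `θ = 1` and `0 < θ < 1` -/

theorem mainTheorem1 (a b α p θ lam : ℝ) (hab : a < b)
    (hα0 : 0 < α) (hα1 : α < 1) (hp : 1 < p) (hαp : 1 < α * p)
    (hθ0 : 0 ≤ θ) (hθ1 : θ ≤ 1) (hlam : lam = 0 ∨ lam = 1)
    (L : ℝ → ℝ → ℝ → ℝ → ℝ)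
    -- `L` depends on the left (right) derivative only through its multiple by `1 - θ` (by `θ`)
    (hform : ∃ Lp : ℝ → ℝ → ℝ → ℝ → ℝ, ∀ a₁ a₂ s : ℝ, ∀ x ∈ Ioo a b,
      L a₁ a₂ s x = Lp ((1 - θ) * a₁) (θ * a₂) s x)
    -- regularity on `ℝ³ × (a, b)`
    (hsmooth : ContDiffOn ℝ 1 (fun q : ℝ × ℝ × ℝ × ℝ => L q.1 q.2.1 q.2.2.1 q.2.2.2)
      (univ ×ˢ univ ×ˢ univ ×ˢ Ioo a b))
    -- bounded below
    (hbdd : ∃ m : ℝ, ∀ a₁ a₂ s : ℝ, ∀ x ∈ Ioo a b, m ≤ L a₁ a₂ s x)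
    -- convex in the first two arguments
    (hconv : ∀ s : ℝ, ∀ x ∈ Ioo a b, ConvexOn ℝ univ (fun q : ℝ × ℝ => L q.1 q.2 s x))
    -- structure conditions: separated partial derivatives
    (L₁ L₂ : ℝ → ℝ → ℝ → ℝ)
    (hL₁ : ContinuousOn (fun q : ℝ × ℝ × ℝ => L₁ q.1 q.2.1 q.2.2) (univ ×ˢ univ ×ˢ Ioo a b))
    (hL₂ : ContinuousOn (fun q : ℝ × ℝ × ℝ => L₂ q.1 q.2.1 q.2.2) (univ ×ˢ univ ×ˢ Ioo a b))
    (hstr₁ : ∀ a₁ a₂ s : ℝ, ∀ x ∈ Ioo a b, HasDerivAt (fun t => L t a₂ s x) (L₁ a₁ s x) a₁)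
    (hstr₂ : ∀ a₁ a₂ s : ℝ, ∀ x ∈ Ioo a b, HasDerivAt (fun t => L a₁ t s x) (L₂ a₂ s x) a₂)
    -- coercivity
    (c₀ c₁ : ℝ) (hc₀ : 0 < c₀) (hc₁ : 0 ≤ c₁)
    (hcoer : ∀ a₁ a₂ s : ℝ, ∀ x ∈ Ioo a b,
      c₀ / 2 * ((1 - θ) * |a₁| ^ p + θ * |a₂| ^ p + lam * |s| ^ p) - c₁ ≤ L a₁ a₂ s x) :
    ∃ u ∈ FracVar.zeroTraceSpace a b α p θ lam,
      ∀ v ∈ FracVar.zeroTraceSpace a b α p θ lam,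
        FracVar.energy a b α L u ≤ FracVar.energy a b α L v := by
  have hL := hsmooth.continuousOn
  have hp0 : 0 < p := by linarith
  have htan : ∀ a₁ a₂ b₁ b₂ s : ℝ, ∀ x ∈ Ioo a b,
      L a₁ a₂ s x + L₁ a₁ s x * (b₁ - a₁) + L₂ a₂ s x * (b₂ - a₂) ≤ L b₁ b₂ s x :=
    fun a₁ a₂ b₁ b₂ s x hx => FracVar.add_mul_sub_add_mul_sub_le (hconv s x hx)
      (g₁ := fun r => L₁ r s x) (g₂ := fun r => L₂ r s x) (fun r t => hstr₁ r t s x hx)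
      (fun r t => hstr₂ r t s x hx) a₁ a₂ b₁ b₂
  have hlam0 : 0 ≤ lam := by rcases hlam with rfl | rfl <;> norm_num
  -- All terms of the coercivity bound are nonnegative, so either derivative term may be kept alone.
  have hcoer' : ∀ a₁ a₂ s : ℝ, ∀ x ∈ Ioo a b,
      c₀ / 2 * (1 - θ) * |a₁| ^ p - c₁ ≤ L a₁ a₂ s x ∧
      c₀ / 2 * θ * |a₂| ^ p - c₁ ≤ L a₁ a₂ s x := by
    intro a₁ a₂ s x hx
    have h := hcoer a₁ a₂ s x hx
    have h1 : 0 ≤ c₀ / 2 * ((1 - θ) * |a₁| ^ p) := by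
      have : 0 ≤ 1 - θ := by linarith
      positivity
    have h2 : 0 ≤ c₀ / 2 * (θ * |a₂| ^ p) := by positivity
    have h3 : 0 ≤ c₀ / 2 * (lam * |s| ^ p) := by positivity
    constructor <;> linarith
  obtain ⟨Lp, hLp⟩ := hform
  rcases hθ0.eq_or_lt with rfl | hθ0
  -- For `θ = 0` the second slot can be frozen at 0, so it does not matter whether a right weak
  -- derivative exists.
  · have hred : ∀ a₁ a₂ s : ℝ, ∀ x ∈ Ioo a b, L a₁ a₂ s x = L a₁ 0 s x := by
      intro a₁ a₂ s x hx
      rw [hLp a₁ a₂ s x hx, hLp a₁ 0 s x hx]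
      simp
    have hF : ContinuousOn (fun q : ℝ × ℝ × ℝ => L q.1 0 q.2.1 q.2.2)
        (univ ×ˢ univ ×ˢ Ioo a b) := by
      refine hL.comp (f := fun q : ℝ × ℝ × ℝ => (q.1, (0 : ℝ), q.2.1, q.2.2)) (by fun_prop) ?_
      rintro ⟨s, r, x⟩ ⟨-, -, hx⟩
      exact ⟨trivial, trivial, trivial, hx⟩
    obtain ⟨u, hu, hmin⟩ := FracVar.exists_minimizer_left hab hα0 hα1 hp hαp lam
      (F := fun r s x => L r 0 s x) hF hL₁
      (fun r r' s x hx => by simpa using htan r 0 r' 0 s x hx) (k := c₀ / 2) (by linarith)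
      (fun r s x hx => by simpa using (hcoer' r 0 s x hx).1)
    have hset : FracVar.zeroTraceSpace a b α p 0 lam =
        {u | u ∈ (if lam = 0 then FracVar.leftRingSobolev a b α p
          else FracVar.leftSobolev a b α p) ∧ FracVar.HasLeftTrace a b u 0} := by
      simp [FracVar.zeroTraceSpace, FracVar.fracSpace]
    have hE : ∀ v, FracVar.energy a b α L v = FracVar.extIntegral a b
        (fun x => L (FracVar.leftWeakDeriv a b α v x) 0 (v x) x) := fun v => by
      refine FracVar.extIntegral_congr_ae ?_
      filter_upwards [ae_restrict_mem measurableSet_Ioo] with x hx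
      exact hred _ _ _ x hx
    rw [hset]
    simp_rw [hE]
    exact ⟨u, hu, hmin⟩
  rcases hθ1.eq_or_lt with rfl | hθ1
  -- For `θ = 1` the problem is reflected: the integrand becomes `L 0 r s (a + b - x)`, and the
  -- spaces, traces and energy correspond under `reflect`.
  · have hred : ∀ a₁ a₂ s : ℝ, ∀ x ∈ Ioo a b, L a₁ a₂ s x = L 0 a₂ s x := by
      intro a₁ a₂ s x hx
      rw [hLp a₁ a₂ s x hx, hLp 0 a₂ s x hx]
      simp
    have hF : ContinuousOn (fun q : ℝ × ℝ × ℝ => L 0 q.1 q.2.1 (a + b - q.2.2))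
        (univ ×ˢ univ ×ˢ Ioo a b) := by
      refine hL.comp (f := fun q : ℝ × ℝ × ℝ => ((0 : ℝ), q.1, q.2.1, a + b - q.2.2))
        (by fun_prop) ?_
      rintro ⟨s, r, x⟩ ⟨-, -, hx⟩
      exact ⟨trivial, trivial, trivial, FracVar.reflect_mem_Ioo hx⟩
    have hF₁ : ContinuousOn (fun q : ℝ × ℝ × ℝ => L₂ q.1 q.2.1 (a + b - q.2.2))
        (univ ×ˢ univ ×ˢ Ioo a b) := by
      refine hL₂.comp (f := fun q : ℝ × ℝ × ℝ => (q.1, q.2.1, a + b - q.2.2)) (by fun_prop) ?_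
      rintro ⟨s, r, x⟩ ⟨-, -, hx⟩
      exact ⟨trivial, trivial, FracVar.reflect_mem_Ioo hx⟩
    obtain ⟨u, hu, hmin⟩ := FracVar.exists_minimizer_left hab hα0 hα1 hp hαp lam
      (F := fun r s x => L 0 r s (a + b - x)) (F₁ := fun r s x => L₂ r s (a + b - x)) hF hF₁
      (fun r r' s x hx => by
        simpa using htan 0 r 0 r' s (a + b - x) (FracVar.reflect_mem_Ioo hx))
      (k := c₀ / 2) (by linarith) (fun r s x hx => by
        simpa using (hcoer' 0 r s (a + b - x) (FracVar.reflect_mem_Ioo hx)).2)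
    have hset : ∀ v, v ∈ FracVar.zeroTraceSpace a b α p 1 lam ↔
        FracVar.reflect a b v ∈ {u | u ∈ (if lam = 0 then FracVar.leftRingSobolev a b α p
          else FracVar.leftSobolev a b α p) ∧ FracVar.HasLeftTrace a b u 0} := by
      intro v
      have h1 : FracVar.HasLeftTrace a b (FracVar.reflect a b v) 0 ↔
          FracVar.HasRightTrace a b v 0 :=
        ⟨fun h => by simpa using h.reflect, fun h => h.reflect⟩
      rcases hlam with rfl | rfl <;>
        simp [FracVar.zeroTraceSpace, FracVar.fracSpace, FracVar.leftRingSobolev,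
          FracVar.rightRingSobolev, FracVar.reflect_mem_leftSobolev_iff,
          FracVar.hasLeftConst_reflect_iff, h1]
    have hE : ∀ v ∈ FracVar.zeroTraceSpace a b α p 1 lam, FracVar.energy a b α L v =
        FracVar.extIntegral a b (fun x => L 0 (FracVar.leftWeakDeriv a b α
          (FracVar.reflect a b v) x) (FracVar.reflect a b v x) (a + b - x)) := by
      intro v hv
      have hvr : v ∈ FracVar.rightSobolev a b α p := by
        have := ((hset v).1 hv).1
        split_ifs at this with h
        · exact FracVar.reflect_mem_leftSobolev_iff.1 this.1
        · exact FracVar.reflect_mem_leftSobolev_iff.1 this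
      rw [← FracVar.extIntegral_reflect (a := a) (b := b)]
      refine FracVar.extIntegral_congr_ae ?_
      filter_upwards [ae_restrict_mem measurableSet_Ioo,
        FracVar.rightWeakDeriv_ae_eq_reflect hvr] with x hx hx'
      rw [hred _ _ _ x hx, hx']
      simp [FracVar.reflect]
    have hu' : FracVar.reflect a b u ∈ FracVar.zeroTraceSpace a b α p 1 lam :=
      (hset _).2 (by rwa [FracVar.reflect_reflect])
    refine ⟨_, hu', fun v hv => ?_⟩
    rw [hE _ hu', hE v hv, FracVar.reflect_reflect]
    exact hmin _ ((hset v).1 hv)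
  -- For `0 < θ < 1` both weights are positive, and the smaller one gives a common coercivity
  -- constant for the two derivatives.
  · have hk : 0 < c₀ / 2 * min (1 - θ) θ :=
      mul_pos (by linarith) (lt_min (by linarith) hθ0)
    obtain ⟨u, hu, hmin⟩ := FracVar.exists_minimizer_both hab hα0 hα1 hp hαp hL hL₁ hL₂ htan hk
      (c₁ := c₁)
      (fun a₁ a₂ s x hx => by
        refine le_trans ?_ (hcoer' a₁ a₂ s x hx).1
        gcongr
        exact min_le_left _ _)
      (fun a₁ a₂ s x hx => by
        refine le_trans ?_ (hcoer' a₁ a₂ s x hx).2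
        gcongr
        exact min_le_right _ _)
    have hset : FracVar.zeroTraceSpace a b α p θ lam =
        {u | u ∈ FracVar.leftSobolev a b α p ∩ FracVar.rightSobolev a b α p ∧
          FracVar.HasLeftTrace a b u 0 ∧ FracVar.HasRightTrace a b u 0} := by
      simp [FracVar.zeroTraceSpace, FracVar.fracSpace, hθ0.ne', hθ1.ne]
    rw [hset]
    exact ⟨u, hu, hmin⟩
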